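/- Let $f:\mathbb P^1\to\mathbb P^1$ be a rational map of degree $d\ge 1$ over $\mathbb C$, that is $f=p/q$ with coprime polynomials $p,q$ and $d=\max(\deg p,\deg q)$, regarded as a holomorphic self-map of the Riemann sphere $\mathbb P^1=\mathbb C\cup\{\infty\}$. An $f$-sheaf is a sheaf $F$ of $\mathcal O_{\mathbb P^1}$-modules together with an $\mathcal O_{\mathbb P^1}$-linear map $f^*F\to F$ (equivalently $F\to f_*F$); a map of $f$-sheaves is an $\mathcal O_{\mathbb P^1}$-linear map which commutes with these. The $f$-sheaves form a $\mathbb C$-linear abelian category, and $\mathrm{Ext}^q_{\mathbb P^1/f}$ denotes its Ext groups. View the sheaf of holomorphic functions $\mathcal O=\mathcal O_{\mathbb P^1}$ and the sheaf of holomorphic one-forms $\Omega=\Omega_{\mathbb P^1}$ as $f$-sheaves through the pullback of functions, respectively of forms, along $f$. Then: 1. $\mathrm{Ext}^q_{\mathbb P^1/f}(\Omega,\mathcal O)$ is a finite-dimensional complex vector space for all $q\ge 0$. 2. If $f$ is not the identity, then $$\dim_{\mathbb C}\mathrm{Ext}^q_{\mathbb P^1/f}(\Omega,\mathcal O)=\begin{cases}1,&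 d=1,\ q=0\text{ or }1,\\ 2d-2,& d>1,\ q=1,\\ 0,&\text{otherwise.}\end{cases}$$ 3. For all such $f$ (the identity included) $\mathbb P^1/f$ is smooth of the expected dimension, i.e. $\mathrm{Ext}^q_{\mathbb P^1/f}(\Omega,\mathcal O)=0$ for all $q\ge 2$, and $$\dim_{\mathbb C}\mathrm{Ext}^1_{\mathbb P^1/f}(\Omega,\mathcal O)-\dim_{\mathbb C}\mathrm{Ext}^0_{\mathbb P^1/f}(\Omega,\mathcal O)=2d-2 .$$ 4. The map $f^*-df:\mathrm H^0(\mathbb P^1,T_{\mathbb P^1})\to \mathrm H^0(\mathbb P^1,f^*T_{\mathbb P^1})$ has a non-trivial kernel if and only if $d=1$; i.e. there is a non-zero holomorphic vector field $v$ on $\mathbb P^1$ with $v(f(x))=df_x(v(x))$ for all $x$ if and only if $d=1$. -/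

import Mathlib

open scoped Manifold ContDiff Topology
open Set Filter CategoryTheory Limits TopologicalSpace Opposite

namespace CategoryTheory.Endofunctor.Coalgebra

universe v u
variable {C : Type u} [Category.{v} C] [Abelian C] (T : C ⥤ C) [T.Additive]
  [PreservesFiniteLimits T]

variable {T}

set_option linter.unusedSectionVars false

@[simp] theorem zero_f' (A B : Coalgebra T) : (0 : A ⟶ B).f = 0 := rfl

/-- The kernel of a morphism of coalgebras, computed in the underlying category. -/
noncomputable def ker {A B : Coalgebra T} (f : A ⟶ B) : Coalgebra T where
  V := kernel f.f
  str := (KernelFork.mapIsLimit _ (kernelIsKernel f.f) T).lift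
    (KernelFork.ofι (kernel.ι f.f ≫ A.str) (by
      rw [Category.assoc, f.h, kernel.condition_assoc, zero_comp]))

theorem ker_str {A B : Coalgebra T} (f : A ⟶ B) :
    (ker f).str ≫ T.map (kernel.ι f.f) = kernel.ι f.f ≫ A.str :=
  (KernelFork.mapIsLimit _ (kernelIsKernel f.f) T).fac _ WalkingParallelPair.zero

/-- The inclusion of the kernel. -/
noncomputable def kerι {A B : Coalgebra T} (f : A ⟶ B) : ker f ⟶ A where
  f := kernel.ι f.f
  h := ker_str f

theorem kerι_comp {A B : Coalgebra T} (f : A ⟶ B) : kerι f ≫ f = 0 := by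
  ext; exact kernel.condition f.f

/-- The cokernel of a morphism of coalgebras, computed in the underlying category. -/
noncomputable def coker {A B : Coalgebra T} (f : A ⟶ B) : Coalgebra T where
  V := cokernel f.f
  str := cokernel.desc f.f (B.str ≫ T.map (cokernel.π f.f)) (by
    rw [← Category.assoc, ← f.h, Category.assoc, ← T.map_comp, cokernel.condition,
      T.map_zero, comp_zero])

/-- The projection to the cokernel. -/
noncomputable def cokerπ {A B : Coalgebra T} (f : A ⟶ B) : B ⟶ coker f where
  f := cokernel.π f.f
  h := (cokernel.π_desc _ _ _).symm

theorem comp_cokerπ {A B : Coalgebra T} (f : A ⟶ B) : f ≫ cokerπ f = 0 := by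
  ext; exact cokernel.condition f.f

theorem lift_hom {A B W : Coalgebra T} (f : A ⟶ B) [Mono f.f] (k : W ⟶ B) (l : W.V ⟶ A.V)
    (h : l ≫ f.f = k.f) : W.str ≫ T.map l = l ≫ A.str := by
  rw [← cancel_mono (T.map f.f), Category.assoc, ← T.map_comp, h, k.h, Category.assoc, f.h,
    ← Category.assoc, h]

theorem desc_hom {A B W : Coalgebra T} (f : A ⟶ B) [Epi f.f] (k : A ⟶ W) (l : B.V ⟶ W.V)
    (h : f.f ≫ l = k.f) : B.str ≫ T.map l = l ≫ W.str := by
  rw [← cancel_epi f.f, ← Category.assoc, ← f.h, Category.assoc, ← T.map_comp, h, k.h,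
    ← Category.assoc, h]

theorem comp_f_eq_zero {A B W : Coalgebra T} {f : A ⟶ B} {g : B ⟶ W} (h : f ≫ g = 0) :
    f.f ≫ g.f = 0 :=
  congrArg Hom.f h

instance : HasKernels (Coalgebra T) where
  has_limit {A B} f := by
    have : Mono (kerι f).f := inferInstanceAs (Mono (kernel.ι f.f))
    have : Mono (kerι f) := mono_of_mono _
    exact ⟨⟨⟨KernelFork.ofι (kerι f) (kerι_comp f), KernelFork.IsLimit.ofι _ _
      (fun {W} k hk => ⟨kernel.lift f.f k.f (comp_f_eq_zero hk),
        lift_hom (kerι f) k _ (kernel.lift_ι _ _ _)⟩)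
      (fun {W} k hk => Coalgebra.ext (kernel.lift_ι _ _ _))
      (fun {W} k hk m hm => (cancel_mono (kerι f)).1
        (hm.trans (Coalgebra.ext (kernel.lift_ι _ _ _).symm)))⟩⟩⟩

instance : HasCokernels (Coalgebra T) where
  has_colimit {A B} f := by
    have : Epi (cokerπ f).f := inferInstanceAs (Epi (cokernel.π f.f))
    have : Epi (cokerπ f) := epi_of_epi _
    exact ⟨⟨⟨CokernelCofork.ofπ (cokerπ f) (comp_cokerπ f), CokernelCofork.IsColimit.ofπ _ _
      (fun {W} k hk => ⟨cokernel.desc f.f k.f (comp_f_eq_zero hk),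
        desc_hom (cokerπ f) k _ (cokernel.π_desc _ _ _)⟩)
      (fun {W} k hk => Coalgebra.ext (cokernel.π_desc _ _ _))
      (fun {W} k hk m hm => (cancel_epi (cokerπ f)).1
        (hm.trans (Coalgebra.ext (cokernel.π_desc _ _ _).symm)))⟩⟩⟩

theorem mono_f {A B : Coalgebra T} (f : A ⟶ B) [Mono f] : Mono f.f :=
  Preadditive.mono_of_kernel_zero
    (congrArg Hom.f (zero_of_comp_mono f (kerι_comp f)))

theorem epi_f {A B : Coalgebra T} (f : A ⟶ B) [Epi f] : Epi f.f :=
  Preadditive.epi_of_cokernel_zero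
    (congrArg Hom.f (zero_of_epi_comp f (comp_cokerπ f)))

instance : HasBinaryBiproducts (Coalgebra T) where
  has_binary_biproduct A B := hasBinaryBiproduct_of_total
    { pt := ⟨A.V ⊞ B.V, biprod.desc (A.str ≫ T.map biprod.inl) (B.str ≫ T.map biprod.inr)⟩
      fst := ⟨biprod.fst, by ext <;> simp [← T.map_comp]⟩
      snd := ⟨biprod.snd, by ext <;> simp [← T.map_comp]⟩
      inl := ⟨biprod.inl, by simp⟩
      inr := ⟨biprod.inr, by simp⟩
      inl_fst := by ext; exact biprod.inl_fst
      inl_snd := by ext; exact biprod.inl_snd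
      inr_fst := by ext; exact biprod.inr_fst
      inr_snd := by ext; exact biprod.inr_snd }
    (by ext1; exact biprod.total)

instance : HasZeroObject (Coalgebra T) where
  zero := ⟨⟨(HasZeroObject.zero' C).zero, 0⟩,
    { unique_to := fun B => ⟨⟨⟨0⟩, fun g => by ext; exact (isZero_zero C).eq_of_src _ _⟩⟩
      unique_from := fun B => ⟨⟨⟨0⟩, fun g => by ext; exact (isZero_zero C).eq_of_tgt _ _⟩⟩ }⟩

noncomputable instance : Abelian (Coalgebra T) where
  has_finite_products := hasFiniteProducts_of_has_binary_and_terminal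
  normalMonoOfMono {A B} f _ := by
    have := mono_f f
    exact ⟨{
      Z := coker f
      g := cokerπ f
      w := comp_cokerπ f
      isLimit := KernelFork.IsLimit.ofι _ _
        (fun {W} k hk => ⟨Abelian.monoLift f.f k.f (comp_f_eq_zero hk),
          lift_hom f k _ (Abelian.monoLift_comp _ _ _)⟩)
        (fun {W} k hk => by ext; exact Abelian.monoLift_comp _ _ _)
        (fun {W} k hk m hm => by rw [← cancel_mono f, hm]; ext; exact (Abelian.monoLift_comp _ _ _).symm) }⟩
  normalEpiOfEpi {A B} f _ := by
    have := epi_f f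
    exact ⟨{
      W := ker f
      g := kerι f
      w := kerι_comp f
      isColimit := CokernelCofork.IsColimit.ofπ _ _
        (fun {W} k hk => ⟨Abelian.epiDesc f.f k.f (comp_f_eq_zero hk),
          desc_hom f k _ (Abelian.comp_epiDesc _ _ _)⟩)
        (fun {W} k hk => by ext; exact Abelian.comp_epiDesc _ _ _)
        (fun {W} k hk m hm => by rw [← cancel_epi f, hm]; ext; exact (Abelian.comp_epiDesc _ _ _).symm) }⟩

end CategoryTheory.Endofunctor.Coalgebra

/-- The Riemann sphere. -/
abbrev RiemannSphere : Type := OnePoint ℂ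

namespace RiemannSphere

open Classical in
/-- The inversion `z ↦ 1 / z` of the Riemann sphere. -/
noncomputable def inversion (x : RiemannSphere) : RiemannSphere :=
  x.elim ((0 : ℂ) : OnePoint ℂ) (fun z => if z = 0 then OnePoint.infty else ((z⁻¹ : ℂ) : OnePoint ℂ))

theorem inversion_infty : inversion OnePoint.infty = ((0 : ℂ) : OnePoint ℂ) := rfl

theorem inversion_zero : inversion ((0 : ℂ) : OnePoint ℂ) = OnePoint.infty := if_pos rfl

theorem inversion_coe {z : ℂ} (hz : z ≠ 0) :
    inversion (z : OnePoint ℂ) = ((z⁻¹ : ℂ) : OnePoint ℂ) := if_neg hz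

theorem inversion_inversion (x : RiemannSphere) : inversion (inversion x) = x := by
  induction x using OnePoint.rec with
  | infty => rw [inversion_infty, inversion_zero]
  | coe z =>
    by_cases hz : z = 0
    · rw [hz, inversion_zero, inversion_infty]
    · rw [inversion_coe hz, inversion_coe (inv_ne_zero hz), inv_inv]

theorem continuous_inversion : Continuous inversion := by
  rw [continuous_iff_continuousAt]
  intro x
  induction x using OnePoint.rec with
  | infty =>
    rw [OnePoint.continuousAt_infty', inversion_infty]
    have h : Tendsto (fun z : ℂ => ((z⁻¹ : ℂ) : OnePoint ℂ)) (coclosedCompact ℂ)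
        (𝓝 ((0 : ℂ) : OnePoint ℂ)) := by
      rw [coclosedCompact_eq_cocompact, ← Metric.cobounded_eq_cocompact]
      exact (OnePoint.continuous_coe.tendsto 0).comp tendsto_inv₀_cobounded
    refine h.congr' ?_
    have : ({0}ᶜ : Set ℂ) ∈ coclosedCompact ℂ := by
      rw [coclosedCompact_eq_cocompact]
      exact isCompact_singleton.compl_mem_cocompact
    filter_upwards [this] with z hz
    exact (inversion_coe hz).symm
  | coe z =>
    rw [OnePoint.continuousAt_coe]
    by_cases hz : z = 0
    · subst hz
      have h : Tendsto (fun z : ℂ => ((z⁻¹ : ℂ) : OnePoint ℂ)) (𝓝[≠] 0) (𝓝 OnePoint.infty) := by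
        refine OnePoint.tendsto_coe_infty.comp ?_
        rw [coclosedCompact_eq_cocompact, ← Metric.cobounded_eq_cocompact]
        exact tendsto_inv₀_nhdsNE_zero
      rw [← continuousWithinAt_compl_self, ContinuousWithinAt, Function.comp_apply, inversion_zero]
      refine h.congr' ?_
      filter_upwards [self_mem_nhdsWithin] with z hz
      exact (inversion_coe hz).symm
    · have h : ContinuousAt (fun z : ℂ => ((z⁻¹ : ℂ) : OnePoint ℂ)) z :=
        OnePoint.continuous_coe.continuousAt.comp (continuousAt_inv₀ hz)
      refine h.congr ?_
      filter_upwards [isOpen_ne.mem_nhds hz] with w hw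
      exact (inversion_coe hw).symm

/-- The inversion, as a homeomorphism. -/
noncomputable def inversionHomeomorph : RiemannSphere ≃ₜ RiemannSphere where
  toFun := inversion
  invFun := inversion
  left_inv := inversion_inversion
  right_inv := inversion_inversion
  continuous_toFun := continuous_inversion
  continuous_invFun := continuous_inversion

/-- The affine chart `z`, defined away from `∞`. -/
noncomputable def chartZero : OpenPartialHomeomorph RiemannSphere ℂ :=
  (OnePoint.isOpenEmbedding_coe.toOpenPartialHomeomorph ((↑) : ℂ → OnePoint ℂ)).symm

/-- The chart `1 / z`, defined away from `0`. -/
noncomputable def chartInfty : OpenPartialHomeomorph RiemannSphere ℂ :=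
  inversionHomeomorph.toOpenPartialHomeomorph.trans chartZero

theorem chartZero_coe (z : ℂ) : chartZero (z : OnePoint ℂ) = z :=
  (OnePoint.isOpenEmbedding_coe.toOpenPartialHomeomorph _).left_inv (mem_univ z)

theorem chartZero_symm (z : ℂ) : chartZero.symm z = (z : OnePoint ℂ) := rfl

theorem chartZero_source : chartZero.source = range ((↑) : ℂ → OnePoint ℂ) := by
  simp [chartZero]

theorem chartInfty_apply (x : RiemannSphere) : chartInfty x = chartZero (inversion x) := rfl

theorem chartInfty_symm (z : ℂ) : chartInfty.symm z = inversion (z : OnePoint ℂ) := rfl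

theorem chartInfty_source :
    chartInfty.source = inversion ⁻¹' range ((↑) : ℂ → OnePoint ℂ) := by
  simp [chartInfty, chartZero_source]; rfl

noncomputable instance : ChartedSpace ℂ RiemannSphere where
  atlas := {chartZero, chartInfty}
  chartAt x := x.elim chartInfty (fun _ => chartZero)
  mem_chart_source x := by
    induction x using OnePoint.rec with
    | infty =>
      rw [OnePoint.elim_infty, chartInfty_source, mem_preimage, inversion_infty]
      exact mem_range_self _
    | coe z =>
      rw [OnePoint.elim_some, chartZero_source]
      exact mem_range_self _
  chart_mem_atlas x := by
    induction x using OnePoint.rec with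
    | infty => exact Or.inr rfl
    | coe z => exact Or.inl rfl

instance (n : ℕ∞ω) : IsManifold 𝓘(ℂ) n RiemannSphere := by
  have inv_on : ∀ (f : ℂ → ℂ) (s : Set ℂ), (∀ z ∈ s, z ≠ 0 ∧ f z = z⁻¹) → ContDiffOn ℂ n f s := by
    intro f s h
    refine ContDiffOn.congr (f := fun z => z⁻¹) ?_ (fun z hz => (h z hz).2)
    exact contDiffOn_id.inv (fun z hz => (h z hz).1)
  have id_on : ∀ (f : ℂ → ℂ) (s : Set ℂ), (∀ z ∈ s, f z = z) → ContDiffOn ℂ n f s := by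
    intro f s h
    exact ContDiffOn.congr contDiffOn_id h
  have ne (z : ℂ) (h : inversion (z : OnePoint ℂ) ∈ range ((↑) : ℂ → OnePoint ℂ)) : z ≠ 0 := by
    rintro rfl
    rw [inversion_zero] at h
    exact OnePoint.infty_notMem_range_coe h
  refine isManifold_of_contDiffOn _ _ _ ?_
  rintro e e' (rfl | rfl) (rfl | rfl)
  · refine id_on _ _ fun z _ => ?_
    exact chartZero_coe z
  · refine inv_on _ _ fun z hz => ?_
    have hz' : chartZero.symm z ∈ chartInfty.source := hz.1.2
    rw [chartZero_symm, chartInfty_source] at hz'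
    refine ⟨ne z hz', ?_⟩
    change chartZero (inversion (z : OnePoint ℂ)) = _
    rw [inversion_coe (ne z hz'), chartZero_coe]
  · refine inv_on _ _ fun z hz => ?_
    have hz' : chartInfty.symm z ∈ chartZero.source := hz.1.2
    rw [chartInfty_symm, chartZero_source] at hz'
    refine ⟨ne z hz', ?_⟩
    change chartZero (inversion (z : OnePoint ℂ)) = _
    rw [inversion_coe (ne z hz'), chartZero_coe]
  · refine id_on _ _ fun z _ => ?_
    change chartZero (inversion (inversion (z : OnePoint ℂ))) = _
    rw [inversion_inversion, chartZero_coe]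

end RiemannSphere

namespace RiemannSurface

section
variable {X : Type} [TopologicalSpace X] [ChartedSpace ℂ X]

/-- The cotangent space at `x`. -/
abbrev Cotangent (x : X) : Type := TangentSpace 𝓘(ℂ) x →L[ℂ] ℂ

/-- The differential `dh` of a function at `y`. -/
noncomputable def differential (h : X → ℂ) (y : X) : Cotangent y := mfderiv 𝓘(ℂ) 𝓘(ℂ) h y

theorem differential_congr {h k : X → ℂ} {y : X} (hk : h =ᶠ[𝓝 y] k) :
    differential h y = differential k y := hk.mfderiv_eq

theorem differential_comp_chart {k : ℂ → ℂ} {e : X → ℂ} {y : X} (hk : DifferentiableAt ℂ k (e y))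
    (he : MDifferentiableAt 𝓘(ℂ) 𝓘(ℂ) e y) :
    differential (k ∘ e) y = deriv k (e y) • differential e y := by
  have h := mfderiv_comp y (I' := 𝓘(ℂ)) (mdifferentiableAt_iff_differentiableAt.2 hk) he
  refine ContinuousLinearMap.ext fun v => ?_
  rw [differential, h, mfderiv_eq_fderiv]
  have (w : ℂ) : fderiv ℂ k (e y) w = deriv k (e y) * w := by
    rw [fderiv_eq_smul_deriv, smul_eq_mul, mul_comm]
  exact this _

theorem differential_comp {h : X → ℂ} {f : X → X} {y : X}
    (hh : MDifferentiableAt 𝓘(ℂ) 𝓘(ℂ) h (f y)) (hf : MDifferentiableAt 𝓘(ℂ) 𝓘(ℂ) f y) :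
    differential (h ∘ f) y = (differential h (f y)).comp (mfderiv 𝓘(ℂ) 𝓘(ℂ) f y) :=
  mfderiv_comp y hh hf

/-- `α` is holomorphic: near each point `x`, `α = g dz` with `g` holomorphic, `z` the chart at `x`. -/
def IsHolForm {U : Opens X} (α : ∀ x : U, Cotangent (x : X)) : Prop :=
  ∀ x : U, ∃ g : X → ℂ, ContMDiffAt 𝓘(ℂ) 𝓘(ℂ) ∞ g x ∧
    ∀ᶠ y in 𝓝 (x : X), ∀ hy : y ∈ U,
      α ⟨y, hy⟩ = g y • differential (chartAt ℂ (x : X)) y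

theorem exists_eq_smul_mfderiv_chart [IsManifold 𝓘(ℂ) ∞ X] {h : X → ℂ} {x : X}
    (hh : ContMDiffAt 𝓘(ℂ) 𝓘(ℂ) ∞ h x) :
    ∃ g : X → ℂ, ContMDiffAt 𝓘(ℂ) 𝓘(ℂ) ∞ g x ∧ ∀ᶠ y in 𝓝 x,
      differential h y =
        g y • differential (chartAt ℂ x) y := by
  set e := chartAt ℂ x with he
  set k : ℂ → ℂ := h ∘ e.symm with hk
  have hxs : x ∈ e.source := mem_chart_source ℂ x
  have hchart : ∀ y ∈ e.source, ContMDiffAt 𝓘(ℂ) 𝓘(ℂ) ∞ e y := fun y hy =>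
    contMDiffAt_of_mem_maximalAtlas (IsManifold.chart_mem_maximalAtlas x) hy
  have hsymm : ContMDiffAt 𝓘(ℂ) 𝓘(ℂ) ∞ e.symm (e x) :=
    contMDiffAt_symm_of_mem_maximalAtlas (IsManifold.chart_mem_maximalAtlas x)
      (e.map_source hxs)
  have hk1 : ContDiffAt ℂ ∞ k (e x) := by
    rw [← contMDiffAt_iff_contDiffAt]
    refine ContMDiffAt.comp (e x) ?_ hsymm
    rw [e.left_inv hxs]; exact hh
  have hd : ContDiffAt ℂ ∞ (deriv k) (e x) := by
    have : deriv k = fun z => fderiv ℂ k z 1 := by ext z; simp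
    rw [this]
    exact (hk1.fderiv_right (m := ∞) (by simp)).clm_apply contDiffAt_const
  refine ⟨deriv k ∘ e, (contMDiffAt_iff_contDiffAt.2 hd).comp x (hchart x hxs), ?_⟩
  have hev : ∀ᶠ z in 𝓝 (e x), ContDiffAt ℂ 1 k z :=
    (hk1.of_le (by norm_cast)).eventually (by simp)
  have hev' : ∀ᶠ y in 𝓝 x, ContDiffAt ℂ 1 k (e y) := (e.continuousAt hxs).eventually hev
  filter_upwards [hev', e.open_source.mem_nhds hxs] with y hy hys
  have hhk : h =ᶠ[𝓝 y] k ∘ e := by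
    filter_upwards [e.open_source.mem_nhds hys] with w hw
    simp [hk, e.left_inv hw]
  rw [differential_congr hhk, differential_comp_chart (hy.differentiableAt (by simp))
    ((hchart y hys).mdifferentiableAt (by simp))]
  rfl

theorem IsHolForm.zero (U : Opens X) :
    IsHolForm (0 : ∀ x : U, Cotangent (x : X)) := fun x =>
  ⟨0, contMDiffAt_const, Eventually.of_forall fun y _ =>
    (zero_smul ℂ (differential (chartAt ℂ (x : X)) y)).symm⟩

theorem IsHolForm.add {U : Opens X} {α η : ∀ x : U, Cotangent (x : X)}
    (hα : IsHolForm α) (hη : IsHolForm η) : IsHolForm (α + η) := fun x => by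
  obtain ⟨g, hg, h1⟩ := hα x
  obtain ⟨g', hg', h2⟩ := hη x
  refine ⟨g + g', hg.add hg', ?_⟩
  filter_upwards [h1, h2] with y h1 h2 hy
  rw [Pi.add_apply, h1 hy, h2 hy]
  exact (add_smul (g y) (g' y) (differential (chartAt ℂ (x : X)) y)).symm

theorem IsHolForm.neg {U : Opens X} {α : ∀ x : U, Cotangent (x : X)}
    (hα : IsHolForm α) : IsHolForm (-α) := fun x => by
  obtain ⟨g, hg, h1⟩ := hα x
  refine ⟨-g, hg.neg, ?_⟩
  filter_upwards [h1] with y h1 hy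
  rw [Pi.neg_apply, h1 hy]
  exact (neg_smul (g y) (differential (chartAt ℂ (x : X)) y)).symm

theorem IsHolForm.smul {U : Opens X} {α : ∀ x : U, Cotangent (x : X)}
    (r : C^∞⟮𝓘(ℂ), U; 𝓘(ℂ), ℂ⟯) (hα : IsHolForm α) : IsHolForm (fun x => r x • α x) := fun x => by
  obtain ⟨g, hg, h1⟩ := hα x
  classical
  refine ⟨fun y => (if hy : y ∈ U then r ⟨y, hy⟩ else 0) * g y, ContMDiffAt.mul ?_ hg, ?_⟩
  · refine contMDiffAt_subtype_iff.1 ((r.contMDiff x).congr_of_eventuallyEq ?_)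
    exact Eventually.of_forall fun y => dif_pos y.2
  · filter_upwards [h1] with y h1 hy
    rw [h1 hy, smul_smul, dif_pos hy]

theorem IsHolForm.res {U V : Opens X} {α : ∀ x : V, Cotangent (x : X)}
    (hα : IsHolForm α) (h : U ≤ V) : IsHolForm (fun x : U => α ⟨x, h x.2⟩) := fun x => by
  obtain ⟨g, hg, h1⟩ := hα ⟨x, h x.2⟩
  refine ⟨g, hg, ?_⟩
  filter_upwards [h1] with y h1 hy
  exact h1 (h hy)

theorem IsHolForm.pullback [IsManifold 𝓘(ℂ) ∞ X] {f : X → X} (hf : ContMDiff 𝓘(ℂ) 𝓘(ℂ) ∞ f)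
    {U V : Opens X} (hV : ∀ x ∈ V, f x ∈ U) 
    {α : ∀ x : U, Cotangent (x : X)}
    (hα : IsHolForm α) :
    IsHolForm (U := V) (fun x => (α ⟨f x, hV x x.2⟩).comp (mfderiv 𝓘(ℂ) 𝓘(ℂ) f x)) := fun x => by
  obtain ⟨g, hg, h1⟩ := hα ⟨f x, hV x x.2⟩
  have hchart : ∀ y ∈ (chartAt ℂ (f x)).source, ContMDiffAt 𝓘(ℂ) 𝓘(ℂ) ∞ (chartAt ℂ (f x)) y := fun y hy =>
    contMDiffAt_of_mem_maximalAtlas (IsManifold.chart_mem_maximalAtlas (f x)) hy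
  obtain ⟨g', hg', h2⟩ := exists_eq_smul_mfderiv_chart (x := (x : X))
    ((hchart (f x) (mem_chart_source ℂ _)).comp (x : X) hf.contMDiffAt)
  refine ⟨fun y => g (f y) * g' y, ContMDiffAt.mul (hg.comp (x : X) hf.contMDiffAt) hg', ?_⟩
  have hs := hf.continuous.continuousAt.preimage_mem_nhds
    ((chartAt ℂ (f x)).open_source.mem_nhds (mem_chart_source ℂ (f x)))
  filter_upwards [hf.continuous.continuousAt.eventually h1, h2, hs] with y h1 h2 hs hy
  rw [mul_smul, ← h2, differential_comp ((hchart _ hs).mdifferentiableAt (by simp))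
    (hf.mdifferentiableAt (by simp)), h1 (hV y hy)]
  rfl

end
end RiemannSurface

namespace RiemannSurface

variable (X : TopCat.{0}) [ChartedSpace ℂ X]

/-- The sheaf `𝒪` of holomorphic functions. -/
noncomputable def holSheaf : Sheaf (Opens.grothendieckTopology X) RingCat.{0} :=
  (sheafCompose _ (forget₂ CommRingCat RingCat)).obj (smoothSheafCommRing 𝓘(ℂ) 𝓘(ℂ) X ℂ)

/-- Holomorphic endomorphisms of `X` (over `ℂ`, `C^∞` is the same as holomorphic). -/
abbrev HolEnd : Type := C^∞⟮𝓘(ℂ), X; 𝓘(ℂ), X⟯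

variable {X}

/-- The continuous map underlying a holomorphic map. -/
noncomputable def HolEnd.toTop (f : HolEnd X) : X ⟶ X := TopCat.ofHom ⟨f, f.contMDiff.continuous⟩

/-- The morphism `𝒪 ⟶ f_* 𝒪`, `g ↦ g ∘ f`. -/
noncomputable def comorphism (f : HolEnd X) :
    holSheaf X ⟶ ((Opens.map f.toTop).sheafPushforwardContinuous RingCat.{0}
      (Opens.grothendieckTopology X) (Opens.grothendieckTopology X)).obj (holSheaf X) :=
  (sheafCompose (Opens.grothendieckTopology X) (forget₂ CommRingCat RingCat)).map
    (ContMDiff.smoothSheafCommRingHom (IM := 𝓘(ℂ)) (I := 𝓘(ℂ)) (IP := 𝓘(ℂ)) (R := ℂ)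
      (f := f) (hf := f.contMDiff))

/-- The direct image functor `f_*`. -/
noncomputable abbrev direct (f : HolEnd X) :
    SheafOfModules.{0} (holSheaf X) ⥤ SheafOfModules.{0} (holSheaf X) :=
  SheafOfModules.pushforward.{0} (comorphism f)

instance (f : HolEnd X) : (direct f).Additive where
  map_add := rfl

instance (f : HolEnd X) : (PresheafOfModules.pushforward.{0} (comorphism f).hom).IsRightAdjoint :=
  CategoryTheory.Functor.isRightAdjoint_of_leftAdjointObjIsDefined_eq_top
    (PresheafOfModules.pullbackObjIsDefined_eq_top _)
noncomputable instance (f : HolEnd X) : PreservesFiniteLimits (direct f) := 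
  have : PreservesLimits (direct f) := (Adjunction.ofIsRightAdjoint (direct f)).rightAdjoint_preservesLimits
  inferInstance

/-- The category of `f`-sheaves of `𝒪`-modules: pairs of a sheaf of `𝒪`-modules `F` and an
`𝒪`-linear map `F ⟶ f_* F`, i.e. (by adjunction) `f^* F ⟶ F`, with the compatible maps. -/
abbrev FSheaf (f : HolEnd X) := Endofunctor.Coalgebra (direct f)

/-- The constant functions on `U`. -/
noncomputable def const (U : (Opens X)ᵒᵖ) : ℂ →+* (holSheaf X).obj.obj U :=
  algebraMap ℂ C^∞⟮𝓘(ℂ), (unop U : Opens X); 𝓘(ℂ), ℂ⟯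

theorem const_mul (U : (Opens X)ᵒᵖ) (c : ℂ) (r : (holSheaf X).obj.obj U) :
    const U c * r = r * const U c :=
  mul_comm (G := C^∞⟮𝓘(ℂ), (unop U : Opens X); 𝓘(ℂ), ℂ⟯) _ _

theorem map_const {U V : (Opens X)ᵒᵖ} (i : U ⟶ V) (c : ℂ) :
    (holSheaf X).obj.map i (const U c) = const V c := rfl

theorem comorphism_const (f : HolEnd X) (U : (Opens X)ᵒᵖ) (c : ℂ) :
    (comorphism f).hom.app U (const U c) = const ((Opens.map f.toTop).op.obj U) c := rfl

/-- Multiplication by the constant `c` on a sheaf of `𝒪`-modules. -/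
noncomputable def scalar (c : ℂ) (N : SheafOfModules.{0} (holSheaf X)) : N ⟶ N where
  val :=
    { app U := ModuleCat.ofHom
        { toFun m := const U c • m
          map_add' := smul_add _
          map_smul' r m := by
            simp only [RingHom.id_apply]
            rw [smul_smul, smul_smul, const_mul] }
      naturality {U V} i := by
        ext m
        exact (N.val.map_smul i (const U c) m).symm }

theorem scalar_apply (c : ℂ) (N : SheafOfModules.{0} (holSheaf X)) (U) (m : N.val.obj U) :
    (scalar c N).val.app U m = const U c • m := rfl

theorem ext_app {N P : SheafOfModules.{0} (holSheaf X)} {a b : N ⟶ P}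
   (h : ∀ U (m : N.val.obj U), a.val.app U m = b.val.app U m) : a = b := by
  ext U m
  exact h U m

variable (f : HolEnd X) 

/-- Multiplication by the constant `c` on an `f`-sheaf. -/
noncomputable def fscalar (c : ℂ) (N : FSheaf f) : N ⟶ N where
  f := scalar c N.V
  h := ext_app fun U m => by
    exact ((N.str.val.app U).hom.map_smul (const U c) m).symm

theorem fext {N P : FSheaf f} {a b : N ⟶ P}
   (h : ∀ U (m : N.V.val.obj U), a.f.val.app U m = b.f.val.app U m) : a = b :=
  Endofunctor.Coalgebra.ext (ext_app h)

/-- The action of the constants on the category of `f`-sheaves. -/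
noncomputable def scalarHom : ℂ →+* CatCenter (FSheaf f) where
  toFun c :=
    { app N := fscalar f c N
      naturality N P a := fext f fun U m =>
        ((a.f.val.app U).hom.map_smul (const U c) m).symm }
  map_one' := NatTrans.ext <| funext fun N => fext f fun U m => by
    change const U 1 • m = m
    rw [map_one, one_smul]
  map_mul' a b := NatTrans.ext <| funext fun N => fext f fun U m => by
    change const U (a * b) • m = const U a • const U b • m
    rw [map_mul, mul_smul]
  map_zero' := NatTrans.ext <| funext fun N => fext f fun U m => by
    change const U 0 • m = 0
    rw [map_zero, zero_smul]
  map_add' a b := NatTrans.ext <| funext fun N => fext f fun U m => by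
    change const U (a + b) • m = const U a • m + const U b • m
    rw [map_add, add_smul]

noncomputable instance : Linear ℂ (FSheaf f) := Linear.ofRingMorphism (scalarHom f)

/-- The sheaf `𝒪` with its action `f^* 𝒪 ⟶ 𝒪`: the pullback of functions along `f`. -/
noncomputable def structureFSheaf : FSheaf f where
  V := SheafOfModules.unit (holSheaf X)
  str :=
   { val :=
    { app U := ModuleCat.ofHom (R := (holSheaf X).obj.obj U)
        (X := (SheafOfModules.unit (holSheaf X)).val.obj U)
        (Y := ((direct f).obj (SheafOfModules.unit (holSheaf X))).val.obj U)
        { toFun m := (comorphism f).hom.app U m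
          map_add' := map_add _
          map_smul' r m := map_mul ((comorphism f).hom.app U).hom r m }
      naturality {U V} i := by
        ext
        rfl } }

end RiemannSurface

namespace RiemannSurface

section

variable (X : TopCat.{0}) [ChartedSpace ℂ X]

/-- The additive group of holomorphic one-forms on `U`. -/
def holForms (U : (Opens X)ᵒᵖ) : AddSubgroup (∀ x : (unop U : Opens X), Cotangent (x : X)) where
  carrier := {α | IsHolForm α}
  zero_mem' := IsHolForm.zero _
  add_mem' := IsHolForm.add
  neg_mem' := IsHolForm.neg

/-- The value at `x` of a holomorphic function on `U`. -/
noncomputable def holEval {U : (Opens X)ᵒᵖ} (g : (holSheaf X).obj.obj U) (x : (unop U : Opens X)) : ℂ :=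
  (show C^∞⟮𝓘(ℂ), (unop U : Opens X); 𝓘(ℂ), ℂ⟯ from g) x

noncomputable instance (U : (Opens X)ᵒᵖ) : Module ((holSheaf X).obj.obj U) (holForms X U) where
  smul g α := ⟨fun x => holEval X g x • α.1 x, IsHolForm.smul _ α.2⟩
  one_smul α := Subtype.ext <| funext fun x => one_smul ℂ (α.1 x)
  mul_smul g h α := Subtype.ext <| funext fun x =>
    mul_smul (holEval X g x) (holEval X h x) (α.1 x)
  smul_zero g := Subtype.ext <| funext fun x => smul_zero (A := Cotangent (x : X)) (holEval X g x)
  smul_add g α η := Subtype.ext <| funext fun x => smul_add (holEval X g x) (α.1 x) (η.1 x)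
  add_smul g h α := Subtype.ext <| funext fun x =>
    add_smul (holEval X g x) (holEval X h x) (α.1 x)
  zero_smul α := Subtype.ext <| funext fun x => zero_smul ℂ (α.1 x)

/-- The presheaf of holomorphic one-forms. -/
noncomputable def cotangentPresheaf : PresheafOfModules.{0} (holSheaf X).obj where
  obj U := ModuleCat.of _ (holForms X U)
  map {U V} i := ModuleCat.ofHom (R := (holSheaf X).obj.obj U)
    (Y := (ModuleCat.restrictScalars ((holSheaf X).obj.map i).hom).obj
      (ModuleCat.of _ (holForms X V)))
    { toFun α := ⟨fun x => α.1 ⟨x, i.unop.le x.2⟩, IsHolForm.res α.2 i.unop.le⟩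
      map_add' _ _ := rfl
      map_smul' _ _ := rfl }

/-- Being a holomorphic one-form is a local condition. -/
def holFormPredicate : TopCat.LocalPredicate (fun x : X => Cotangent x) where
  pred {_} α := IsHolForm α
  res i _ h := IsHolForm.res h i.le
  locality {U} α h x := by
    obtain ⟨V, hxV, i, hV⟩ := h x
    obtain ⟨g, hg, h1⟩ := hV ⟨x, hxV⟩
    refine ⟨g, hg, ?_⟩
    filter_upwards [h1, V.isOpen.mem_nhds hxV] with y h1 hyV hy
    exact h1 hyV

/-- The sheaf `Ω` of holomorphic one-forms. -/
noncomputable def cotangentSheaf : SheafOfModules.{0} (holSheaf X) where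
  val := cotangentPresheaf X
  isSheaf := (Presheaf.isSheaf_iff_isSheaf_forget _ _ (forget AddCommGrpCat)).2
    (TopCat.subpresheafToTypes.isSheaf (holFormPredicate X))

end

section

variable {X : TopCat.{0}} [ChartedSpace ℂ X] [IsManifold 𝓘(ℂ) ∞ X]

/-- The sheaf `Ω` with its action `f^* Ω ⟶ Ω`: the pullback of forms along `f`. -/
noncomputable def cotangentFSheaf (f : HolEnd X) : FSheaf f where
  V := cotangentSheaf X
  str :=
   { val :=
    { app U := ModuleCat.ofHom (R := (holSheaf X).obj.obj U)
        (X := (cotangentSheaf X).val.obj U)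
        (Y := ((direct f).obj (cotangentSheaf X)).val.obj U)
        { toFun α := (⟨fun x => (α.1 ⟨f x, x.2⟩).comp (mfderiv 𝓘(ℂ) 𝓘(ℂ) f x),
              IsHolForm.pullback f.contMDiff (fun _ h => h) α.2⟩ :
            holForms X ((Opens.map f.toTop).op.obj U))
          map_add' _ _ := rfl
          map_smul' _ _ := rfl }
      naturality {U V} i := by
        ext
        rfl } }

noncomputable instance (f : HolEnd X) : HasExt.{1} (FSheaf f) := HasExt.standard _

end

end RiemannSurface

namespace RiemannSphere

/-- The Riemann sphere `P¹`, as an object of the category of topological spaces. -/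
noncomputable def sphere : TopCat.{0} := TopCat.of RiemannSphere

noncomputable instance : ChartedSpace ℂ sphere := inferInstanceAs (ChartedSpace ℂ RiemannSphere)

instance (n : ℕ∞ω) : IsManifold 𝓘(ℂ) n sphere := inferInstanceAs (IsManifold 𝓘(ℂ) n RiemannSphere)

open Classical in
/-- The self-map `z ↦ p(z) / q(z)` of the Riemann sphere, for coprime polynomials `p`, `q`. At `∞`
it is the quotient of the coefficients of degree `max (deg p) (deg q)`. A quotient `a / 0` is `∞`. -/
noncomputable def ratMap (p q : Polynomial ℂ) (x : RiemannSphere) : RiemannSphere :=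
  x.elim
    (if q.coeff (max p.natDegree q.natDegree) = 0 then OnePoint.infty
      else ((p.coeff (max p.natDegree q.natDegree) / q.coeff (max p.natDegree q.natDegree) : ℂ) :
        OnePoint ℂ))
    (fun z => if q.eval z = 0 then OnePoint.infty
      else ((p.eval z / q.eval z : ℂ) : OnePoint ℂ))

/-- `f` is a rational map of degree `d`. -/
def IsRationalOfDegree (f : RiemannSphere → RiemannSphere) (d : ℕ) : Prop :=
  ∃ p q : Polynomial ℂ, IsCoprime p q ∧ max p.natDegree q.natDegree = d ∧ f = ratMap p q

end RiemannSphere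

namespace RiemannSurface

/-- `v` is a global holomorphic vector field, i.e. an element of `H⁰(X, T_X)`. -/
def IsHolVectorField {X : TopCat.{0}} [ChartedSpace ℂ X] [IsManifold 𝓘(ℂ) ∞ X]
    (v : ∀ x : X, TangentSpace 𝓘(ℂ) x) : Prop :=
  ContMDiff 𝓘(ℂ) 𝓘(ℂ).tangent ∞ (fun x => (⟨x, v x⟩ : TangentBundle 𝓘(ℂ) X))

/-- The `ℂ`-vector space `Ext^q_{X/f}(Ω, 𝒪)`, computed in the abelian category of `f`-sheaves. -/
abbrev extCotangent {X : TopCat.{0}} [ChartedSpace ℂ X] [IsManifold 𝓘(ℂ) ∞ X] (f : HolEnd X)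
    (q : ℕ) : Type 1 :=
  Abelian.Ext.{1} (cotangentFSheaf f) (structureFSheaf f) q

end RiemannSurface

/-!
An `f`-sheaf is a coalgebra for the left exact endofunctor `T = f_*` of the category of sheaves of
`𝒪`-modules. The forgetful functor has a right adjoint, the cofree coalgebra `∏ₙ Tⁿ M`, and each
coalgebra `G` has a resolution of length one by cofree coalgebras,
`0 ⟶ G ⟶ ∏ₙ Tⁿ G ⟶ ∏ₙ Tⁿ (T G) ⟶ 0` (`standard_shortExact`). If the higher Ext groups from `F` to
both cofree coalgebras vanish, then the Ext groups from `F` to `G` vanish in degrees at least two,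
and `Ext⁰` and `Ext¹` are the kernel and the cokernel of a map `Hom(F, G) ⟶ Hom(F, T G)` between
spaces of morphisms of the underlying objects (`ext_add_two_eq_zero`, `finrank_ext_one_add`). For
`F = Ω` and `G = 𝒪` this is the map `v ↦ df(v) - v ∘ f` from `H⁰(T)` to `H⁰(f^* T)`, where `T` now
is the tangent sheaf (`evDirect_standardDiff`).

The vanishing (`cofreeAcyclic_structureSheaf`, `cofreeAcyclic_direct_structureSheaf`) amounts to
that of the higher cohomology of `T` and of its pullbacks, together with the exactness of the
infinite product, which is not automatic. Both are obtained from soft sheaves. On a compact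
Hausdorff space each section near a closed set of a quotient by a soft sheaf lifts near that closed
set, so that such quotients behave well with respect to direct images, countable products and
morphisms from an invertible sheaf. The sheaf `𝒪` has the resolution `0 ⟶ 𝒪 ⟶ 𝒞 ⟶ 𝒞 / 𝒪 ⟶ 0` by the
sheaf `𝒞` of continuous functions, in which the last two sheaves are soft. For `𝒞 / 𝒪` this is a
form of the theorem of Mittag-Leffler on the sphere (`exists_global_representative`): using the
Cauchy transform, a continuous function on a disc is changed by a holomorphic function on a smaller
disc into a continuous function on the whole sphere which is holomorphic wherever the given function
is (`exists_holomorphic_modification`). As `T` has a transition function `-1 / z²` which is regular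
at infinity, the lifting of morphisms from `Ω` follows as well (`exists_pair_lift`).

Let `f = p / q` be of degree `d`. By the theorem of Liouville, sections of `f^* T` are
`c / q² · ∂/∂z` for polynomials `c` of degree at most `2 d`, so that the two spaces have dimensions
`3` and `2 d + 1`, and the Euler characteristic is `2 - 2 d` (`exists_linearEquiv_unit`,
`exists_linearEquiv_direct`). A vector field `v = α z² + β z + γ` is in the kernel if and only if
`α p² + β p q + γ q² = (p' q - p q') v`. Factoring `v` into linear forms and comparing orders and
residues at the zeros of these forms in `p` and `q`, one finds that a nonzero `v` forces `d = 1`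
(`natDegree_le_one_of_invariant`). If `d = 1` and `f` is not the identity, then the kernel is
spanned by the vector field with the fixed points of `f` as zeros, since the traceless matrices
which commute with a non-scalar `2 × 2` matrix form a line (`exists_smul_fixedPointField`). The same
description in coordinates applies to vector fields as sections of the tangent bundle, which gives
the criterion for the existence of an invariant vector field.
-/

/-! ### Sheaves of modules form a Grothendieck category -/

section

universe v

namespace PresheafOfModules

variable {C : Type v} [SmallCategory.{v} C] (R : Cᵒᵖ ⥤ RingCat.{v})

instance : HasSeparator (PresheafOfModules.{v} R) where
  hasSeparator := ⟨_, (freeYoneda.isSeparating R).isSeparator_coproduct⟩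

instance : HasFilteredColimitsOfSize.{v, v} (PresheafOfModules.{v} R) where
  HasColimitsOfShape _ := inferInstance

noncomputable instance : ReflectsFiniteLimits (toPresheaf.{v} R) where
  reflects _ _ _ := inferInstance

/-- Filtered colimits of presheaves of modules are exact, since they are computed on the underlying
presheaves of abelian groups. -/
instance : AB5OfSize.{v, v} (PresheafOfModules.{v} R) where
  ofShape K _ _ := HasExactColimitsOfShape.domain_of_functor K (toPresheaf.{v} R)

end PresheafOfModules

namespace SheafOfModules

variable {C : Type v} [SmallCategory.{v} C] {J : GrothendieckTopology C} (R : Sheaf J RingCat.{v})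
  [HasSheafify J AddCommGrpCat.{v}] [J.WEqualsLocallyBijective AddCommGrpCat.{v}]

instance : HasFilteredColimitsOfSize.{v, v} (SheafOfModules.{v} R) where
  HasColimitsOfShape _ := inferInstance
instance : AB5OfSize.{v, v} (SheafOfModules.{v} R) where
  ofShape K _ _ :=
    (PresheafOfModules.sheafificationAdjunction (𝟙 R.obj)).hasExactColimitsOfShape K

/-- The sheafification of a separator is a separator. -/
instance : HasSeparator (SheafOfModules.{v} R) where
  hasSeparator := by
    let adj := PresheafOfModules.sheafificationAdjunction (𝟙 R.obj)
    let G := separator (PresheafOfModules.{v} R.obj)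
    refine ⟨(PresheafOfModules.sheafification (𝟙 R.obj)).obj G, ?_⟩
    rw [isSeparator_def]
    intro M N f g h
    apply (forget R).map_injective
    refine (isSeparator_separator (PresheafOfModules.{v} R.obj)).def _ _ fun k => ?_
    have := h ((adj.homEquiv _ _).symm k)
    exact (adj.homEquiv _ _).symm.injective ((adj.homEquiv_naturality_right_symm k f).trans
      (this.trans (adj.homEquiv_naturality_right_symm k g).symm))

/-- In particular there are enough injective sheaves of modules. -/
instance : IsGrothendieckAbelian.{v} (SheafOfModules.{v} R) where

end SheafOfModules

end

/-! ### Cofree coalgebras of a left exact endofunctor -/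

namespace CategoryTheory.Endofunctor.Coalgebra

universe w v u

set_option linter.unusedSectionVars false

section Cofree

variable {C : Type u} [Category.{v} C] (T : C ⥤ C)

/-- The objects `Tⁿ M`. -/
def iterObj (M : C) : ℕ → C
  | 0 => M
  | n + 1 => T.obj (iterObj M n)

/-- The identification `T⁰ M ≅ M`. -/
def iterZero (M : C) : iterObj T M 0 ≅ M := Iso.refl _

/-- The identification `Tⁿ⁺¹ M ≅ T (Tⁿ M)`. -/
def iterSucc (M : C) (n : ℕ) : iterObj T M (n + 1) ≅ T.obj (iterObj T M n) := Iso.refl _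

/-- The morphism `Tⁿ g`. -/
def iterMap {M N : C} (g : M ⟶ N) : ∀ n, iterObj T M n ⟶ iterObj T N n
  | 0 => (iterZero T M).hom ≫ g ≫ (iterZero T N).inv
  | n + 1 => (iterSucc T M n).hom ≫ T.map (iterMap g n) ≫ (iterSucc T N n).inv

/-- The isomorphism `Tⁿ (T M) ≅ T (Tⁿ M)`. -/
def iterObjIso (M : C) : ∀ n, iterObj T (T.obj M) n ≅ T.obj (iterObj T M n)
  | 0 => iterZero T (T.obj M) ≪≫ T.mapIso (iterZero T M).symm
  | n + 1 => iterSucc T (T.obj M) n ≪≫ T.mapIso (iterObjIso M n ≪≫ (iterSucc T M n).symm)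

variable {T}

/-- The map `Tⁿ(str) : Tⁿ G ⟶ Tⁿ⁺¹ G` for a coalgebra `G`. -/
def iterStr (G : Coalgebra T) : ∀ n, iterObj T G.V n ⟶ T.obj (iterObj T G.V n)
  | 0 => (iterZero T G.V).hom ≫ G.str ≫ T.map (iterZero T G.V).inv
  | n + 1 => (iterSucc T G.V n).hom ≫ T.map (iterStr G n ≫ (iterSucc T G.V n).inv)

/-- The components `F ⟶ Tⁿ M` of the coalgebra map to the cofree coalgebra which is induced by a
morphism `F ⟶ M`. -/
def cofreeComponent (F : Coalgebra T) {M : C} (g : F.V ⟶ M) : ∀ n, F.V ⟶ iterObj T M n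
  | 0 => g ≫ (iterZero T M).inv
  | n + 1 => F.str ≫ T.map (cofreeComponent F g n) ≫ (iterSucc T M n).inv

variable [HasProductsOfShape ℕ C] [PreservesLimitsOfShape (Discrete ℕ) T]

variable (T) in
/-- The cofree coalgebra `∏ₙ Tⁿ M`, with the shift as its structure. -/
noncomputable def cofreeObj (M : C) : Coalgebra T where
  V := ∏ᶜ iterObj T M
  str := Pi.lift (fun n => Pi.π (iterObj T M) (n + 1) ≫ (iterSucc T M n).hom) ≫
    (PreservesProduct.iso T (iterObj T M)).inv

variable (T) in
/-- The projection of the cofree coalgebra to its `n`-th factor. -/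
noncomputable def proj (M : C) (n : ℕ) : (cofreeObj T M).V ⟶ iterObj T M n := Pi.π (iterObj T M) n

variable (T) in
/-- The universal morphism from the cofree coalgebra on `M` to `M`. -/
noncomputable def cofreeCounit (M : C) : (cofreeObj T M).V ⟶ M := proj T M 0 ≫ (iterZero T M).hom

theorem proj_hom_ext {F M : C} {a b : F ⟶ (cofreeObj T M).V}
    (h : ∀ n, a ≫ proj T M n = b ≫ proj T M n) : a = b := Pi.hom_ext (f := iterObj T M) _ _ h

/-- The morphism to the cofree coalgebra with given components. -/
noncomputable def projLift {F M : C} (a : ∀ n, F ⟶ iterObj T M n) : F ⟶ (cofreeObj T M).V :=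
  Pi.lift a

@[simp]
theorem projLift_proj {F M : C} (a : ∀ n, F ⟶ iterObj T M n) (n : ℕ) :
    projLift a ≫ proj T M n = a n := Pi.lift_π _ _

/-- As `T` preserves the product, `T (∏ₙ Tⁿ M)` is the product of the objects `T (Tⁿ M)`. -/
theorem map_proj_hom_ext {F M : C} {a b : F ⟶ T.obj (cofreeObj T M).V}
    (h : ∀ n, a ≫ T.map (proj T M n) = b ≫ T.map (proj T M n)) : a = b := by
  refine (cancel_mono (PreservesProduct.iso T (iterObj T M)).hom).1 ?_
  refine Pi.hom_ext _ _ fun n => ?_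
  rw [PreservesProduct.iso_hom]
  have := piComparison_comp_π T (iterObj T M) n
  refine (Category.assoc _ _ _).trans (Eq.trans ?_ (Category.assoc _ _ _).symm)
  exact (congrArg _ this).trans ((h n).trans (congrArg _ this).symm)

theorem cofreeObj_str (M : C) (n : ℕ) :
    (cofreeObj T M).str ≫ T.map (proj T M n) = proj T M (n + 1) ≫ (iterSucc T M n).hom := by
  have h : (PreservesProduct.iso T (iterObj T M)).inv ≫ T.map (Pi.π _ n) = Pi.π _ n := by
    rw [Iso.inv_comp_eq, PreservesProduct.iso_hom, piComparison_comp_π]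
  refine (Category.assoc _ _ _).trans ((congrArg _ h).trans ?_)
  exact Pi.lift_π _ _

/-- The coalgebra map to the cofree coalgebra induced by a morphism `F ⟶ M`. -/
noncomputable def cofreeLift (F : Coalgebra T) {M : C} (g : F.V ⟶ M) : F ⟶ cofreeObj T M where
  f := projLift (cofreeComponent F g)
  h := map_proj_hom_ext fun n => by
    rw [Category.assoc, Category.assoc, ← T.map_comp, cofreeObj_str, projLift_proj,
      ← Category.assoc, projLift_proj, cofreeComponent]
    simp

@[simp]
theorem cofreeLift_proj (F : Coalgebra T) {M : C} (g : F.V ⟶ M) (n : ℕ) :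
    (cofreeLift F g).f ≫ proj T M n = cofreeComponent F g n :=
  projLift_proj _ _

@[simp]
theorem cofreeLift_counit (F : Coalgebra T) {M : C} (g : F.V ⟶ M) :
    (cofreeLift F g).f ≫ cofreeCounit T M = g := by
  rw [cofreeCounit, ← Category.assoc, cofreeLift_proj, cofreeComponent]
  simp

/-- A coalgebra map to a cofree coalgebra is determined by its component in `M`. -/
theorem comp_proj_eq_cofreeComponent {F : Coalgebra T} {M : C} (k : F ⟶ cofreeObj T M) (n : ℕ) :
    k.f ≫ proj T M n = cofreeComponent F (k.f ≫ cofreeCounit T M) n := by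
  induction n with
  | zero => simp [cofreeComponent, cofreeCounit]
  | succ n ih =>
    rw [cofreeComponent, ← ih, T.map_comp, Category.assoc, ← Category.assoc, k.h, Category.assoc,
      ← Category.assoc _ (T.map _), cofreeObj_str]
    simp

theorem cofree_hom_ext {F : Coalgebra T} {M : C} {k l : F ⟶ cofreeObj T M}
    (h : k.f ≫ cofreeCounit T M = l.f ≫ cofreeCounit T M) : k = l := by
  ext1
  refine proj_hom_ext fun n => ?_
  rw [comp_proj_eq_cofreeComponent, h, ← comp_proj_eq_cofreeComponent]

theorem cofreeLift_comp_cofreeLift (F : Coalgebra T) {M N : C} (a : F.V ⟶ M) (g : M ⟶ N) :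
    cofreeLift F a ≫ cofreeLift (cofreeObj T M) (cofreeCounit T M ≫ g) =
      cofreeLift F (a ≫ g) := by
  refine cofree_hom_ext ?_
  rw [comp_f, Category.assoc, cofreeLift_counit, cofreeLift_counit, ← Category.assoc,
    cofreeLift_counit]

variable (T) in
/-- The functor of cofree coalgebras. -/
noncomputable def cofree : C ⥤ Coalgebra T where
  obj := cofreeObj T
  map g := cofreeLift _ (cofreeCounit T _ ≫ g)
  map_id M := cofree_hom_ext (by simp)
  map_comp g h := ((cofreeLift_comp_cofreeLift _ _ h).trans
    (congrArg _ (Category.assoc _ _ _))).symm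

variable (T) in
/-- The cofree coalgebra is right adjoint to the forgetful functor. -/
noncomputable def forgetCofreeAdjunction : forget T ⊣ cofree T :=
  Adjunction.mkOfHomEquiv
    { homEquiv F M :=
        { toFun g := cofreeLift F g
          invFun k := k.f ≫ cofreeCounit T M
          left_inv g := cofreeLift_counit F g
          right_inv k := cofree_hom_ext (cofreeLift_counit _ _) }
      homEquiv_naturality_left_symm a k := Category.assoc _ _ _
      homEquiv_naturality_right g h := by
        refine cofree_hom_ext ((cofreeLift_counit _ _).trans ?_)
        refine Eq.trans ?_ (Category.assoc _ _ _).symm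
        refine Eq.trans ?_ (congrArg _ (cofreeLift_counit _ _).symm)
        refine Eq.trans ?_ (Category.assoc _ _ _)
        exact congrArg (· ≫ h) (cofreeLift_counit _ _).symm }

theorem cofree_map_proj {M N : C} (g : M ⟶ N) (n : ℕ) :
    (cofreeLift (cofreeObj T M) (cofreeCounit T M ≫ g)).f ≫ proj T N n =
      proj T M n ≫ iterMap T g n := by
  induction n with
  | zero => simp [cofreeComponent, cofreeCounit, iterMap]
  | succ n ih =>
    rw [cofreeLift_proj] at ih ⊢
    rw [cofreeComponent, ih, T.map_comp, Category.assoc, ← Category.assoc, cofreeObj_str, iterMap]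
    simp

end Cofree

section Abelian

variable {C : Type u} [Category.{v} C] [Abelian C] {T : C ⥤ C} [T.Additive]
  [PreservesFiniteLimits T]

instance : (forget T).PreservesMonomorphisms where
  preserves f _ := mono_f f

/-- A sequence of coalgebras is short exact if the sequence of the underlying objects is. -/
theorem shortExact_of_forget {A B D : Coalgebra T} (f : A ⟶ B) (g : B ⟶ D)
    (w : f.f ≫ g.f = 0) (h : (ShortComplex.mk f.f g.f w).ShortExact) :
    (ShortComplex.mk f g (Coalgebra.ext w)).ShortExact := by
  have : Mono f.f := h.mono_f
  have : Epi g.f := h.epi_g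
  have : Mono f := mono_of_mono f
  have : Epi g := epi_of_epi g
  refine { exact := ShortComplex.exact_of_f_is_kernel _ ?_ }
  have hk := h.fIsKernel
  refine KernelFork.IsLimit.ofι _ _ (fun {W} k hk' => ⟨hk.lift (KernelFork.ofι k.f
      (comp_f_eq_zero hk')), lift_hom f k _ (hk.fac _ WalkingParallelPair.zero)⟩)
      (fun {W} k hk' => Coalgebra.ext (hk.fac _ WalkingParallelPair.zero))
      (fun {W} k hk' m hm => (cancel_mono f).1
        (hm.trans (Coalgebra.ext (hk.fac (KernelFork.ofι k.f
          (comp_f_eq_zero hk')) WalkingParallelPair.zero)).symm))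

variable [HasProductsOfShape ℕ C] [PreservesLimitsOfShape (Discrete ℕ) T]

instance (J : C) [Injective J] : Injective ((cofree T).obj J) :=
  Injective.injective_of_adjoint (forgetCofreeAdjunction T) J

/-- The morphism `∏ₙ Tⁿ G ⟶ T G` whose associated coalgebra map has kernel `G`. -/
noncomputable def standardMap (G : Coalgebra T) : (cofreeObj T G.V).V ⟶ T.obj G.V :=
  (cofreeObj T G.V).str ≫ T.map (cofreeCounit T G.V) - cofreeCounit T G.V ≫ G.str

/-- In components, the second map of the standard resolution is `x ↦ (xₙ₊₁ - Tⁿ(str) xₙ)ₙ`. -/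
theorem cofreeComponent_standardMap (G : Coalgebra T) (n : ℕ) :
    cofreeComponent (cofreeObj T G.V) (standardMap G) n =
      (proj T G.V (n + 1) ≫ (iterSucc T G.V n).hom - proj T G.V n ≫ iterStr G n) ≫
        (iterObjIso T G.V n).inv := by
  induction n with
  | zero =>
    rw [cofreeComponent, standardMap, cofreeCounit, T.map_comp, ← Category.assoc, cofreeObj_str,
      iterStr, iterObjIso]
    simp
  | succ n ih =>
    rw [cofreeComponent, ih, T.map_comp, T.map_sub, T.map_comp, T.map_comp, Category.assoc,
      ← Category.assoc,
      Preadditive.comp_sub, ← Category.assoc, ← Category.assoc, cofreeObj_str,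
      ← Category.assoc _ _ (T.map (iterStr G n)), cofreeObj_str, iterStr, iterObjIso]
    simp

theorem cofreeComponent_id_succ (G : Coalgebra T) (n : ℕ) :
    cofreeComponent G (𝟙 _) (n + 1) ≫ (iterSucc T G.V n).hom =
      cofreeComponent G (𝟙 _) n ≫ iterStr G n := by
  induction n with
  | zero => simp [cofreeComponent, iterStr]
  | succ n ih =>
    conv_lhs => rw [cofreeComponent, (Iso.eq_comp_inv _).2 ih]
    simp [cofreeComponent, iterStr]

/-- The section `y ↦ (0, y₀, y₁ + T(str) y₀, …)` of the second map of the standard resolution. -/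
noncomputable def standardSection (G : Coalgebra T) :
    ∀ n, (cofreeObj T (T.obj G.V)).V ⟶ iterObj T G.V n
  | 0 => 0
  | n + 1 => (proj T _ n ≫ (iterObjIso T G.V n).hom + standardSection G n ≫ iterStr G n) ≫
      (iterSucc T G.V n).inv

theorem standard_comp (G : Coalgebra T) :
    (cofreeLift G (𝟙 _)).f ≫ (cofreeLift (cofreeObj T G.V) (standardMap G)).f = 0 := by
  refine proj_hom_ext fun n => ?_
  rw [Category.assoc, cofreeLift_proj, cofreeComponent_standardMap, ← Category.assoc,
    Preadditive.comp_sub, ← Category.assoc, ← Category.assoc, cofreeLift_proj, cofreeLift_proj,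
    cofreeComponent_id_succ, sub_self, zero_comp, zero_comp]

/-- The standard resolution `0 ⟶ G ⟶ ∏ₙ Tⁿ G ⟶ ∏ₙ Tⁿ (T G) ⟶ 0` is exact: it is split, as a
sequence of objects, by the projection to `G` and by `standardSection`. -/
theorem standard_shortExact (G : Coalgebra T) :
    (ShortComplex.mk (cofreeLift G (𝟙 _)) (cofreeLift (cofreeObj T G.V) (standardMap G))
      (Coalgebra.ext (standard_comp G))).ShortExact := by
  refine shortExact_of_forget _ _ (standard_comp G) (ShortComplex.Splitting.shortExact
    { r := cofreeCounit T G.V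
      s := projLift (standardSection G)
      f_r := cofreeLift_counit _ _
      s_g := ?_
      id := ?_ })
  · refine proj_hom_ext fun n => ?_
    dsimp only
    rw [Category.assoc, cofreeLift_proj, cofreeComponent_standardMap, ← Category.assoc,
      Preadditive.comp_sub, ← Category.assoc, ← Category.assoc, projLift_proj, projLift_proj,
      standardSection]
    simp
  · refine proj_hom_ext fun n => ?_
    dsimp only
    rw [Preadditive.add_comp, Category.assoc, Category.assoc, cofreeLift_proj, projLift_proj,
      Category.id_comp]
    induction n with
    | zero => simp [standardSection, cofreeComponent, cofreeCounit]
    | succ n ih =>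
      rw [← cancel_mono (iterSucc T G.V n).hom, Preadditive.add_comp, Category.assoc,
        cofreeComponent_id_succ, standardSection, Category.assoc, Category.assoc,
        Iso.inv_hom_id, Category.comp_id, Preadditive.comp_add, ← Category.assoc _ (proj _ _ _),
        cofreeLift_proj, cofreeComponent_standardMap, Category.assoc, Iso.inv_hom_id,
        Category.comp_id, add_left_comm, ← Category.assoc, ← Category.assoc,
        ← Preadditive.add_comp, ih, sub_add_cancel]

end Abelian

end CategoryTheory.Endofunctor.Coalgebra

/-! ### Ext groups of coalgebras -/

namespace CategoryTheory.Endofunctor.Coalgebra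

universe w v u

set_option linter.unusedSectionVars false

variable {C : Type u} [Category.{v} C] [Abelian C] {T : C ⥤ C} [T.Additive]
  [PreservesFiniteLimits T] [HasProductsOfShape ℕ C] [PreservesLimitsOfShape (Discrete ℕ) T]

open Abelian

instance : (forget T).Additive where

instance : (cofree T).Additive := (forgetCofreeAdjunction T).right_adjoint_additive

instance : PreservesLimits (cofree T) := (forgetCofreeAdjunction T).rightAdjoint_preservesLimits

/-- The cofree functor is left exact, so that only the right end has to be checked. -/
theorem cofree_shortExact {S : ShortComplex C} (hS : S.ShortExact) (h : Epi ((cofree T).map S.g)) :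
    (S.map (cofree T)).ShortExact := by
  have := hS.mono_f
  exact { exact := hS.exact.map_of_mono_of_preservesKernel (cofree T) inferInstance inferInstance
          mono_f := inferInstanceAs (Mono ((cofree T).map S.f))
          epi_g := h }

section

variable {D : Type u} [Category.{v} D] [Abelian D] [HasExt.{w} D] {F : D} {S : ShortComplex D}
  (hS : S.ShortExact)

include hS

theorem ext_succ_eq_zero {n : ℕ} (h₂ : ∀ y : Ext F S.X₂ (n + 1), y = 0)
    (h₃ : ∀ y : Ext F S.X₃ n, y = 0) (x : Ext F S.X₁ (n + 1)) : x = 0 := by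
  obtain ⟨y, rfl⟩ := Ext.covariant_sequence_exact₁ F hS x (h₂ _) rfl
  rw [h₃ y, Ext.zero_comp]

/-- If `Ext¹(F, X₂)` vanishes, then the connecting map `Hom(F, X₃) → Ext¹(F, X₁)` is surjective. -/
theorem exists_mk₀_comp_extClass (h₂ : ∀ y : Ext F S.X₂ 1, y = 0) (x : Ext F S.X₁ 1) :
    ∃ k : F ⟶ S.X₃, (Ext.mk₀ k).comp hS.extClass (zero_add 1) = x := by
  obtain ⟨y, rfl⟩ := Ext.covariant_sequence_exact₁ F hS x (h₂ _) (zero_add 1)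
  obtain ⟨k, rfl⟩ := (Ext.mk₀_bijective F _).2 y
  exact ⟨k, rfl⟩

theorem mk₀_comp_extClass_eq_zero_iff (k : F ⟶ S.X₃) :
    (Ext.mk₀ k).comp hS.extClass (zero_add 1) = 0 ↔ ∃ l : F ⟶ S.X₂, l ≫ S.g = k := by
  constructor
  · intro hk
    obtain ⟨y, hy⟩ := Ext.covariant_sequence_exact₃ F hS (Ext.mk₀ k) (zero_add 1) hk
    obtain ⟨l, rfl⟩ := (Ext.mk₀_bijective F _).2 y
    rw [Ext.mk₀_comp_mk₀] at hy
    exact ⟨l, (Ext.mk₀_bijective F _).1 hy⟩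
  · rintro ⟨l, rfl⟩
    rw [← Ext.mk₀_comp_mk₀, Ext.comp_assoc_of_second_deg_zero, hS.comp_extClass, Ext.comp_zero]

theorem ext_one_eq_zero (h₂ : ∀ y : Ext F S.X₂ 1, y = 0)
    (h : ∀ k : F ⟶ S.X₃, ∃ l : F ⟶ S.X₂, l ≫ S.g = k) (x : Ext F S.X₁ 1) : x = 0 := by
  obtain ⟨k, rfl⟩ := exists_mk₀_comp_extClass hS h₂ x
  exact (mk₀_comp_extClass_eq_zero_iff hS k).2 (h k)

theorem exists_comp_eq_iff (k : F ⟶ S.X₂) : (∃ l : F ⟶ S.X₁, l ≫ S.f = k) ↔ k ≫ S.g = 0 := by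
  have := hS.mono_f
  constructor
  · rintro ⟨l, rfl⟩
    rw [Category.assoc, S.zero, comp_zero]
  · intro hk
    exact ⟨hS.fIsKernel.lift (KernelFork.ofι k hk), hS.fIsKernel.fac _ WalkingParallelPair.zero⟩

end

variable [HasExt.{w} (Coalgebra T)]

/-- The higher Ext groups from `F` to the cofree coalgebra on `M` vanish. -/
def CofreeAcyclic (F : Coalgebra T) (M : C) : Prop :=
  ∀ (n : ℕ) (x : Ext F ((cofree T).obj M) (n + 1)), x = 0

theorem cofreeAcyclic_of_injective (F : Coalgebra T) (J : C) [Injective J] :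
    CofreeAcyclic F J := fun _ x => Ext.eq_zero_of_injective x

section

variable (F : Coalgebra T) {S : ShortComplex C} (hS : S.ShortExact)
  (hepi : Epi ((cofree T).map S.g)) (h₂ : CofreeAcyclic F S.X₂)

include hS hepi h₂

/-- By adjunction, the surjectivity of `Hom(F, cofree X₂) → Hom(F, cofree X₃)` is a lifting property
of morphisms of the underlying objects. -/
theorem ext_one_eq_zero_of_shortExact
    (hlift : ∀ φ : F.V ⟶ S.X₃, ∃ ψ : F.V ⟶ S.X₂, ψ ≫ S.g = φ)
    (x : Ext F ((cofree T).obj S.X₁) 1) : x = 0 := by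
  refine ext_one_eq_zero (cofree_shortExact hS hepi) (h₂ 0) (fun k => ?_) x
  obtain ⟨ψ, hψ⟩ := hlift (k.f ≫ cofreeCounit T S.X₃)
  refine ⟨cofreeLift F ψ, (cofreeLift_comp_cofreeLift F ψ S.g).trans (cofree_hom_ext ?_)⟩
  rw [cofreeLift_counit, hψ]
  rfl

theorem ext_succ_eq_zero_of_shortExact {n : ℕ}
    (h₃ : ∀ x : Ext F ((cofree T).obj S.X₃) (n + 1), x = 0)
    (x : Ext F ((cofree T).obj S.X₁) (n + 1 + 1)) : x = 0 := by
  exact ext_succ_eq_zero (cofree_shortExact hS hepi) (h₂ _) h₃ x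

/-- Acyclicity of the kernel: in degree one it is the lifting property, and in higher degrees it
follows from dimension shifting. -/
theorem cofreeAcyclic_of_shortExact (h₃ : CofreeAcyclic F S.X₃)
    (hlift : ∀ φ : F.V ⟶ S.X₃, ∃ ψ : F.V ⟶ S.X₂, ψ ≫ S.g = φ) : CofreeAcyclic F S.X₁
  | 0, x => ext_one_eq_zero_of_shortExact F hS hepi h₂ hlift x
  | n + 1, x => ext_succ_eq_zero_of_shortExact F hS hepi h₂ (h₃ n) x

end

/-- Dimension shifting: a class `P` of objects which contains the injectives and is stable under
quotients in short exact sequences consists of objects acyclic for `F`, as soon as morphisms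
from `F` and the cofree functor behave well on quotients by objects of `P`. -/
theorem cofreeAcyclic_of_class [EnoughInjectives C] (F : Coalgebra T) (P : C → Prop)
    (hinj : ∀ (J : C) [Injective J], P J)
    (hquot : ∀ S : ShortComplex C, S.ShortExact → P S.X₁ → P S.X₂ → P S.X₃)
    (hlift : ∀ S : ShortComplex C, S.ShortExact → P S.X₁ →
      ∀ φ : F.V ⟶ S.X₃, ∃ ψ : F.V ⟶ S.X₂, ψ ≫ S.g = φ)
    (hepi : ∀ S : ShortComplex C, S.ShortExact → P S.X₁ → Epi ((cofree T).map S.g))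
    {M : C} (hM : P M) : CofreeAcyclic F M := by
  intro n
  induction n generalizing M with
  | zero =>
    have hS : (ShortComplex.mk (Injective.ι M) (cokernel.π (Injective.ι M))
        (cokernel.condition _)).ShortExact :=
      { exact := ShortComplex.exact_of_g_is_cokernel _ (cokernelIsCokernel _) }
    exact ext_one_eq_zero_of_shortExact F hS (hepi _ hS hM) (cofreeAcyclic_of_injective F _)
      (hlift _ hS hM)
  | succ n ih =>
    have hS : (ShortComplex.mk (Injective.ι M) (cokernel.π (Injective.ι M))
        (cokernel.condition _)).ShortExact :=
      { exact := ShortComplex.exact_of_g_is_cokernel _ (cokernelIsCokernel _) }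
    exact ext_succ_eq_zero_of_shortExact F hS (hepi _ hS hM) (cofreeAcyclic_of_injective F _)
      (ih (hquot _ hS hM (hinj _)))

section

variable {F G : Coalgebra T} (h₀ : CofreeAcyclic F G.V) (h₁ : CofreeAcyclic F (T.obj G.V))

include h₀ h₁ in
/-- The Ext groups of coalgebras vanish in degrees `≥ 2`, since the standard resolution has
length one. -/
theorem ext_add_two_eq_zero (n : ℕ) (x : Ext F G (n + 1 + 1)) : x = 0 := by
  exact ext_succ_eq_zero (standard_shortExact G) (h₀ _) (h₁ _) x

/-- On the level of morphisms `φ : F ⟶ G` of objects, the differential of the standard resolution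
measures the failure of `φ` to be a map of coalgebras. -/
theorem cofreeLift_comp_standardMap (φ : F.V ⟶ G.V) :
    cofreeLift F φ ≫ cofreeLift (cofreeObj T G.V) (standardMap G) =
      cofreeLift F (F.str ≫ T.map φ - φ ≫ G.str) := by
  refine cofree_hom_ext ?_
  rw [comp_f, Category.assoc, cofreeLift_counit, cofreeLift_counit, standardMap,
    Preadditive.comp_sub, ← Category.assoc, ← (cofreeLift F φ).h, Category.assoc, ← T.map_comp,
    cofreeLift_counit, ← Category.assoc, cofreeLift_counit]

variable (𝕜 : Type*) [Field 𝕜] [Linear 𝕜 (Coalgebra T)]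

variable (F G) in
/-- The connecting homomorphism `Hom(F, T G) ⟶ Ext¹(F, G)` of the standard resolution. -/
noncomputable def connecting :
    (F ⟶ cofreeObj T (T.obj G.V)) →ₗ[𝕜] Ext F G 1 where
  toFun k := (Ext.mk₀ k).comp (standard_shortExact G).extClass (zero_add 1)
  map_add' a b := by rw [Ext.mk₀_add, Ext.add_comp]
  map_smul' c a := by rw [Ext.mk₀_smul, Ext.smul_comp, RingHom.id_apply]

variable (F G) in
/-- The differential `Hom(F, G) ⟶ Hom(F, T G)` of the standard resolution. -/
noncomputable def standardDiff :
    (F ⟶ cofreeObj T G.V) →ₗ[𝕜] (F ⟶ cofreeObj T (T.obj G.V)) :=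
  Linear.rightComp 𝕜 F (cofreeLift (cofreeObj T G.V) (standardMap G))

include h₀ in
theorem connecting_surjective : Function.Surjective (connecting F G 𝕜) :=
  exists_mk₀_comp_extClass (standard_shortExact G) (h₀ _)

theorem ker_connecting :
    LinearMap.ker (connecting F G 𝕜) = LinearMap.range (standardDiff F G 𝕜) :=
  SetLike.ext fun k => mk₀_comp_extClass_eq_zero_iff (standard_shortExact G) k

variable (F G) in
/-- Postcomposition with the inclusion `G ⟶ ∏ₙ Tⁿ G`. -/
noncomputable def homToCofree : (F ⟶ G) →ₗ[𝕜] (F ⟶ cofreeObj T G.V) :=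
  Linear.rightComp 𝕜 F (cofreeLift G (𝟙 _))

theorem homToCofree_injective : Function.Injective (homToCofree F G 𝕜) := fun a b h => by
  have : Mono (cofreeLift G (𝟙 _)) := (standard_shortExact G).mono_f
  exact (cancel_mono (cofreeLift G (𝟙 _))).1 h

theorem range_homToCofree :
    LinearMap.range (homToCofree F G 𝕜) = LinearMap.ker (standardDiff F G 𝕜) :=
  SetLike.ext fun k => exists_comp_eq_iff (standard_shortExact G) k

variable [Module.Finite 𝕜 (F ⟶ cofreeObj T G.V)]
  [Module.Finite 𝕜 (F ⟶ cofreeObj T (T.obj G.V))]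

theorem finite_hom : Module.Finite 𝕜 (F ⟶ G) :=
  Module.Finite.of_injective _ (homToCofree_injective 𝕜)

theorem finite_ext_zero : Module.Finite 𝕜 (Ext F G 0) :=
  have := finite_hom (F := F) (G := G) 𝕜
  Module.Finite.equiv (Ext.linearEquiv₀ (R := 𝕜)).symm

include h₀ in
theorem finite_ext_one : Module.Finite 𝕜 (Ext F G 1) :=
  Module.Finite.of_surjective _ (connecting_surjective h₀ 𝕜)

include h₀ in
/-- The Euler characteristic of the Ext groups of coalgebras. -/
theorem finrank_ext_one_add :
    Module.finrank 𝕜 (Ext F G 1) + Module.finrank 𝕜 (F ⟶ cofreeObj T G.V) =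
      Module.finrank 𝕜 (F ⟶ cofreeObj T (T.obj G.V)) + Module.finrank 𝕜 (F ⟶ G) := by
  have e₁ := LinearMap.finrank_range_add_finrank_ker (connecting F G 𝕜)
  have e₂ := LinearMap.finrank_range_add_finrank_ker (standardDiff F G 𝕜)
  have e₃ := LinearMap.finrank_range_of_inj (homToCofree_injective (F := F) (G := G) 𝕜)
  rw [LinearMap.range_eq_top.2 (connecting_surjective h₀ 𝕜), finrank_top, ker_connecting] at e₁
  rw [range_homToCofree] at e₃
  omega

end

end CategoryTheory.Endofunctor.Coalgebra

/-! ### Sections of sheaves of modules on a topological space -/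

namespace SheafOfModules

universe v

section

variable {C : Type v} [SmallCategory.{v} C] {J : GrothendieckTopology C} (R : Sheaf J RingCat.{v})
  [HasSheafify J AddCommGrpCat.{v}] [J.WEqualsLocallyBijective AddCommGrpCat.{v}]

/-- Colimits of sheaves of modules are sheafifications of colimits of presheaves of modules, so
that they are preserved by the forgetful functor to abelian sheaves. -/
instance preservesFiniteColimits_toSheaf : PreservesFiniteColimits (toSheaf.{v} R) where
  preservesFiniteColimits K _ _ := ⟨fun {F} => by
    let A := PresheafOfModules.sheafification (𝟙 R.obj)
    let G := F ⋙ forget R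
    let e : F ≅ G ⋙ A :=
      Functor.isoWhiskerLeft F
        (asIso (PresheafOfModules.sheafificationAdjunction (𝟙 R.obj)).counit).symm
    have h1 : PreservesColimit G (A ⋙ toSheaf R) :=
      preservesColimit_of_natIso G (PresheafOfModules.sheafificationCompToSheaf (𝟙 R.obj)).symm
    have h2 : PreservesColimit (G ⋙ A) (toSheaf R) :=
      preservesColimit_of_preserves_colimit_cocone
        (isColimitOfPreserves A (colimit.isColimit G))
        (isColimitOfPreserves (A ⋙ toSheaf R) (colimit.isColimit G))
    exact preservesColimit_of_iso_diagram _ e.symm⟩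

end

variable {X : TopCat.{0}} {R : Sheaf (Opens.grothendieckTopology X) RingCat.{0}}

/-- The sections of a sheaf of modules on an open set. -/
abbrev sec (M : SheafOfModules.{0} R) (U : Opens X) : Type := M.val.obj (op U)

/-- The restriction of sections. -/
noncomputable def res (M : SheafOfModules.{0} R) {U V : Opens X} (h : V ≤ U) :
    sec M U →+ sec M V :=
  (M.val.restrictₛₗ (homOfLE h).op).toAddMonoidHom

/-- The restriction of sections of the structure sheaf. -/
noncomputable def ringRes (R : Sheaf (Opens.grothendieckTopology X) RingCat.{0}) {U V : Opens X}
    (h : V ≤ U) : R.obj.obj (op U) →+* R.obj.obj (op V) :=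
  (R.obj.map (homOfLE h).op).hom

theorem res_smul (M : SheafOfModules.{0} R) {U V : Opens X} (h : V ≤ U) (r : R.obj.obj (op U))
    (m : sec M U) : res M h (r • m) = ringRes R h r • res M h m :=
  M.val.map_smul (homOfLE h).op r m

theorem res_res (M : SheafOfModules.{0} R) {U V W : Opens X} (h : V ≤ U) (h' : W ≤ V)
    (m : sec M U) : res M h' (res M h m) = res M (h'.trans h) m := by
  have := ConcreteCategory.congr_hom (M.val.presheaf.map_comp (homOfLE h).op (homOfLE h').op) m
  exact this.symm

theorem res_self (M : SheafOfModules.{0} R) {U : Opens X} (m : sec M U) :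
    res M le_rfl m = m :=
  ConcreteCategory.congr_hom (M.val.presheaf.map_id (op U)) m

/-- The map on sections of a morphism of sheaves of modules. -/
noncomputable def app {M N : SheafOfModules.{0} R} (φ : M ⟶ N) (U : Opens X) :
    sec M U →ₗ[R.obj.obj (op U)] sec N U :=
  (φ.val.app (op U)).hom

theorem app_res {M N : SheafOfModules.{0} R} (φ : M ⟶ N) {U V : Opens X} (h : V ≤ U)
    (m : sec M U) : app φ V (res M h m) = res N h (app φ U m) :=
  PresheafOfModules.naturality_apply φ.val (homOfLE h).op m

theorem hom_ext_app {M N : SheafOfModules.{0} R} {φ ψ : M ⟶ N}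
    (h : ∀ U m, app φ U m = app ψ U m) : φ = ψ := by
  ext U m
  exact h U.unop m

theorem app_comp {M N P : SheafOfModules.{0} R} (φ : M ⟶ N) (ψ : N ⟶ P) (U : Opens X)
    (m : sec M U) : app (φ ≫ ψ) U m = app ψ U (app φ U m) := rfl

theorem app_zero {M N : SheafOfModules.{0} R} (U : Opens X)
    (m : sec M U) : app (0 : M ⟶ N) U m = 0 := rfl

/-- The constructor of morphisms from compatible linear maps on sections. -/
noncomputable def mkHom {M N : SheafOfModules.{0} R}
    (φ : ∀ U : Opens X, sec M U →ₗ[R.obj.obj (op U)] sec N U)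
    (h : ∀ (U V : Opens X) (h : V ≤ U) (m : sec M U), φ V (res M h m) = res N h (φ U m)) :
    M ⟶ N where
  val :=
    { app U := ModuleCat.ofHom (φ U.unop)
      naturality {U V} i := by
        ext m
        exact h U.unop V.unop i.unop.le m }

/-- The underlying sheaf of abelian groups. -/
noncomputable def abSheaf (M : SheafOfModules.{0} R) : TopCat.Sheaf AddCommGrpCat.{0} X :=
  ⟨M.val.presheaf, M.isSheaf⟩

theorem sec_ext (M : SheafOfModules.{0} R) {V : Opens X} {s t : sec M V}
    (h : ∀ x ∈ V, ∃ (W : Opens X) (hW : W ≤ V), x ∈ W ∧ res M hW s = res M hW t) : s = t := by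
  choose! W hW hx hst using h
  refine TopCat.Sheaf.eq_of_locally_eq' (abSheaf M) (fun x : V => W x) V
    (fun x => homOfLE (hW x x.2)) (fun x hxV => ?_) s t (fun x => hst x x.2)
  exact Opens.mem_iSup.2 ⟨⟨x, hxV⟩, hx x hxV⟩

theorem exists_glue (M : SheafOfModules.{0} R) {ι : Type*} {U : ι → Opens X} {V : Opens X}
    (hU : ∀ i, U i ≤ V) (hV : ∀ x ∈ V, ∃ i, x ∈ U i) (s : ∀ i, sec M (U i))
    (hs : ∀ i j, res M (inf_le_left : U i ⊓ U j ≤ U i) (s i) =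
      res M (inf_le_right : U i ⊓ U j ≤ U j) (s j)) :
    ∃ t : sec M V, ∀ i, res M (hU i) t = s i := by
  obtain ⟨t, ht, -⟩ := TopCat.Sheaf.existsUnique_gluing' (abSheaf M) U V
    (fun i => homOfLE (hU i)) (fun x hx => Opens.mem_iSup.2 (hV x hx))
    (show ∀ i, ToType ((abSheaf M).1.obj (op (U i))) from s) hs
  exact ⟨t, ht⟩

theorem sec_ext₂ (M : SheafOfModules.{0} R) {U₁ U₂ V : Opens X} (h₁ : U₁ ≤ V) (h₂ : U₂ ≤ V)
    (hV : V ≤ U₁ ⊔ U₂) {s t : sec M V} (e₁ : res M h₁ s = res M h₁ t)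
    (e₂ : res M h₂ s = res M h₂ t) : s = t :=
  sec_ext M fun x hx => by
    obtain h | h := hV hx
    · exact ⟨U₁, h₁, h, e₁⟩
    · exact ⟨U₂, h₂, h, e₂⟩

theorem exists_glue₂ (M : SheafOfModules.{0} R) {U₁ U₂ V : Opens X} (h₁ : U₁ ≤ V) (h₂ : U₂ ≤ V)
    (hV : V ≤ U₁ ⊔ U₂) (s₁ : sec M U₁) (s₂ : sec M U₂)
    (hs : ∀ (W : Opens X) (w₁ : W ≤ U₁) (w₂ : W ≤ U₂), res M w₁ s₁ = res M w₂ s₂) :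
    ∃ t : sec M V, res M h₁ t = s₁ ∧ res M h₂ t = s₂ := by
  obtain ⟨t, ht⟩ := exists_glue M (ι := Bool) (U := fun b => bif b then U₁ else U₂) (V := V)
    (fun b => by cases b; exacts [h₂, h₁])
    (fun x hx => by
      obtain h | h := hV hx
      · exact ⟨true, h⟩
      · exact ⟨false, h⟩)
    (fun b => match b with | true => s₁ | false => s₂)
    (fun i j => by
      cases i <;> cases j
      · rfl
      · exact (hs _ _ _).symm
      · exact hs _ _ _
      · rfl)
  exact ⟨t, ht true, ht false⟩

/-! ### Exactness and sections -/

theorem epi_of_locally_surjective {M N : SheafOfModules.{0} R} (φ : M ⟶ N)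
    (h : ∀ (U : Opens X) (n : sec N U), ∀ x ∈ U, ∃ (V : Opens X) (hV : V ≤ U) (m : sec M V),
      x ∈ V ∧ app φ V m = res N hV n) : Epi φ := by
  refine (toSheaf R).epi_of_epi_map ?_
  refine (TopCat.Sheaf.isLocallySurjective_iff_epi (F := abSheaf M) (G := abSheaf N)
    ((toSheaf R).map φ)).1 ?_
  constructor
  intro U n x hx
  obtain ⟨V, hV, m, hx, e⟩ := h U n x hx
  exact ⟨V, homOfLE hV, ⟨m, e⟩, hx⟩

theorem locally_surjective_of_epi {M N : SheafOfModules.{0} R} (φ : M ⟶ N) [Epi φ]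
    (U : Opens X) (n : sec N U) (x : X) (hx : x ∈ U) :
    ∃ (V : Opens X) (hV : V ≤ U) (m : sec M V), x ∈ V ∧ app φ V m = res N hV n := by
  have h : Epi ((toSheaf R).map φ) := inferInstance
  replace h := (TopCat.Sheaf.isLocallySurjective_iff_epi (F := abSheaf M) (G := abSheaf N)
    ((toSheaf R).map φ)).2 h
  obtain ⟨V, hV, ⟨m, e⟩, hx⟩ := h.imageSieve_mem n x hx
  exact ⟨V, hV.le, m, hx, e⟩

theorem mono_of_app_injective {M N : SheafOfModules.{0} R} (φ : M ⟶ N)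
    (h : ∀ U, Function.Injective (app φ U)) : Mono φ where
  right_cancellation a b e := hom_ext_app fun U m => h U (by
    rw [← app_comp, ← app_comp, e])

/-- Taking sections is left exact. -/
theorem exists_of_app_eq_zero {S : ShortComplex (SheafOfModules.{0} R)} (hS : S.ShortExact)
    {U : Opens X} (t : sec S.X₂ U) (ht : app S.g U t = 0) : ∃ s : sec S.X₁ U, app S.f U s = t := by
  have := hS.mono_f
  have : (evaluation R (op U)).PreservesZeroMorphisms := ⟨fun _ _ => rfl⟩
  have h := hS.exact.map_of_mono_of_preservesKernel (evaluation R (op U)) inferInstance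
    inferInstance
  rw [ShortComplex.moduleCat_exact_iff] at h
  exact h t ht

theorem app_app_eq_zero (S : ShortComplex (SheafOfModules.{0} R))
    {U : Opens X} (s : sec S.X₁ U) : app S.g U (app S.f U s) = 0 := by
  rw [← app_comp, S.zero, app_zero]

/-- Sections of a product are families of sections. -/
theorem exists_pi_section {ι : Type} (M : ι → SheafOfModules.{0} R) {U : Opens X}
    (s : ∀ i, sec (M i) U) : ∃ t : sec (∏ᶜ M) U, ∀ i, app (Pi.π M i) U t = s i := by
  let G := evaluation R (op U) ⋙ CategoryTheory.forget (ModuleCat (R.obj.obj (op U)))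
  have hl := isLimitOfHasProductOfPreservesLimit G M
  let c : Fan (fun i => G.obj (M i)) := Fan.mk PUnit (fun i => ↾(fun _ => s i))
  refine ⟨hl.lift c PUnit.unit, fun i => ?_⟩
  exact ConcreteCategory.congr_hom (hl.fac c ⟨i⟩) PUnit.unit

theorem pi_section_ext {ι : Type} (M : ι → SheafOfModules.{0} R) {U : Opens X}
    {s t : sec (∏ᶜ M) U} (h : ∀ i, app (Pi.π M i) U s = app (Pi.π M i) U t) : s = t := by
  let G := evaluation R (op U) ⋙ CategoryTheory.forget (ModuleCat (R.obj.obj (op U)))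
  have hl := isLimitOfHasProductOfPreservesLimit G M
  have := hl.hom_ext (W := PUnit) (f := ↾(fun _ => s)) (f' := ↾(fun _ => t)) (fun i => by
    ext
    exact h i.as)
  exact ConcreteCategory.congr_hom this PUnit.unit

end SheafOfModules

/-! ### Soft sheaves of modules -/

namespace SheafOfModules

variable {X : TopCat.{0}} {R : Sheaf (Opens.grothendieckTopology X) RingCat.{0}}

/-- A sheaf is soft if each section near a closed set agrees, near that closed set, with a global
section. -/
def IsSoft (M : SheafOfModules.{0} R) : Prop :=
  ∀ (U : Opens X) (s : sec M U) (K : Set X), IsClosed K → K ⊆ U →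
    ∃ (t : sec M ⊤) (V : Opens X) (hV : V ≤ U), K ⊆ V ∧ res M le_top t = res M hV s

/-- A morphism has the closed lifting property if sections near a closed set can be lifted near that
closed set. -/
def ClosedLift {M N : SheafOfModules.{0} R} (φ : M ⟶ N) : Prop :=
  ∀ (U : Opens X) (n : sec N U) (K : Set X), IsClosed K → K ⊆ U →
    ∃ (V : Opens X) (hV : V ≤ U) (m : sec M V), K ⊆ V ∧ app φ V m = res N hV n

theorem ClosedLift.epi [T1Space X] {M N : SheafOfModules.{0} R} {φ : M ⟶ N} (h : ClosedLift φ) :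
    Epi φ := epi_of_locally_surjective φ fun U n x hx => by
  obtain ⟨V, hV, m, hK, e⟩ := h U n {x} isClosed_singleton (singleton_subset_iff.2 hx)
  exact ⟨V, hV, m, hK rfl, e⟩

/-- Each section of an injective sheaf of modules extends to a global section, since the sheaf
`𝒪_U`, extended by zero, is a subsheaf of `𝒪`. -/
theorem exists_extension_of_injective (J : SheafOfModules.{0} R) [Injective J] (U : Opens X)
    (s : sec J U) : ∃ t : sec J ⊤, res J le_top t = s := by
  let adj := PresheafOfModules.sheafificationAdjunction (𝟙 R.obj)
  let ι : (PresheafOfModules.free R.obj).obj (yoneda.obj U) ⟶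
      (PresheafOfModules.free R.obj).obj (yoneda.obj (⊤ : Opens X)) :=
    (PresheafOfModules.free R.obj).map (yoneda.map (homOfLE le_top))
  have hι : Mono ι := by
    refine ((PresheafOfModules.toPresheaf R.obj).mono_of_mono_map ?_)
    refine @NatTrans.mono_of_mono_app _ _ _ _ _ _ _ fun V => ?_
    rw [AddCommGrpCat.mono_iff_injective]
    exact Finsupp.mapDomain_injective fun (a b : V.unop ⟶ U) _ => Subsingleton.elim a b
  let J' := (forget R ⋙ PresheafOfModules.restrictScalars (𝟙 R.obj)).obj J
  let a : (PresheafOfModules.free R.obj).obj (yoneda.obj U) ⟶ J' :=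
    PresheafOfModules.freeYonedaEquiv.symm s
  let b := Injective.factorThru ((adj.homEquiv _ J).symm a)
    ((PresheafOfModules.sheafification (𝟙 R.obj)).map ι)
  have hb : ι ≫ adj.homEquiv _ J b = a := by
    rw [← adj.homEquiv_naturality_left, Injective.comp_factorThru, Equiv.apply_symm_apply]
  refine ⟨PresheafOfModules.freeYonedaEquiv (adj.homEquiv _ J b), ?_⟩
  have h1 := PresheafOfModules.naturality_apply (adj.homEquiv _ J b)
    (homOfLE (le_top : U ≤ ⊤)).op (ModuleCat.freeMk (𝟙 (⊤ : Opens X)))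
  refine h1.symm.trans ?_
  have h2 : (((PresheafOfModules.free R.obj).obj (yoneda.obj (⊤ : Opens X))).map
      (homOfLE (le_top : U ≤ ⊤)).op) (ModuleCat.freeMk (𝟙 (⊤ : Opens X))) =
      ι.app (op U) (ModuleCat.freeMk (𝟙 U)) := by
    rw [PresheafOfModules.free_map_app]
    erw [ModuleCat.freeDesc_apply, ModuleCat.free_map_apply]
    rfl
  refine (congrArg _ h2).trans ?_
  have h3 := PresheafOfModules.freeYonedaEquiv_symm_app J' U s
  refine Eq.trans ?_ h3
  change (ι ≫ adj.homEquiv _ J b).app (op U) _ = _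
  rw [hb]

theorem isSoft_of_injective (J : SheafOfModules.{0} R) [Injective J] : IsSoft J :=
  fun U s _ _ hKU => by
    obtain ⟨t, ht⟩ := exists_extension_of_injective J U s
    exact ⟨t, U, le_rfl, hKU, ht.trans (res_self J s).symm⟩

section

variable [CompactSpace X] [T2Space X]

/-- Neighbourhoods of two closed sets can be shrunk so that they meet only in a given neighbourhood
of the intersection of the closed sets. -/
theorem exists_shrinking {K₁ K₂ : Set X} (h₁ : IsClosed K₁) (h₂ : IsClosed K₂) {V₁ V₂ W : Opens X}
    (hV₁ : K₁ ⊆ V₁) (hV₂ : K₂ ⊆ V₂) (hW : K₁ ∩ K₂ ⊆ W) :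
    ∃ V₁' ≤ V₁, ∃ V₂' ≤ V₂, K₁ ⊆ V₁' ∧ K₂ ⊆ V₂' ∧ V₁' ⊓ V₂' ≤ W := by
  obtain ⟨A₁, A₂, hA₁, hA₂, hK₁, hK₂, hd⟩ := normal_separation (s := K₁ \ W) (t := K₂ \ W)
    (h₁.sdiff W.isOpen) (h₂.sdiff W.isOpen)
    (Set.disjoint_left.2 fun x hx hx' => hx.2 (hW ⟨hx.1, hx'.1⟩))
  refine ⟨V₁ ⊓ (⟨A₁, hA₁⟩ ⊔ W), inf_le_left, V₂ ⊓ (⟨A₂, hA₂⟩ ⊔ W), inf_le_left,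
    fun x hx => ⟨hV₁ hx, ?_⟩, fun x hx => ⟨hV₂ hx, ?_⟩, ?_⟩
  · by_cases h : x ∈ W
    · exact Or.inr h
    · exact Or.inl (hK₁ ⟨hx, h⟩)
  · by_cases h : x ∈ W
    · exact Or.inr h
    · exact Or.inl (hK₂ ⟨hx, h⟩)
  · rintro x ⟨⟨-, h | h⟩, ⟨-, h' | h'⟩⟩
    · exact (Set.disjoint_left.1 hd h h').elim
    all_goals assumption

variable {S : ShortComplex (SheafOfModules.{0} R)} (hS : S.ShortExact)

include hS

/-- Two lifts near closed sets can be patched to a lift near their union: they differ by a section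
of the kernel near the intersection, which extends globally if the kernel is soft. -/
theorem IsSoft.exists_lift_union (h : IsSoft S.X₁) {U : Opens X} (q : sec S.X₃ U) {K₁ K₂ : Set X}
    (h₁ : IsClosed K₁) (h₂ : IsClosed K₂) {V₁ V₂ : Opens X} (hV₁ : V₁ ≤ U) (hV₂ : V₂ ≤ U)
    (hK₁ : K₁ ⊆ V₁) (hK₂ : K₂ ⊆ V₂) (t₁ : sec S.X₂ V₁) (t₂ : sec S.X₂ V₂)
    (e₁ : app S.g V₁ t₁ = res S.X₃ hV₁ q) (e₂ : app S.g V₂ t₂ = res S.X₃ hV₂ q) :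
    ∃ (V : Opens X) (hV : V ≤ U) (t : sec S.X₂ V), K₁ ∪ K₂ ⊆ V ∧
      app S.g V t = res S.X₃ hV q := by
  obtain ⟨s, hs⟩ := exists_of_app_eq_zero hS (U := V₁ ⊓ V₂)
    (res S.X₂ inf_le_left t₁ - res S.X₂ inf_le_right t₂) (by
      rw [map_sub, app_res, app_res, e₁, e₂, res_res, res_res, sub_self])
  obtain ⟨r, W, hW, hKW, hr⟩ := h _ s (K₁ ∩ K₂) (h₁.inter h₂)
    (fun x hx => ⟨hK₁ hx.1, hK₂ hx.2⟩)
  obtain ⟨V₁', hV₁', V₂', hV₂', hK₁', hK₂', hle⟩ := exists_shrinking h₁ h₂ hK₁ hK₂ hKW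
  obtain ⟨t, ht₁, ht₂⟩ := exists_glue₂ S.X₂ (le_sup_left : V₁' ≤ V₁' ⊔ V₂') le_sup_right le_rfl
    (res S.X₂ hV₁' t₁ - app S.f _ (res S.X₁ le_top r)) (res S.X₂ hV₂' t₂) (fun A a₁ a₂ => by
      have hA : A ≤ W := (le_inf a₁ a₂).trans hle
      have := congrArg (res S.X₁ hA) hr
      rw [res_res, res_res] at this
      rw [map_sub, ← app_res, res_res, res_res, res_res, this, app_res, hs, map_sub, res_res,
        res_res, sub_sub_cancel])
  refine ⟨V₁' ⊔ V₂', sup_le (hV₁'.trans hV₁) (hV₂'.trans hV₂), t,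
    union_subset (hK₁'.trans (show V₁' ≤ V₁' ⊔ V₂' from le_sup_left))
      (hK₂'.trans (show V₂' ≤ V₁' ⊔ V₂' from le_sup_right)), ?_⟩
  refine sec_ext₂ S.X₃ (le_sup_left : V₁' ≤ V₁' ⊔ V₂') le_sup_right le_rfl ?_ ?_
  · rw [← app_res, ht₁, map_sub, app_app_eq_zero, sub_zero, app_res, e₁, res_res, res_res]
  · rw [← app_res, ht₂, app_res, e₂, res_res, res_res]

/-- Local lifts exist at each point, and by compactness they can be patched finitely often to a lift
near a closed set. -/
theorem IsSoft.closedLift (h : IsSoft S.X₁) : ClosedLift S.g := by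
  intro U q K hK hKU
  have := hS.epi_g
  have hP := hK.isCompact.induction_on (p := fun A => ∃ (V : Opens X) (hV : V ≤ U)
    (t : sec S.X₂ V), closure A ⊆ V ∧ app S.g V t = res S.X₃ hV q) ?_ ?_ ?_ ?_
  · obtain ⟨V, hV, t, hKV, e⟩ := hP
    exact ⟨V, hV, t, subset_closure.trans hKV, e⟩
  · exact ⟨⊥, bot_le, 0, by simp, sec_ext _ fun x hx => hx.elim⟩
  · rintro A B hAB ⟨V, hV, t, hB, e⟩
    exact ⟨V, hV, t, (closure_mono hAB).trans hB, e⟩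
  · rintro A B ⟨V, hV, t, hA, e⟩ ⟨V', hV', t', hB, e'⟩
    rw [closure_union]
    exact h.exists_lift_union hS q isClosed_closure isClosed_closure hV hV' hA hB t t' e e'
  · intro x hx
    obtain ⟨V, hV, t, hxV, e⟩ := locally_surjective_of_epi S.g U q x (hKU hx)
    obtain ⟨A, hA, hAc, hAV⟩ := exists_mem_nhds_isClosed_subset (V.isOpen.mem_nhds hxV)
    exact ⟨A, mem_nhdsWithin_of_mem_nhds hA, V, hV, t, hAc.closure_eq.subset.trans hAV, e⟩

theorem IsSoft.of_shortExact (h₁ : IsSoft S.X₁) (h₂ : IsSoft S.X₂) : IsSoft S.X₃ := by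
  intro U q K hK hKU
  obtain ⟨V, hV, t, hKV, e⟩ := h₁.closedLift hS U q K hK hKU
  obtain ⟨r, W, hW, hKW, hr⟩ := h₂ V t K hK hKV
  refine ⟨app S.g _ r, W, hW.trans hV, hKW, ?_⟩
  rw [← app_res, hr, app_res, e, res_res]

end

end SheafOfModules

/-! ### Direct images of soft sheaves -/

namespace RiemannSurface

open SheafOfModules CategoryTheory.Endofunctor.Coalgebra

variable {X : TopCat.{0}} [ChartedSpace ℂ X] (f : HolEnd X)

/-- The preimage of an open set. -/
noncomputable def preim (U : Opens X) : Opens X := (Opens.map f.toTop).obj U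

theorem preim_mono {U V : Opens X} (h : U ≤ V) : preim f U ≤ preim f V := fun _ hx => h hx

variable [CompactSpace X] [T2Space X]

/-- A neighbourhood of the preimage of a closed set contains the preimage of a neighbourhood, since
`f` is a closed map. -/
theorem exists_preim_le {K : Set X} {V : Opens X} (hV : f ⁻¹' K ⊆ V) :
    ∃ W : Opens X, K ⊆ W ∧ preim f W ≤ V := by
  have hc : IsClosed (f '' (V : Set X)ᶜ) :=
    (V.isOpen.isClosed_compl.isCompact.image f.contMDiff.continuous).isClosed
  refine ⟨⟨_, hc.isOpen_compl⟩, ?_, ?_⟩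
  · rintro _ hx ⟨y, hy, rfl⟩
    exact hy (hV hx)
  · intro x hx
    by_contra h
    exact hx ⟨x, h, rfl⟩

/-- Direct images of soft sheaves under a proper map are soft: a neighbourhood of the preimage of a
closed set contains the preimage of a neighbourhood. -/
theorem isSoft_direct {M : SheafOfModules.{0} (holSheaf X)} (h : IsSoft M) :
    IsSoft ((direct f).obj M) := by
  intro U s K hK hKU
  obtain ⟨t, V, hV, hKV, e⟩ := h (preim f U) s (f ⁻¹' K) (hK.preimage f.contMDiff.continuous)
    (fun x hx => hKU hx)
  obtain ⟨W, hKW, hW⟩ := exists_preim_le f hKV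
  refine ⟨t, W ⊓ U, inf_le_right, fun x hx => ⟨hKW hx, hKU hx⟩, ?_⟩
  have hle : preim f (W ⊓ U) ≤ V := (preim_mono f inf_le_left).trans hW
  exact (res_res M le_top hle t).symm.trans ((congrArg (res M hle) e).trans (res_res M hV hle s))

theorem closedLift_direct {M N : SheafOfModules.{0} (holSheaf X)} {φ : M ⟶ N}
    (h : ClosedLift φ) : ClosedLift ((direct f).map φ) := by
  intro U s K hK hKU
  obtain ⟨V, hV, t, hKV, e⟩ := h (preim f U) s (f ⁻¹' K) (hK.preimage f.contMDiff.continuous)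
    (fun x hx => hKU hx)
  obtain ⟨W, hKW, hW⟩ := exists_preim_le f hKV
  have hle : preim f (W ⊓ U) ≤ V := (preim_mono f inf_le_left).trans hW
  refine ⟨W ⊓ U, inf_le_right, res M hle t, fun x hx => ⟨hKW hx, hKU hx⟩, ?_⟩
  refine (app_res φ hle t).trans ?_
  exact (congrArg (res N hle) e).trans (res_res N hV hle s)

theorem closedLift_iterMap {M N : SheafOfModules.{0} (holSheaf X)} {φ : M ⟶ N}
    (h : ClosedLift φ) : ∀ n, ClosedLift (iterMap (direct f) φ n)
  | 0 => h
  | n + 1 => closedLift_direct f (closedLift_iterMap h n)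

/-- The cofree functor preserves epimorphisms with the closed lifting property: a section of an
infinite product can be lifted on a closed neighbourhood of a point. -/
theorem epi_cofree_map {M N : SheafOfModules.{0} (holSheaf X)} {φ : M ⟶ N} (h : ClosedLift φ) :
    Epi ((cofree (direct f)).map φ) := by
  suffices Epi ((cofree (direct f)).map φ).f from epi_of_epi _
  refine epi_of_locally_surjective _ fun U q x hx => ?_
  obtain ⟨A, hA, hAc, hAU⟩ := exists_mem_nhds_isClosed_subset (U.isOpen.mem_nhds hx)
  choose V hV m hAV e using fun n => closedLift_iterMap f h n U
    (app (proj (direct f) N n) U q) A hAc hAU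
  let W : Opens X := ⟨interior A, isOpen_interior⟩
  have hWV (n) : W ≤ V n := fun y hy => hAV n (interior_subset hy)
  have hWU : W ≤ U := fun y hy => hAU (interior_subset hy)
  obtain ⟨t, ht⟩ := exists_pi_section (iterObj (direct f) M) fun n => res _ (hWV n) (m n)
  refine ⟨W, hWU, t, mem_interior_iff_mem_nhds.2 hA, ?_⟩
  refine pi_section_ext (iterObj (direct f) N) fun n => ?_
  have h1 : app (proj (direct f) N n) W (app ((cofree (direct f)).map φ).f W t) =
      app (iterMap (direct f) φ n) W (app (proj (direct f) M n) W t) :=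
    congrArg (fun ψ => app ψ W t) (cofree_map_proj φ n)
  refine h1.trans ((congrArg _ (ht n)).trans ?_)
  rw [app_res, e, res_res]
  exact (app_res (proj (direct f) N n) hWU q).symm

end RiemannSurface

/-! ### Morphisms from an invertible sheaf which is trivial on two open sets -/

namespace SheafOfModules

variable {X : TopCat.{0}} {R : Sheaf (Opens.grothendieckTopology X) RingCat.{0}}

theorem ringRes_ringRes {U V W : Opens X} (h : V ≤ U) (h' : W ≤ V) (r : R.obj.obj (op U)) :
    ringRes R h' (ringRes R h r) = ringRes R (h'.trans h) r :=
  (ConcreteCategory.congr_hom (R.obj.map_comp (homOfLE h).op (homOfLE h').op) r).symm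

/-- A basis of a sheaf of modules on an open set, consisting of one section. -/
structure Frame (L : SheafOfModules.{0} R) (W : Opens X) where
  /-- the generating section -/
  gen : sec L W
  /-- the coefficient of a section with respect to the generator -/
  coef : ∀ U : Opens X, U ≤ W → (sec L U →ₗ[R.obj.obj (op U)] R.obj.obj (op U))
  coef_smul : ∀ (U : Opens X) (h : U ≤ W) (s : sec L U), coef U h s • res L h gen = s
  coef_gen : ∀ (U : Opens X) (h : U ≤ W), coef U h (res L h gen) = 1

namespace Frame

variable {L M : SheafOfModules.{0} R} {W : Opens X} (F : Frame L W)

theorem coef_res {U V : Opens X} (hU : U ≤ W) (h : V ≤ U) (s : sec L U) :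
    F.coef V (h.trans hU) (res L h s) = ringRes R h (F.coef U hU s) := by
  conv_lhs => rw [← F.coef_smul U hU s, res_smul, res_res, map_smul, F.coef_gen, smul_eq_mul,
    mul_one]

/-- The restriction of a frame. -/
noncomputable def restrict {V : Opens X} (h : V ≤ W) : Frame L V where
  gen := res L h F.gen
  coef U hU := F.coef U (hU.trans h)
  coef_smul U hU s := by rw [res_res, F.coef_smul]
  coef_gen U hU := by rw [res_res, F.coef_gen]

theorem app_eq (φ : L ⟶ M) {U : Opens X} (h : U ≤ W) (s : sec L U) :
    app φ U s = F.coef U h s • res M h (app φ W F.gen) := by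
  conv_lhs => rw [← F.coef_smul U h s, map_smul, app_res]

end Frame

variable {L M : SheafOfModules.{0} R} {W₀ W₁ : Opens X} (F₀ : Frame L W₀) (F₁ : Frame L W₁)

/-- The transition function `F₁.gen / F₀.gen`. -/
noncomputable def transition : R.obj.obj (op (W₀ ⊓ W₁)) :=
  F₀.coef _ inf_le_left (res L inf_le_right F₁.gen)

theorem app_gen_eq (φ : L ⟶ M) : res M inf_le_right (app φ W₁ F₁.gen) =
    transition F₀ F₁ • res M inf_le_left (app φ W₀ F₀.gen) := by
  rw [← app_res, F₀.app_eq φ inf_le_left]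
  rfl

theorem hom_ext_frames (hW : ∀ x, x ∈ W₀ ∨ x ∈ W₁) {φ ψ : L ⟶ M}
    (h₀ : app φ W₀ F₀.gen = app ψ W₀ F₀.gen) (h₁ : app φ W₁ F₁.gen = app ψ W₁ F₁.gen) : φ = ψ :=
  hom_ext_app fun U s => by
    refine sec_ext₂ M (inf_le_left : U ⊓ W₀ ≤ U) (inf_le_left : U ⊓ W₁ ≤ U)
      (fun x hx => (hW x).imp (fun h => ⟨hx, h⟩) (fun h => ⟨hx, h⟩)) ?_ ?_
    · rw [← app_res, ← app_res, F₀.app_eq φ inf_le_right, F₀.app_eq ψ inf_le_right, h₀]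
    · rw [← app_res, ← app_res, F₁.app_eq φ inf_le_right, F₁.app_eq ψ inf_le_right, h₁]

/-- Morphisms from an invertible sheaf are given by the images of the two generators. -/
theorem exists_hom_of_frames (hW : ∀ x, x ∈ W₀ ∨ x ∈ W₁) (m₀ : sec M W₀) (m₁ : sec M W₁)
    (h : res M inf_le_right m₁ = transition F₀ F₁ • res M inf_le_left m₀) :
    ∃ φ : L ⟶ M, app φ W₀ F₀.gen = m₀ ∧ app φ W₁ F₁.gen = m₁ := by
  -- the image of a section of `L` is determined on the two open sets, where it has a coefficient
  have key (U : Opens X) (s : sec L U) : ∃ t : sec M U,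
      res M (inf_le_left : U ⊓ W₀ ≤ U) t =
        F₀.coef _ inf_le_right (res L inf_le_left s) • res M inf_le_right m₀ ∧
      res M (inf_le_left : U ⊓ W₁ ≤ U) t =
        F₁.coef _ inf_le_right (res L inf_le_left s) • res M inf_le_right m₁ := by
    refine exists_glue₂ M inf_le_left inf_le_left
      (fun x hx => (hW x).imp (fun h => ⟨hx, h⟩) (fun h => ⟨hx, h⟩)) _ _ fun A a₀ a₁ => ?_
    have hA : A ≤ W₀ ⊓ W₁ := le_inf (a₀.trans inf_le_right) (a₁.trans inf_le_right)
    have hm := congrArg (res M hA) h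
    rw [res_res, res_smul, res_res] at hm
    rw [res_smul, res_smul, ← F₀.coef_res, ← F₁.coef_res, res_res, res_res, res_res, res_res, hm,
      smul_smul, transition, ← F₀.coef_res, res_res, ← smul_eq_mul,
      ← (F₀.coef A _).map_smul, F₁.coef_smul]
  choose t ht₀ ht₁ using key
  have ext {U : Opens X} {a b : sec M U}
      (h₀ : res M (inf_le_left : U ⊓ W₀ ≤ U) a = res M inf_le_left b)
      (h₁ : res M (inf_le_left : U ⊓ W₁ ≤ U) a = res M inf_le_left b) : a = b :=
    sec_ext₂ M (inf_le_left : U ⊓ W₀ ≤ U) (inf_le_left : U ⊓ W₁ ≤ U)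
      (fun x hx => (hW x).imp (fun h => ⟨hx, h⟩) (fun h => ⟨hx, h⟩)) h₀ h₁
  let φ : L ⟶ M := mkHom (fun U =>
    { toFun := t U
      map_add' a b := ext (by rw [map_add, ht₀, ht₀, ht₀, map_add, map_add, add_smul])
        (by rw [map_add, ht₁, ht₁, ht₁, map_add, map_add, add_smul])
      map_smul' r a := ext
        (by rw [RingHom.id_apply, res_smul, ht₀, ht₀, res_smul, map_smul, smul_assoc])
        (by rw [RingHom.id_apply, res_smul, ht₁, ht₁, res_smul, map_smul, smul_assoc]) })
    (fun U V hVU s => ext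
      (by
        change res M _ (t V _) = res M _ (res M _ (t U s))
        have := congrArg (res M (inf_le_inf_right W₀ hVU)) (ht₀ U s)
        rw [res_res, res_smul, ← F₀.coef_res, res_res, res_res] at this
        rw [ht₀, res_res, res_res, this])
      (by
        change res M _ (t V _) = res M _ (res M _ (t U s))
        have := congrArg (res M (inf_le_inf_right W₁ hVU)) (ht₁ U s)
        rw [res_res, res_smul, ← F₁.coef_res, res_res, res_res] at this
        rw [ht₁, res_res, res_res, this]))
  refine ⟨φ, ?_, ?_⟩
  · have := congrArg (res M (le_inf le_rfl le_rfl : W₀ ≤ W₀ ⊓ W₀)) (ht₀ W₀ F₀.gen)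
    rw [res_res, res_self, F₀.coef_gen, one_smul, res_res, res_self] at this
    exact this
  · have := congrArg (res M (le_inf le_rfl le_rfl : W₁ ≤ W₁ ⊓ W₁)) (ht₁ W₁ F₁.gen)
    rw [res_res, res_self, F₁.coef_gen, one_smul, res_res, res_self] at this
    exact this

theorem exists_closed_cover [CompactSpace X] [T2Space X] (hW : ∀ x, x ∈ W₀ ∨ x ∈ W₁) :
    ∃ K₀ K₁ : Set X, IsClosed K₀ ∧ IsClosed K₁ ∧ K₀ ⊆ W₀ ∧ K₁ ⊆ W₁ ∧ ∀ x, x ∈ K₀ ∨ x ∈ K₁ := by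
  obtain ⟨A₀, A₁, hA₀, hA₁, h₀, h₁, hd⟩ := normal_separation
    (s := (W₀ : Set X)ᶜ) (t := (W₁ : Set X)ᶜ) W₀.isOpen.isClosed_compl W₁.isOpen.isClosed_compl
    (Set.disjoint_left.2 fun x hx hx' => (hW x).elim hx hx')
  refine ⟨A₀ᶜ, A₁ᶜ, hA₀.isClosed_compl, hA₁.isClosed_compl, compl_subset_comm.1 h₀,
    compl_subset_comm.1 h₁, fun x => ?_⟩
  by_contra! h
  simp only [mem_compl_iff, not_not] at h
  exact Set.disjoint_left.1 hd h.1 h.2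

/-- Morphisms from an invertible sheaf lift along an epimorphism with soft kernel. -/
theorem IsSoft.exists_hom_lift [CompactSpace X] [T2Space X] (F₀ : Frame L W₀) (F₁ : Frame L W₁)
    (hW : ∀ x, x ∈ W₀ ∨ x ∈ W₁)
    {S : ShortComplex (SheafOfModules.{0} R)} (hS : S.ShortExact) (h : IsSoft S.X₁)
    (φ : L ⟶ S.X₃) : ∃ ψ : L ⟶ S.X₂, ψ ≫ S.g = φ := by
  obtain ⟨K₀, K₁, hK₀, hK₁, hKW₀, hKW₁, hK⟩ := exists_closed_cover hW
  obtain ⟨V₀, hV₀, t₀, hKV₀, e₀⟩ := h.closedLift hS W₀ (app φ W₀ F₀.gen) K₀ hK₀ hKW₀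
  obtain ⟨V₁, hV₁, t₁, hKV₁, e₁⟩ := h.closedLift hS W₁ (app φ W₁ F₁.gen) K₁ hK₁ hKW₁
  let c := ringRes R (inf_le_inf hV₀ hV₁) (transition F₀ F₁)
  have hφ := congrArg (res S.X₃ (inf_le_inf hV₀ hV₁)) (app_gen_eq F₀ F₁ φ)
  rw [res_smul, res_res, res_res] at hφ
  obtain ⟨s, hs⟩ := exists_of_app_eq_zero hS (U := V₀ ⊓ V₁)
    (res S.X₂ inf_le_right t₁ - c • res S.X₂ inf_le_left t₀) (by
      rw [map_sub, map_smul, app_res, app_res, e₀, e₁, res_res, res_res, hφ, sub_self])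
  obtain ⟨r, W, hW', hKW, hr⟩ := h _ s (K₀ ∩ K₁) (hK₀.inter hK₁)
    (fun x hx => ⟨hKV₀ hx.1, hKV₁ hx.2⟩)
  obtain ⟨V₀', hV₀', V₁', hV₁', hK₀', hK₁', hle⟩ := exists_shrinking hK₀ hK₁ hKV₀ hKV₁ hKW
  have hV' : ∀ x, x ∈ V₀' ∨ x ∈ V₁' := fun x => (hK x).imp (fun h => hK₀' h) (fun h => hK₁' h)
  let G₀ := F₀.restrict (hV₀'.trans hV₀)
  let G₁ := F₁.restrict (hV₁'.trans hV₁)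
  have hc : transition G₀ G₁ = ringRes R (inf_le_inf hV₀' hV₁') c := by
    change F₀.coef _ _ (res L _ (res L _ F₁.gen)) = _
    rw [ringRes_ringRes, transition, ← F₀.coef_res, res_res, res_res]
  obtain ⟨ψ, hψ₀, hψ₁⟩ := exists_hom_of_frames G₀ G₁ hV' (res S.X₂ hV₀' t₀)
    (res S.X₂ hV₁' t₁ - app S.f _ (res S.X₁ le_top r)) (by
      have h1 := congrArg (res S.X₂ (inf_le_inf hV₀' hV₁')) hs
      have h2 := congrArg (res S.X₁ hle) hr
      rw [res_res, res_res] at h2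
      rw [← app_res, map_sub, res_smul, res_res, res_res] at h1
      rw [map_sub, ← app_res, res_res, res_res, res_res, h2, h1, hc, sub_sub_cancel])
  refine ⟨ψ, hom_ext_frames G₀ G₁ hV' ?_ ?_⟩
  · rw [app_comp, hψ₀, app_res, e₀, res_res]
    exact (app_res φ _ _).symm
  · rw [app_comp, hψ₁, map_sub, app_app_eq_zero, sub_zero, app_res, e₁, res_res]
    exact (app_res φ _ _).symm

/-- Vanishing of the first cohomology for an invertible sheaf of non-negative degree: if the
transition function `c₁` and its inverse `c₀` are regular on the respective open sets, then
compatible pairs of sections lift along an epimorphism whose target has only sections which are,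
near closed sets, images of global sections. -/
theorem exists_pair_lift [CompactSpace X] [T2Space X] {E B : SheafOfModules.{0} R} (p : E ⟶ B)
    (hp : ∀ (U : Opens X) (b : sec B U) (K : Set X), IsClosed K → K ⊆ U →
      ∃ (e : sec E ⊤) (V : Opens X) (hV : V ≤ U), K ⊆ V ∧
        res B le_top (app p ⊤ e) = res B hV b)
    {A₀ A₁ : Opens X} (hA : ∀ x, x ∈ A₀ ∨ x ∈ A₁) (c₀ : R.obj.obj (op A₀))
    (c₁ : R.obj.obj (op A₁))
    (hc : ringRes R (inf_le_left : A₀ ⊓ A₁ ≤ A₀) c₀ * ringRes R inf_le_right c₁ = 1)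
    (hc' : ringRes R (inf_le_right : A₀ ⊓ A₁ ≤ A₁) c₁ * ringRes R inf_le_left c₀ = 1)
    (b₀ : sec B A₀) (b₁ : sec B A₁)
    (hb : res B inf_le_right b₁ =
      ringRes R (inf_le_right : A₀ ⊓ A₁ ≤ A₁) c₁ • res B inf_le_left b₀) :
    ∃ (e₀ : sec E A₀) (e₁ : sec E A₁), app p A₀ e₀ = b₀ ∧ app p A₁ e₁ = b₁ ∧
      res E inf_le_right e₁ =
        ringRes R (inf_le_right : A₀ ⊓ A₁ ≤ A₁) c₁ • res E inf_le_left e₀ := by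
  obtain ⟨K₀, K₁, hK₀, hK₁, hKA₀, hKA₁, hK⟩ := exists_closed_cover hA
  obtain ⟨g, V, hV, hKV, hg⟩ := hp A₁ b₁ K₁ hK₁ hKA₁
  have hcA {A : Opens X} (h : A ≤ A₀ ⊓ A₁) :
      ringRes R (h.trans inf_le_left) c₀ * ringRes R (h.trans inf_le_right) c₁ = 1 := by
    rw [← ringRes_ringRes inf_le_left h, ← ringRes_ringRes inf_le_right h, ← map_mul, hc, map_one]
  have hcA' {A : Opens X} (h : A ≤ A₀ ⊓ A₁) :
      ringRes R (h.trans inf_le_right) c₁ * ringRes R (h.trans inf_le_left) c₀ = 1 := by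
    rw [← ringRes_ringRes inf_le_left h, ← ringRes_ringRes inf_le_right h, ← map_mul, hc', map_one]
  have hbA {A : Opens X} (h : A ≤ A₀ ⊓ A₁) : res B (h.trans inf_le_right) b₁ =
      ringRes R (h.trans inf_le_right) c₁ • res B (h.trans inf_le_left) b₀ := by
    have := congrArg (res B h) hb
    rwa [res_smul, res_res, res_res, ringRes_ringRes] at this
  -- `c₀ g` represents `b₀` near `K₁`, so that the difference extends by zero to a global section
  obtain ⟨d, hd, hd'⟩ := exists_glue₂ B (U₁ := A₀) (U₂ := V) le_top le_top
    (fun x _ => (hK x).imp (fun h => hKA₀ h) (fun h => hKV h))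
    (b₀ - c₀ • res B le_top (app p ⊤ g)) 0 (fun A h₁ h₂ => by
      have h : A ≤ A₀ ⊓ A₁ := le_inf h₁ (h₂.trans hV)
      have hg' := congrArg (res B h₂) hg
      rw [res_res, res_res] at hg'
      rw [map_sub, res_smul, res_res, hg', hbA h, smul_smul, hcA h, one_smul, sub_self, map_zero])
  obtain ⟨e, V', hVt, hV', he⟩ := hp ⊤ d univ isClosed_univ (fun _ _ => trivial)
  have hV'' : V' = ⊤ := top_le_iff.1 fun x _ => hV' trivial
  subst hV''
  rw [res_self, res_self] at he
  refine ⟨res E le_top e + c₀ • res E le_top g, res E le_top g + c₁ • res E le_top e, ?_, ?_, ?_⟩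
  · rw [map_add, map_smul, app_res, app_res, he, hd, sub_add_cancel]
  · refine sec_ext₂ B hV (inf_le_right : A₀ ⊓ A₁ ≤ A₁) (fun x hx => ?_) ?_ ?_
    · exact (hK x).elim (fun h => Or.inr ⟨hKA₀ h, hx⟩) (fun h => Or.inl (hKV h))
    · rw [map_add, map_smul, app_res, app_res, he, map_add, res_smul, res_res, res_res, hg, hd',
        smul_zero, add_zero]
    · have hd2 := congrArg (res B (inf_le_left : A₀ ⊓ A₁ ≤ A₀)) hd
      rw [res_res, map_sub, res_smul, res_res] at hd2
      rw [map_add, map_smul, app_res, app_res, he, map_add, res_smul, res_res, res_res, hd2, hb,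
        smul_sub, smul_smul, hc', one_smul, add_sub_cancel]
  · rw [map_add, map_add, res_smul, res_smul, res_res, res_res, res_res, res_res, smul_add,
      smul_smul, hc', one_smul, add_comm]

end SheafOfModules

/-! ### The Cauchy transform -/

section Cauchy

open MeasureTheory Complex

/-- The Wirtinger derivative `∂φ/∂z̄`. -/
noncomputable def dbar (φ : ℂ → ℂ) (z : ℂ) : ℂ := (fderiv ℝ φ z 1 + I * fderiv ℝ φ z I) / 2

theorem dbar_mul {φ ψ : ℂ → ℂ} {z : ℂ} (hφ : DifferentiableAt ℝ φ z)
    (hψ : DifferentiableAt ℝ ψ z) : dbar (φ * ψ) z = φ z * dbar ψ z + ψ z * dbar φ z := by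
  simp only [dbar, fderiv_mul hφ hψ, add_apply, smul_apply,
    smul_eq_mul]
  ring

theorem dbar_eq_zero {u : ℂ → ℂ} {z : ℂ} (hu : DifferentiableAt ℂ u z) : dbar u z = 0 := by
  have h : fderiv ℝ u z I = I * fderiv ℝ u z 1 := by
    rw [hu.fderiv_restrictScalars ℝ]
    simp only [ContinuousLinearMap.coe_restrictScalars']
    rw [fderiv_eq_smul_deriv, fderiv_eq_smul_deriv, one_smul, smul_eq_mul]
  rw [dbar, h, ← mul_assoc, I_mul_I]
  ring

theorem dbar_comp_const_sub {φ : ℂ → ℂ} (hφ : Differentiable ℝ φ) (z t : ℂ) :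
    dbar (fun s => φ (z - s)) t = -dbar φ (z - t) := by
  have h := ((hφ (z - t)).hasFDerivAt.comp t ((hasFDerivAt_id t).const_sub z)).fderiv
  simp only [Function.comp_def] at h
  simp only [dbar, h, ContinuousLinearMap.comp_neg, ContinuousLinearMap.comp_id, neg_apply]
  ring

theorem continuous_dbar {φ : ℂ → ℂ} (hφ : ContDiff ℝ 1 φ) : Continuous (dbar φ) := by
  have := hφ.continuous_fderiv one_ne_zero
  unfold dbar
  fun_prop

theorem tsupport_dbar_subset (φ : ℂ → ℂ) : tsupport (dbar φ) ⊆ tsupport φ := by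
  refine (closure_mono fun z hz => ?_).trans (tsupport_fderiv_subset ℝ (f := φ))
  contrapose! hz
  rw [Function.mem_support, not_not] at hz
  simp [dbar, hz]

/-- The Cauchy–Pompeiu formula at the centre. In polar coordinates the integrand is the sum of a
radial derivative, which integrates to the value at `0`, and of an angular derivative, which
integrates to zero. -/
theorem integral_inv_mul_dbar {φ : ℂ → ℂ} (hφ : ContDiff ℝ 1 φ) (hc : HasCompactSupport φ) :
    ∫ t, t⁻¹ * dbar φ t = -(Real.pi * φ 0) := by
  have hd : ∀ z, HasFDerivAt φ (fderiv ℝ φ z) z := fun z =>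
    (hφ.differentiable one_ne_zero z).hasFDerivAt
  have hcont := hφ.continuous_fderiv one_ne_zero
  obtain ⟨R, hR⟩ := hc.isCompact.isBounded.subset_ball (0 : ℂ)
  have hzero (z : ℂ) (hz : R ≤ ‖z‖) : fderiv ℝ φ z = 0 := by
    by_contra h
    exact absurd (mem_ball_zero_iff.1 (hR (tsupport_fderiv_subset ℝ (subset_tsupport _ h))))
      (not_lt.2 hz)
  let e : ℝ → ℂ := fun θ => exp (θ * I)
  have he : Continuous e := by fun_prop
  let A : ℝ × ℝ → ℂ := fun p => fderiv ℝ φ (p.1 * e p.2) (e p.2)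
  let B : ℝ × ℝ → ℂ := fun p => fderiv ℝ φ (p.1 * e p.2) (I * e p.2)
  have hA : Continuous A := by
    refine Continuous.clm_apply (hcont.comp ?_) ?_ <;> fun_prop
  have hB : Continuous B := by
    refine Continuous.clm_apply (hcont.comp ?_) ?_ <;> fun_prop
  have hne (θ : ℝ) : ‖e θ‖ = 1 := norm_exp_ofReal_mul_I θ
  have hint (G : ℝ × ℝ → ℂ) (hG : Continuous G)
      (hG0 : ∀ p : ℝ × ℝ, fderiv ℝ φ (p.1 * e p.2) = 0 → G p = 0) :
      IntegrableOn G (Ioi (0 : ℝ) ×ˢ Ioo (-Real.pi) Real.pi) := by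
    have h1 : IntegrableOn G (Icc (0 : ℝ) R ×ˢ Icc (-Real.pi) Real.pi) :=
      hG.continuousOn.integrableOn_compact (isCompact_Icc.prod isCompact_Icc)
    refine h1.of_forall_sdiff_eq_zero (measurableSet_Ioi.prod measurableSet_Ioo) fun p hp => ?_
    refine hG0 p (hzero _ ?_)
    have hp0 : 0 < p.1 := hp.1.1
    rw [norm_mul, hne, mul_one, norm_real, Real.norm_of_nonneg hp0.le]
    by_contra! hlt
    exact hp.2 ⟨⟨hp0.le, hlt.le⟩, Ioo_subset_Icc_self hp.1.2⟩
  have hIA := hint A hA fun p h => by simp [A, h]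
  have hIB := hint B hB fun p h => by simp [B, h]
  have key : ∫ t, t⁻¹ * dbar φ t =
      ∫ p in Ioi (0 : ℝ) ×ˢ Ioo (-Real.pi) Real.pi, (1 / 2 : ℂ) * (A p + I * B p) := by
    rw [← Complex.integral_comp_polarCoord_symm, polarCoord_target]
    refine setIntegral_congr_fun (measurableSet_Ioi.prod measurableSet_Ioo) fun p hp => ?_
    have hp0 : (p.1 : ℂ) ≠ 0 := ofReal_ne_zero.2 (ne_of_gt hp.1)
    have hs : Complex.polarCoord.symm p = p.1 * e p.2 := by
      rw [Complex.polarCoord_symm_apply]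
      simp only [e, exp_mul_I]
      push_cast
      ring
    have hee : e p.2 = (Real.cos p.2 : ℂ) + (Real.sin p.2 : ℂ) * I := by
      simp only [e, exp_mul_I]; push_cast; ring
    have hnz : e p.2 ≠ 0 := exp_ne_zero _
    simp only [A, B, hs, dbar, real_smul]
    set L := fderiv ℝ φ (p.1 * e p.2)
    have h1 : L (e p.2) = Real.cos p.2 * L 1 + Real.sin p.2 * L I := by
      have : e p.2 = Real.cos p.2 • (1 : ℂ) + Real.sin p.2 • I := by
        rw [hee, real_smul, real_smul, mul_one]
      rw [this, map_add, map_smul, map_smul, real_smul, real_smul]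
    have h2 : L (I * e p.2) = -(Real.sin p.2 * L 1) + Real.cos p.2 * L I := by
      have : I * e p.2 = (-Real.sin p.2) • (1 : ℂ) + Real.cos p.2 • I := by
        rw [hee, real_smul, real_smul, mul_one, mul_add, mul_left_comm, I_mul_I]
        push_cast; ring
      rw [this, map_add, map_smul, map_smul, real_smul, real_smul]
      push_cast; ring
    have h3 : (e p.2)⁻¹ = Real.cos p.2 - Real.sin p.2 * I := by
      simp only [e]
      rw [← exp_neg, ← neg_mul, exp_mul_I, Complex.cos_neg, Complex.sin_neg]
      push_cast; ring
    rw [h1, h2, mul_inv, h3]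
    field_simp
    linear_combination (-(Real.sin p.2 * L I) : ℂ) * I_sq
  have eA : ∫ p in Ioi (0 : ℝ) ×ˢ Ioo (-Real.pi) Real.pi, A p = -(2 * Real.pi * φ 0) := by
    rw [Measure.volume_eq_prod, ← setIntegral_prod_swap, setIntegral_prod]
    · have : ∀ θ : ℝ, ∫ r in Ioi (0 : ℝ), A (Prod.swap (θ, r)) = -φ 0 := fun θ => by
        have hray : ∀ r : ℝ, HasDerivAt (fun r : ℝ => φ (r * e θ)) (A (r, θ)) r := fun r => by
          have h := (hd (r * e θ)).comp_hasDerivAt r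
            ((ofRealCLM.hasDerivAt (x := r)).mul_const (e θ))
          exact h.congr_deriv (by simp [A])
        have := integral_Ioi_of_hasDerivAt_of_tendsto' (a := 0) (f := fun r : ℝ => φ (r * e θ))
          (f' := fun r => A (r, θ)) (m := 0) (fun r _ => hray r) ?_ ?_
        · simpa using this
        · refine IntegrableOn.of_forall_sdiff_eq_zero (s := Icc 0 R)
            ((hA.comp (by fun_prop : Continuous fun r : ℝ => (r, θ))).continuousOn
              |>.integrableOn_compact isCompact_Icc) measurableSet_Ioi fun r hr => ?_
          have hr0 : 0 < r := hr.1
          have : fderiv ℝ φ (r * e θ) = 0 := hzero _ (by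
            rw [norm_mul, hne, mul_one, norm_real, Real.norm_of_nonneg hr0.le]
            by_contra! hlt
            exact hr.2 ⟨hr0.le, hlt.le⟩)
          simp [A, this]
        · refine tendsto_const_nhds.congr' ?_
          filter_upwards [eventually_ge_atTop (max R 0)] with r hr
          have hr0 : 0 ≤ r := (le_max_right _ _).trans hr
          by_contra h
          have := mem_ball_zero_iff.1 (hR (subset_tsupport _ (Ne.symm h)))
          rw [norm_mul, hne, mul_one, norm_real, Real.norm_of_nonneg hr0] at this
          exact absurd this (not_lt.2 ((le_max_left _ _).trans hr))
      simp_rw [this]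
      rw [setIntegral_const, Measure.real, Real.volume_Ioo, ENNReal.toReal_ofReal
        (by linarith [Real.pi_pos]), real_smul]
      push_cast; ring
    · exact hIA.swap
  have eB : ∫ p in Ioi (0 : ℝ) ×ˢ Ioo (-Real.pi) Real.pi, B p = 0 := by
    rw [Measure.volume_eq_prod, setIntegral_prod _ hIB]
    refine (setIntegral_congr_fun measurableSet_Ioi fun r hr => ?_).trans (integral_zero _ _)
    have hr0 : (r : ℂ) ≠ 0 := ofReal_ne_zero.2 (ne_of_gt hr)
    have hcirc : ∀ θ : ℝ, HasDerivAt (fun θ : ℝ => (r : ℂ)⁻¹ * φ (r * e θ)) (B (r, θ)) θ :=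
      fun θ => by
        have h1 : HasDerivAt e (e θ * I) θ := by
          have := ((ofRealCLM.hasDerivAt (x := θ)).mul_const I).cexp
          simpa [e] using this
        have h := ((hd (r * e θ)).comp_hasDerivAt θ (h1.const_mul (r : ℂ))).const_mul (r : ℂ)⁻¹
        refine h.congr_deriv ?_
        have : (r : ℂ) * (e θ * I) = r • (I * e θ) := by rw [real_smul, mul_comm (e θ)]
        rw [this, map_smul, real_smul, inv_mul_cancel_left₀ hr0]
    have := intervalIntegral.integral_eq_sub_of_hasDerivAt (a := -Real.pi) (b := Real.pi)
      (fun θ _ => hcirc θ)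
      ((hB.comp (by fun_prop : Continuous fun θ : ℝ => (r, θ))).intervalIntegrable _ _)
    change ∫ θ in Ioo (-Real.pi) Real.pi, B (r, θ) = 0
    rw [← integral_Ioc_eq_integral_Ioo, ← intervalIntegral.integral_of_le
      (by linarith [Real.pi_pos]), this]
    have h2 : e Real.pi = e (-Real.pi) := by
      simp [e, exp_pi_mul_I, exp_neg]
    rw [h2, sub_self]
  rw [key, integral_const_mul, integral_add hIA (hIB.const_mul I), integral_const_mul, eA, eB]
  ring

/-- The Cauchy transform of `g`, normalized so that it is a right inverse of `∂/∂z̄`. -/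
noncomputable def cauchyTransform (g : ℂ → ℂ) (z : ℂ) : ℂ :=
  (Real.pi : ℂ)⁻¹ * ∫ t, t⁻¹ * g (z - t)

theorem cauchyTransform_dbar {φ : ℂ → ℂ} (hφ : ContDiff ℝ 1 φ) (hc : HasCompactSupport φ) (z : ℂ) :
    cauchyTransform (dbar φ) z = φ z := by
  have h := integral_inv_mul_dbar (φ := fun t => φ (z - t)) (hφ.comp (by fun_prop))
    (hc.comp_homeomorph (Homeomorph.subLeft z))
  simp only [dbar_comp_const_sub (hφ.differentiable one_ne_zero), mul_neg, integral_neg,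
    sub_zero] at h
  rw [cauchyTransform, neg_inj.1 h, inv_mul_cancel_left₀ (ofReal_ne_zero.2 Real.pi_ne_zero)]

theorem locallyIntegrable_inv : LocallyIntegrable (fun t : ℂ => t⁻¹) :=
  locallyIntegrable_of_norm_le_rpow (C := 1) (α := 1) (by simp) (by simp)
    (Eventually.of_forall fun t => by rw [Real.rpow_neg_one, one_mul, norm_inv])
    (by fun_prop : Measurable fun t : ℂ => t⁻¹).aestronglyMeasurable

theorem cauchyTransform_eq (g : ℂ → ℂ) (z : ℂ) :
    cauchyTransform g z = (Real.pi : ℂ)⁻¹ * ∫ t, (z - t)⁻¹ * g t := by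
  rw [cauchyTransform, ← integral_sub_left_eq_self _ _ z]
  simp

section

variable {g : ℂ → ℂ} (hg : Continuous g) (hc : HasCompactSupport g)

include hg hc

theorem integrable_inv_mul (z : ℂ) : Integrable fun t => t⁻¹ * g (z - t) := by
  have h := hc.convolutionExists_right (ContinuousLinearMap.mul ℝ ℂ) locallyIntegrable_inv hg z
  exact h

theorem continuous_cauchyTransform : Continuous (cauchyTransform g) := by
  have h := hc.continuous_convolution_right (ContinuousLinearMap.mul ℝ ℂ) locallyIntegrable_inv hg
  exact continuous_const.mul h

/-- Off the support of `g` the integral can be differentiated under the integral sign. -/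
theorem analyticAt_cauchyTransform {z : ℂ} (hz : z ∉ tsupport g) :
    AnalyticAt ℂ (cauchyTransform g) z := by
  obtain ⟨δ, hδ, hball⟩ := Metric.isOpen_iff.1 (isClosed_tsupport g).isOpen_compl z hz
  have key : ∀ w ∈ Metric.ball z (δ / 2), DifferentiableAt ℂ (cauchyTransform g) w := by
    intro w hw
    have hdist (t : ℂ) (ht : g t ≠ 0) (y : ℂ) (hy : y ∈ Metric.ball z (δ / 2)) :
        δ / 2 ≤ ‖y - t‖ := by
      by_contra! h
      refine hball (a := t) ?_ (subset_tsupport _ ht)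
      rw [Metric.mem_ball] at hy ⊢
      have := dist_triangle t y z
      rw [dist_comm t y, dist_eq_norm y t] at this
      linarith
    have hmeas (y : ℂ) : AEStronglyMeasurable (fun t => (y - t)⁻¹ * g t) := by
      have : Measurable fun t : ℂ => (y - t)⁻¹ := by fun_prop
      exact (this.mul hg.measurable).aestronglyMeasurable
    have h := hasDerivAt_integral_of_dominated_loc_of_deriv_le (𝕜 := ℂ) (μ := volume)
      (F := fun y t => (y - t)⁻¹ * g t) (F' := fun y t => -((y - t) ^ 2)⁻¹ * g t) (x₀ := w)
      (bound := fun t => ((δ / 2) ^ 2)⁻¹ * ‖g t‖) (Metric.isOpen_ball.mem_nhds hw)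
      (Eventually.of_forall hmeas) ?_ ?_ ?_ ?_ ?_
    · have := h.2.differentiableAt.const_mul (Real.pi : ℂ)⁻¹
      refine this.congr_of_eventuallyEq (Eventually.of_forall fun y => ?_)
      exact cauchyTransform_eq g y
    · have := (integrable_inv_mul hg hc w).comp_sub_left w
      simpa using this
    · have : Measurable fun t : ℂ => -((w - t) ^ 2)⁻¹ := by fun_prop
      exact (this.mul hg.measurable).aestronglyMeasurable
    · refine Eventually.of_forall fun t y hy => ?_
      by_cases ht : g t = 0
      · simp [ht]
      · rw [norm_mul, norm_neg, norm_inv, norm_pow]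
        have := hdist t ht y hy
        gcongr
    · exact (hg.integrable_of_hasCompactSupport hc).norm.const_mul _
    · refine Eventually.of_forall fun t y hy => ?_
      by_cases ht : g t = 0
      · simp only [ht, mul_zero]
        exact hasDerivAt_const _ _
      · have hne : y - t ≠ 0 := by
          intro h0
          have := hdist t ht y hy
          rw [h0, norm_zero] at this
          linarith
        have := (((hasDerivAt_id y).sub_const t).inv hne).mul_const (g t)
        refine this.congr_deriv ?_
        simp [neg_div]
  exact DifferentiableOn.analyticAt (fun w hw => (key w hw).differentiableWithinAt)
    (Metric.ball_mem_nhds z (by positivity))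

theorem tendsto_cauchyTransform : Tendsto (cauchyTransform g) (cocompact ℂ) (𝓝 0) := by
  obtain ⟨R, hR⟩ := hc.isCompact.isBounded.subset_ball (0 : ℂ)
  have hgi : Integrable g := hg.integrable_of_hasCompactSupport hc
  have hlim : Tendsto (fun z : ℂ => Real.pi⁻¹ * ((‖z‖ - R)⁻¹ * ∫ t, ‖g t‖)) (cocompact ℂ)
      (𝓝 0) := by
    have h1 : Tendsto (fun z : ℂ => ‖z‖ - R) (cocompact ℂ) atTop :=
      tendsto_atTop_add_const_right _ (-R) (tendsto_norm_cocompact_atTop (E := ℂ))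
    have := ((tendsto_inv_atTop_zero.comp h1).mul_const (∫ t, ‖g t‖)).const_mul Real.pi⁻¹
    simpa using this
  refine squeeze_zero_norm' ?_ hlim
  filter_upwards [(tendsto_norm_cocompact_atTop (E := ℂ)).eventually_gt_atTop R] with z hz
  rw [cauchyTransform_eq, norm_mul, norm_inv, norm_real, Real.norm_of_nonneg Real.pi_pos.le]
  gcongr
  rw [← integral_const_mul]
  refine norm_integral_le_of_norm_le (hgi.norm.const_mul _) (Eventually.of_forall fun t => ?_)
  by_cases ht : g t = 0
  · simp [ht]
  · rw [norm_mul, norm_inv]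
    have h1 : ‖t‖ < R := mem_ball_zero_iff.1 (hR (subset_tsupport _ ht))
    have h2 := norm_sub_norm_le z t
    have : ‖z‖ - R ≤ ‖z - t‖ := by linarith
    have : 0 < ‖z‖ - R := by linarith
    gcongr

end

theorem cauchyTransform_add {g h : ℂ → ℂ} (hg : Continuous g) (hgc : HasCompactSupport g)
    (hh : Continuous h) (hhc : HasCompactSupport h) (z : ℂ) :
    cauchyTransform (g + h) z = cauchyTransform g z + cauchyTransform h z := by
  simp only [cauchyTransform, Pi.add_apply, mul_add]
  rw [integral_add (integrable_inv_mul hg hgc z) (integrable_inv_mul hh hhc z), mul_add]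

theorem ContinuousOn.continuous_mul_of_tsupport_subset {u h : ℂ → ℂ} {D : Set ℂ}
    (hu : ContinuousOn u D) (hD : IsOpen D) (hh : Continuous h) (hs : tsupport h ⊆ D) :
    Continuous (u * h) :=
  continuous_of_tsupport fun _ hz =>
    (hu.continuousAt (hD.mem_nhds (hs (tsupport_mul_subset_right hz)))).mul hh.continuousAt

/-- A continuous function `u` on a disc can be replaced by a continuous function `w` on the plane
which vanishes at infinity, differs from `u` by a holomorphic function on a smaller disc, and is
holomorphic off the disc and wherever `u` is: with a cutoff function `χ`, it is `χ u` minus the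
Cauchy transform of `u ∂χ/∂z̄`. -/
theorem exists_holomorphic_modification {a : ℂ} {r R : ℝ} (hr : 0 < r) (hrR : r < R) {u : ℂ → ℂ}
    (hu : ContinuousOn u (Metric.ball a R)) :
    ∃ w : ℂ → ℂ, Continuous w ∧ Tendsto w (cocompact ℂ) (𝓝 0) ∧
      (∃ ρ < R, ∀ z ∉ Metric.closedBall a ρ, AnalyticAt ℂ w z) ∧
      (∀ z ∈ Metric.closedBall a r, AnalyticAt ℂ (w - u) z) ∧
      ∀ z ∈ Metric.ball a R, AnalyticAt ℂ u z → AnalyticAt ℂ w z := by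
  let bump {c : ℂ} (b : ContDiffBump c) : ℂ → ℂ := fun z => b z
  have bump_cd {c : ℂ} (b : ContDiffBump c) : ContDiff ℝ 1 (bump b) :=
    ofRealCLM.contDiff.comp b.contDiff
  have bump_ts {c : ℂ} (b : ContDiffBump c) : tsupport (bump b) = Metric.closedBall c b.rOut := by
    rw [← b.tsupport_eq]
    exact congrArg closure (Set.ext fun z => not_congr ofReal_eq_zero)
  have bump_hc {c : ℂ} (b : ContDiffBump c) : HasCompactSupport (bump b) := by
    rw [HasCompactSupport, bump_ts]; exact isCompact_closedBall _ _
  -- the cutoff function `χ` is `1` near the small disc, with support in the large disc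
  let bχ : ContDiffBump a := ⟨(2 * r + R) / 3, (r + 2 * R) / 3, by linarith, by linarith⟩
  have hχ1 : ∀ z ∈ Metric.closedBall a ((2 * r + R) / 3), bump bχ z = 1 := fun z hz =>
    (congrArg ofReal (bχ.one_of_mem_closedBall hz)).trans ofReal_one
  have hχs : tsupport (bump bχ) = Metric.closedBall a ((r + 2 * R) / 3) := bump_ts bχ
  have hχsub : tsupport (bump bχ) ⊆ Metric.ball a R :=
    hχs.trans_subset (Metric.closedBall_subset_ball (by linarith))
  set χ := bump bχ
  have hχ : ContDiff ℝ 1 χ := bump_cd bχ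
  have hχc : HasCompactSupport χ := bump_hc bχ
  have hdχ := continuous_dbar hχ
  have hdχc : HasCompactSupport (dbar χ) :=
    hχc.mono' ((subset_tsupport _).trans (tsupport_dbar_subset χ))
  have hg : Continuous (u * dbar χ) := hu.continuous_mul_of_tsupport_subset Metric.isOpen_ball hdχ
    ((tsupport_dbar_subset χ).trans hχsub)
  have hgc : HasCompactSupport (u * dbar χ) := hdχc.mul_left
  have huχ : Continuous (u * χ) := hu.continuous_mul_of_tsupport_subset Metric.isOpen_ball
    hχ.continuous hχsub
  have huχc : HasCompactSupport (u * χ) := hχc.mul_left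
  refine ⟨u * χ - cauchyTransform (u * dbar χ), huχ.sub (continuous_cauchyTransform hg hgc), ?_,
    ⟨(r + 2 * R) / 3, by linarith, fun z hz => ?_⟩, fun z hz => ?_, fun z hz huz => ?_⟩
  · have h1 : Tendsto (u * χ) (cocompact ℂ) (𝓝 0) := by
      rw [hasCompactSupport_iff_eventuallyEq, coclosedCompact_eq_cocompact] at huχc
      exact huχc.tendsto
    have := h1.sub (tendsto_cauchyTransform hg hgc)
    rwa [sub_zero] at this
  · have hz' : z ∉ tsupport χ := hχs ▸ hz
    have h1 : z ∉ tsupport (u * χ) := fun h => hz' (tsupport_mul_subset_right h)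
    refine AnalyticAt.sub ?_ (analyticAt_cauchyTransform hg hgc fun h =>
      hz' (tsupport_dbar_subset χ (tsupport_mul_subset_right h)))
    exact analyticAt_const.congr (notMem_tsupport_iff_eventuallyEq.1 h1).symm
  · have hnear : ∀ᶠ y in 𝓝 z, χ y = 1 := by
      have : Metric.ball a ((2 * r + R) / 3) ∈ 𝓝 z := Metric.isOpen_ball.mem_nhds
        (Metric.closedBall_subset_ball (by linarith) hz)
      filter_upwards [this] with y hy
      exact hχ1 y (Metric.ball_subset_closedBall hy)
    have hd0 : ∀ᶠ y in 𝓝 z, dbar χ y = 0 := by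
      filter_upwards [hnear.eventually_nhds] with y hy
      have : χ =ᶠ[𝓝 y] fun _ => (1 : ℂ) := hy
      simp [dbar, this.fderiv_eq]
    have h1 : z ∉ tsupport (u * dbar χ) := by
      rw [notMem_tsupport_iff_eventuallyEq]
      filter_upwards [hd0] with y hy
      simp [hy]
    refine (analyticAt_cauchyTransform hg hgc h1).neg.congr ?_
    filter_upwards [hnear] with y hy
    simp [hy]
  · -- where `u` is holomorphic, a second cutoff function `ψ` splits off `∂(u ψ χ)/∂z̄`, whose
    -- Cauchy transform is `u ψ χ`, from `u ∂χ/∂z̄`; the remainder vanishes near `z`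
    obtain ⟨δ, hδ, hball⟩ := Metric.isOpen_iff.1
      ((isOpen_analyticAt ℂ u).inter (Metric.isOpen_ball (x := a) (ε := R))) z ⟨huz, hz⟩
    let bψ : ContDiffBump z := ⟨δ / 3, δ / 2, by linarith, by linarith⟩
    have hψ1 : ∀ᶠ y in 𝓝 z, bump bψ y = 1 := by
      filter_upwards [Metric.closedBall_mem_nhds z (by positivity : 0 < δ / 3)] with y hy
      exact (congrArg ofReal (bψ.one_of_mem_closedBall hy)).trans ofReal_one
    have hψsub : tsupport (bump bψ) ⊆ Metric.ball z δ :=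
      (bump_ts bψ).trans_subset (Metric.closedBall_subset_ball (half_lt_self hδ))
    have hψ : ContDiff ℝ 1 (bump bψ) := bump_cd bψ
    have hψc : HasCompactSupport (bump bψ) := bump_hc bψ
    set ψ := bump bψ
    have hdψc : HasCompactSupport (dbar ψ) :=
      hψc.mono' ((subset_tsupport _).trans (tsupport_dbar_subset ψ))
    have hudiff : ∀ y ∈ Metric.ball z δ, ContDiffAt ℝ 1 u y := fun y hy =>
      (hball hy).1.contDiffAt.restrict_scalars ℝ
    have hφ : ContDiff ℝ 1 (u * (ψ * χ)) := by
      rw [contDiff_iff_contDiffAt]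
      intro y
      by_cases hy : y ∈ Metric.ball z δ
      · exact (hudiff y hy).mul (hψ.mul hχ).contDiffAt
      · have h1 : y ∉ tsupport (u * (ψ * χ)) := fun h =>
          hy (hψsub (tsupport_mul_subset_left (tsupport_mul_subset_right h)))
        exact contDiffAt_const.congr_of_eventuallyEq (notMem_tsupport_iff_eventuallyEq.1 h1)
    have hφc : HasCompactSupport (u * (ψ * χ)) := (hχc.mul_left).mul_left
    have hdφ : ∀ y, dbar (u * (ψ * χ)) y = u y * (ψ y * dbar χ y) + u y * (χ y * dbar ψ y) := by
      intro y
      by_cases hy : y ∈ Metric.ball z δ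
      · rw [dbar_mul ((hudiff y hy).differentiableAt one_ne_zero)
          ((hψ.differentiable one_ne_zero y).mul (hχ.differentiable one_ne_zero y)),
          dbar_eq_zero (hball hy).1.differentiableAt,
          dbar_mul (hψ.differentiable one_ne_zero y) (hχ.differentiable one_ne_zero y)]
        ring
      · have h1 : y ∉ tsupport ψ := fun h => hy (hψsub h)
        have h2 : dbar ψ y = 0 := by
          by_contra h
          exact h1 (tsupport_dbar_subset ψ (subset_tsupport _ h))
        have h3 : dbar (u * (ψ * χ)) y = 0 := by
          by_contra h
          exact h1 (tsupport_mul_subset_left (tsupport_mul_subset_right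
            (tsupport_dbar_subset _ (subset_tsupport _ h))))
        rw [h2, h3, image_eq_zero_of_notMem_tsupport h1]
        ring
    let g₁ : ℂ → ℂ := u * ((1 - ψ) * dbar χ)
    let g₂ : ℂ → ℂ := u * (-χ * dbar ψ)
    have hg₁ : Continuous g₁ := hu.continuous_mul_of_tsupport_subset Metric.isOpen_ball
      ((continuous_const.sub hψ.continuous).mul hdχ)
      ((tsupport_mul_subset_right.trans (tsupport_dbar_subset χ)).trans hχsub)
    have hg₁c : HasCompactSupport g₁ := (hdχc.mul_left).mul_left
    have hg₂ : Continuous g₂ := hu.continuous_mul_of_tsupport_subset Metric.isOpen_ball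
      (hχ.continuous.neg.mul (continuous_dbar hψ))
      (((tsupport_mul_subset_right.trans (tsupport_dbar_subset ψ)).trans hψsub).trans
        fun y hy => (hball hy).2)
    have hg₂c : HasCompactSupport g₂ := (hdψc.mul_left).mul_left
    have hsum : u * dbar χ = g₁ + (dbar (u * (ψ * χ)) + g₂) := by
      funext y
      simp only [g₁, g₂, Pi.add_apply, hdφ, Pi.mul_apply, Pi.sub_apply, Pi.one_apply, Pi.neg_apply]
      ring
    have hdφc : HasCompactSupport (dbar (u * (ψ * χ))) :=
      hφc.mono' ((subset_tsupport _).trans (tsupport_dbar_subset _))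
    have hz₁ : z ∉ tsupport g₁ := by
      rw [notMem_tsupport_iff_eventuallyEq]
      filter_upwards [hψ1] with y hy
      simp [g₁, hy]
    have hz₂ : z ∉ tsupport g₂ := by
      rw [notMem_tsupport_iff_eventuallyEq]
      filter_upwards [hψ1.eventually_nhds] with y hy
      have : ψ =ᶠ[𝓝 y] fun _ => (1 : ℂ) := hy
      simp [g₂, dbar, this.fderiv_eq]
    refine ((analyticAt_cauchyTransform hg₁ hg₁c hz₁).add
      (analyticAt_cauchyTransform hg₂ hg₂c hz₂)).neg.congr ?_
    filter_upwards [hψ1] with y hy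
    simp only [Pi.neg_apply, Pi.add_apply, Pi.sub_apply]
    rw [hsum, cauchyTransform_add hg₁ hg₁c ((continuous_dbar hφ).add hg₂) (hdφc.add hg₂c),
      cauchyTransform_add (continuous_dbar hφ) hdφc hg₂ hg₂c, cauchyTransform_dbar hφ hφc]
    simp only [Pi.mul_apply, hy]
    ring

end Cauchy

/-! ### Holomorphic and continuous functions on a Riemann surface -/

namespace RiemannSurface

open SheafOfModules

variable {X : TopCat.{0}} [ChartedSpace ℂ X]

/-- `h` is holomorphic at `x`. -/
abbrev HolAt (h : X → ℂ) (x : X) : Prop := ContMDiffAt 𝓘(ℂ) 𝓘(ℂ) ∞ h x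

/-- The holomorphic functions on `U`. -/
abbrev holSec (U : Opens X) : Type := (holSheaf X).obj.obj (op U)

section val

variable {U : Opens X}

/-- The value of a holomorphic function at a point. -/
noncomputable def val (g : holSec U) (x : X) (hx : x ∈ U) : ℂ := holEval X g ⟨x, hx⟩

theorem hol_ext {g h : holSec U} (H : ∀ x hx, val g x hx = val h x hx) : g = h :=
  ContMDiffMap.ext (f := (g : C^∞⟮𝓘(ℂ), U; 𝓘(ℂ), ℂ⟯)) fun x => H x.1 x.2

theorem val_add (g h : holSec U) (x : X) (hx : x ∈ U) :
    val (g + h) x hx = val g x hx + val h x hx := rfl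

theorem val_mul (g h : holSec U) (x : X) (hx : x ∈ U) :
    val (g * h) x hx = val g x hx * val h x hx := rfl

theorem val_const (c : ℂ) (x : X) (hx : x ∈ U) : val (const (op U) c) x hx = c := rfl

open Classical in
/-- The extension by zero of a holomorphic function. -/
noncomputable def holExt (g : holSec U) (x : X) : ℂ := if hx : x ∈ U then val g x hx else 0

theorem holExt_of_mem (g : holSec U) {x : X} (hx : x ∈ U) : holExt g x = val g x hx := dif_pos hx

theorem holAt_holExt (g : holSec U) {x : X} (hx : x ∈ U) : HolAt (holExt g) x := by
  refine (contMDiffAt_subtype_iff (x := (⟨x, hx⟩ : U))).1 ?_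
  refine ((show C^∞⟮𝓘(ℂ), U; 𝓘(ℂ), ℂ⟯ from g).contMDiff ⟨x, hx⟩).congr_of_eventuallyEq ?_
  exact Eventually.of_forall fun y => holExt_of_mem g y.2

/-- A function which is holomorphic at each point of `U`, as a section of `𝒪`. -/
noncomputable def holMk (U : Opens X) (h : X → ℂ) (hh : ∀ x ∈ U, HolAt h x) : holSec U :=
  (⟨fun x : U => h x, fun x => contMDiffAt_subtype_iff.2 (hh x.1 x.2)⟩ : C^∞⟮𝓘(ℂ), U; 𝓘(ℂ), ℂ⟯)

theorem val_holMk (h : X → ℂ) (hh : ∀ x ∈ U, HolAt h x) (x : X) (hx : x ∈ U) :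
    val (holMk U h hh) x hx = h x := rfl

end val

theorem HolAt.congr {h k : X → ℂ} {x : X} (hh : HolAt h x) (e : k =ᶠ[𝓝 x] h) : HolAt k x :=
  ContMDiffAt.congr_of_eventuallyEq hh e

variable (X) in
/-- The continuous functions on `U`. -/
def contFns (U : (Opens X)ᵒᵖ) : AddSubgroup (∀ _ : (unop U : Opens X), ℂ) where
  carrier := {α | Continuous α}
  zero_mem' := continuous_const
  add_mem' := Continuous.add
  neg_mem' := Continuous.neg

noncomputable instance (U : (Opens X)ᵒᵖ) : Module ((holSheaf X).obj.obj U) (contFns X U) where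
  smul g α := ⟨fun x => holEval X g x * α.1 x,
    ((show C^∞⟮𝓘(ℂ), (unop U : Opens X); 𝓘(ℂ), ℂ⟯ from g).contMDiff.continuous).mul α.2⟩
  one_smul α := Subtype.ext <| funext fun x => one_mul (α.1 x)
  mul_smul g h α := Subtype.ext <| funext fun x => mul_assoc (holEval X g x) (holEval X h x) (α.1 x)
  smul_zero g := Subtype.ext <| funext fun x => mul_zero (holEval X g x)
  smul_add g α η := Subtype.ext <| funext fun x => mul_add (holEval X g x) (α.1 x) (η.1 x)
  add_smul g h α := Subtype.ext <| funext fun x => add_mul (holEval X g x) (holEval X h x) (α.1 x)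
  zero_smul α := Subtype.ext <| funext fun x => zero_mul (α.1 x)

variable (X) in
/-- The presheaf of continuous functions, as a presheaf of `𝒪`-modules. -/
noncomputable def contPresheaf : PresheafOfModules.{0} (holSheaf X).obj where
  obj U := ModuleCat.of _ (contFns X U)
  map {U V} i := ModuleCat.ofHom (R := (holSheaf X).obj.obj U)
    (Y := (ModuleCat.restrictScalars ((holSheaf X).obj.map i).hom).obj
      (ModuleCat.of _ (contFns X V)))
    { toFun α := ⟨fun x => α.1 ⟨x, i.unop.le x.2⟩,
        α.2.comp (continuous_inclusion i.unop.le)⟩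
      map_add' _ _ := rfl
      map_smul' _ _ := rfl }

variable (X) in
/-- The sheaf of continuous functions, as a sheaf of `𝒪`-modules. -/
noncomputable def contSheaf : SheafOfModules.{0} (holSheaf X) where
  val := contPresheaf X
  isSheaf := (Presheaf.isSheaf_iff_isSheaf_forget _ _ (CategoryTheory.forget AddCommGrpCat)).2
    (TopCat.subpresheafToTypes.isSheaf (TopCat.continuousLocal X ℂ))

section cval

variable {U : Opens X}

/-- The value of a continuous function at a point. -/
noncomputable def cval (e : sec (contSheaf X) U) (x : X) (hx : x ∈ U) : ℂ :=
  (show contFns X (op U) from e).1 ⟨x, hx⟩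

theorem cont_ext {g h : sec (contSheaf X) U} (H : ∀ x hx, cval g x hx = cval h x hx) : g = h :=
  Subtype.ext (a1 := (g : contFns X (op U))) <| funext fun x => H x.1 x.2

theorem cval_sub (g h : sec (contSheaf X) U) (x : X) (hx : x ∈ U) :
    cval (g - h) x hx = cval g x hx - cval h x hx := rfl

theorem cval_res {V : Opens X} (h : V ≤ U) (g : sec (contSheaf X) U) (x : X) (hx : x ∈ V) :
    cval (res _ h g) x hx = cval g x (h hx) := rfl

open Classical in
/-- The extension by zero of a continuous function. -/
noncomputable def contExt (g : sec (contSheaf X) U) (x : X) : ℂ :=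
  if hx : x ∈ U then cval g x hx else 0

theorem contExt_of_mem (g : sec (contSheaf X) U) {x : X} (hx : x ∈ U) :
    contExt g x = cval g x hx := dif_pos hx

theorem continuousOn_contExt (g : sec (contSheaf X) U) : ContinuousOn (contExt g) U := by
  rw [continuousOn_iff_continuous_domRestrict]
  refine ((show contFns X (op U) from g).2).congr fun x => ?_
  exact (contExt_of_mem g x.2).symm

/-- A function which is continuous on `U`, as a section of the sheaf of continuous functions. -/
noncomputable def contMk (U : Opens X) (h : X → ℂ) (hh : ContinuousOn h U) :
    sec (contSheaf X) U :=
  (⟨fun x : U => h x, continuousOn_iff_continuous_domRestrict.1 hh⟩ : contFns X (op U))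

theorem cval_contMk (h : X → ℂ) (hh : ContinuousOn h U) (x : X) (hx : x ∈ U) :
    cval (contMk U h hh) x hx = h x := rfl

end cval

variable (X) in
/-- The inclusion of the holomorphic functions into the continuous ones. -/
noncomputable def holToCont : SheafOfModules.unit (holSheaf X) ⟶ contSheaf X :=
  mkHom (fun U =>
    { toFun (g : holSec U) := contMk U (holExt g) fun _ hx =>
        (holAt_holExt g hx).continuousAt.continuousWithinAt
      map_add' g h := cont_ext fun x hx => by
        refine (holExt_of_mem (U := U) (g + h : holSec U) hx).trans ?_
        exact (congrArg₂ (· + ·) (holExt_of_mem (U := U) g hx) (holExt_of_mem (U := U) h hx)).symm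
      map_smul' r g := cont_ext fun x hx => by
        refine (holExt_of_mem (U := U) (r * (show holSec U from g)) hx).trans ?_
        exact (congrArg (val r x hx * ·) (holExt_of_mem (U := U) g hx)).symm })
    fun U V h g => cont_ext fun x hx =>
      (holExt_of_mem (U := V) (ringRes (holSheaf X) h g) hx).trans
        (holExt_of_mem (U := U) g (h hx)).symm

theorem cval_holToCont {U : Opens X} (g : holSec U) (x : X) (hx : x ∈ U) :
    cval (app (holToCont X) U g) x hx = val g x hx := holExt_of_mem g hx

instance : Mono (holToCont X) := mono_of_app_injective _ fun U g h H =>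
  hol_ext fun x hx => (cval_holToCont (U := U) g x hx).symm.trans
    ((congrArg (fun e => cval e x hx) H).trans (cval_holToCont (U := U) h x hx))

variable (X) in
/-- The sheaf of continuous functions modulo holomorphic functions. -/
noncomputable abbrev quotSheaf : SheafOfModules.{0} (holSheaf X) := cokernel (holToCont X)

variable (X) in
/-- The class of a continuous function modulo holomorphic functions. -/
noncomputable abbrev contToQuot : contSheaf X ⟶ quotSheaf X := cokernel.π (holToCont X)

variable (X) in
/-- The resolution of `𝒪` by continuous functions. -/
noncomputable abbrev contSeq : ShortComplex (SheafOfModules.{0} (holSheaf X)) :=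
  ShortComplex.mk (holToCont X) (contToQuot X) (cokernel.condition _)

theorem contSeq_shortExact : (contSeq X).ShortExact where
  exact := ShortComplex.exact_cokernel _
  mono_f := inferInstanceAs (Mono (holToCont X))
  epi_g := inferInstanceAs (Epi (contToQuot X))

theorem contToQuot_eq_zero_iff {U : Opens X} (e : sec (contSheaf X) U) :
    app (contToQuot X) U e = 0 ↔ ∀ x ∈ U, HolAt (contExt e) x := by
  constructor
  · intro h x hx
    obtain ⟨g, rfl⟩ := exists_of_app_eq_zero (contSeq_shortExact (X := X)) e h
    refine (holAt_holExt (U := U) g hx).congr ?_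
    filter_upwards [U.isOpen.mem_nhds hx] with y hy
    rw [contExt_of_mem _ hy]
    exact (cval_holToCont (U := U) g y hy).trans (holExt_of_mem (U := U) g hy).symm
  · intro h
    have : app (holToCont X) U (holMk U (contExt e) h) = e := cont_ext fun x hx => by
      rw [cval_holToCont, val_holMk, contExt_of_mem e hx]
    rw [← this]
    exact app_app_eq_zero (contSeq X) (holMk U (contExt e) h)

end RiemannSurface

/-! ### Holomorphic functions on the Riemann sphere -/

namespace RiemannSphere

open RiemannSurface SheafOfModules

instance : CompactSpace sphere := inferInstanceAs (CompactSpace (OnePoint ℂ))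

instance : T2Space sphere := inferInstanceAs (T2Space (OnePoint ℂ))

theorem _root_.analyticAt_iff_contDiffAt_infty {h : ℂ → ℂ} {z : ℂ} :
    AnalyticAt ℂ h z ↔ ContDiffAt ℂ ∞ h z := by
  refine ⟨fun H => H.contDiffAt, fun H => ?_⟩
  rw [Complex.analyticAt_iff_eventually_differentiableAt]
  have h1 : ContDiffAt ℂ 1 h z := H.of_le (by norm_cast)
  filter_upwards [h1.eventually (by simp)] with w hw
  exact hw.differentiableAt one_ne_zero

theorem holAt_symm_iff {e : OpenPartialHomeomorph sphere ℂ} (he : e ∈ atlas ℂ sphere) {z : ℂ}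
    (hz : z ∈ e.target) {h : sphere → ℂ} :
    HolAt h (e.symm z) ↔ AnalyticAt ℂ (fun w => h (e.symm w)) z := by
  have he' := IsManifold.subset_maximalAtlas (I := 𝓘(ℂ)) (n := ∞) he
  rw [analyticAt_iff_contDiffAt_infty, ← contMDiffAt_iff_contDiffAt]
  constructor
  · intro H
    exact ContMDiffAt.comp z H (contMDiffAt_symm_of_mem_maximalAtlas he' hz)
  · intro H
    have hs := e.map_target hz
    have h1 : ContMDiffAt 𝓘(ℂ) 𝓘(ℂ) ∞ ((fun w => h (e.symm w)) ∘ e) (e.symm z) := by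
      refine ContMDiffAt.comp _ ?_ (contMDiffAt_of_mem_maximalAtlas he' hs)
      rwa [e.right_inv hz]
    refine h1.congr_of_eventuallyEq ?_
    filter_upwards [e.open_source.mem_nhds hs] with y hy
    simp [e.left_inv hy]

/-- The two standard coordinates `z` and `1 / z` as self-homeomorphisms of the sphere. -/
def IsCoordinate (σ : RiemannSphere ≃ₜ RiemannSphere) : Prop :=
  σ = Homeomorph.refl _ ∨ σ = inversionHomeomorph

/-- The embedding of the plane which is inverse to a coordinate. -/
noncomputable def coordMap (σ : RiemannSphere ≃ₜ RiemannSphere) (z : ℂ) : sphere :=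
  σ.symm (z : OnePoint ℂ)

section coord

variable {σ : RiemannSphere ≃ₜ RiemannSphere}

theorem isOpenEmbedding_coordMap : Topology.IsOpenEmbedding (coordMap σ) :=
  σ.symm.isOpenEmbedding.comp OnePoint.isOpenEmbedding_coe

theorem holAt_coordMap_iff (hσ : IsCoordinate σ) {h : sphere → ℂ} {z : ℂ} :
    HolAt h (coordMap σ z) ↔ AnalyticAt ℂ (fun w => h (coordMap σ w)) z := by
  obtain rfl | rfl := hσ
  · exact holAt_symm_iff (e := chartZero) (Or.inl rfl) (by simp [chartZero])
  · exact holAt_symm_iff (e := chartInfty) (Or.inr rfl) (by simp [chartInfty, chartZero])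

theorem exists_coordMap_eq (x : sphere) : ∃ σ, IsCoordinate σ ∧ ∃ z, coordMap σ z = x := by
  induction x using OnePoint.rec with
  | infty => exact ⟨_, Or.inr rfl, 0, inversion_zero⟩
  | coe z => exact ⟨_, Or.inl rfl, z, rfl⟩

theorem _root_.RiemannSurface.HolAt.eventually {h : sphere → ℂ} {x : sphere} (H : HolAt h x) :
    ∀ᶠ y in 𝓝 x, HolAt h y := by
  obtain ⟨σ, hσ, z, rfl⟩ := exists_coordMap_eq x
  rw [← (isOpenEmbedding_coordMap (σ := σ)).map_nhds_eq z]
  refine ((holAt_coordMap_iff hσ).1 H).eventually_analyticAt.mono fun w hw => ?_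
  exact (holAt_coordMap_iff hσ).2 hw

/-- Removable singularities. -/
theorem holAt_of_punctured {h : sphere → ℂ} {p : sphere} (hc : ContinuousAt h p)
    (hd : ∀ᶠ y in 𝓝[≠] p, HolAt h y) : HolAt h p := by
  obtain ⟨σ, hσ, z, rfl⟩ := exists_coordMap_eq p
  rw [holAt_coordMap_iff hσ]
  have hj : Tendsto (coordMap σ) (𝓝[≠] z) (𝓝[≠] (coordMap σ z)) :=
    tendsto_nhdsWithin_of_tendsto_nhds_of_eventually_within _
      (isOpenEmbedding_coordMap.continuous.tendsto z |>.mono_left nhdsWithin_le_nhds)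
      (by filter_upwards [self_mem_nhdsWithin] with w hw using
        isOpenEmbedding_coordMap.injective.ne hw)
  refine Complex.analyticAt_of_differentiable_on_punctured_nhds_of_continuousAt ?_
    (ContinuousAt.comp hc isOpenEmbedding_coordMap.continuous.continuousAt)
  filter_upwards [hj.eventually hd] with w hw
  exact ((holAt_coordMap_iff hσ).1 hw).differentiableAt

/-- The modification of a continuous function by holomorphic functions, transported to the sphere by
a coordinate: as it vanishes at the remaining point, it is continuous there, and holomorphic by
removability of the singularity. -/
theorem exists_global_modification (hσ : IsCoordinate σ) {a : ℂ} {r R : ℝ} (hr : 0 < r)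
    (hrR : r < R) {h : sphere → ℂ} (hh : ContinuousOn h (coordMap σ '' Metric.ball a R)) :
    ∃ k : sphere → ℂ, Continuous k ∧
      (∀ x ∈ coordMap σ '' Metric.closedBall a r, HolAt (k - h) x) ∧
      ∀ x, (x ∈ coordMap σ '' Metric.ball a R → HolAt h x) → HolAt k x := by
  obtain ⟨w, hw, hw0, ⟨ρ, hρ, hwρ⟩, hwr, hwu⟩ := exists_holomorphic_modification hr hrR
    (u := fun z => h (coordMap σ z))
    (hh.comp isOpenEmbedding_coordMap.continuous.continuousOn fun z hz => mem_image_of_mem _ hz)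
  let k : sphere → ℂ := fun x => (σ x : OnePoint ℂ).elim 0 w
  have hkc : Continuous k := by
    have h0 : Continuous (fun x : OnePoint ℂ => x.elim 0 w) := by
      rw [OnePoint.continuous_iff]
      refine ⟨?_, hw⟩
      rw [coclosedCompact_eq_cocompact]
      exact hw0
    exact h0.comp σ.continuous
  have hkj (z : ℂ) : k (coordMap σ z) = w z := by
    simp only [k, coordMap]
    erw [σ.apply_symm_apply]
    rfl
  have hcoe (z : ℂ) (hz : z ∈ Metric.ball a R → HolAt h (coordMap σ z)) :
      HolAt k (coordMap σ z) := by
    rw [holAt_coordMap_iff hσ]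
    simp only [hkj]
    by_cases hzR : z ∈ Metric.ball a R
    · exact hwu z hzR ((holAt_coordMap_iff hσ).1 (hz hzR))
    · exact hwρ z fun h => hzR (Metric.closedBall_subset_ball hρ h)
  refine ⟨k, hkc, ?_, fun x hx => ?_⟩
  · rintro _ ⟨z, hz, rfl⟩
    rw [holAt_coordMap_iff hσ]
    refine (hwr z hz).congr (Eventually.of_forall fun y => ?_)
    simp [hkj]
  · obtain ⟨y, rfl⟩ := σ.symm.surjective x
    induction y using OnePoint.rec with
    | coe z => exact hcoe z fun hz => hx (mem_image_of_mem _ hz)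
    | infty =>
      refine holAt_of_punctured hkc.continuousAt ?_
      have hcl : IsClosed (coordMap σ '' Metric.closedBall a ρ) :=
        ((isCompact_closedBall a ρ).image isOpenEmbedding_coordMap.continuous).isClosed
      have hmem : (coordMap σ '' Metric.closedBall a ρ)ᶜ ∈ 𝓝 (σ.symm OnePoint.infty : sphere) := by
        refine hcl.isOpen_compl.mem_nhds ?_
        rintro ⟨z, -, hz⟩
        exact OnePoint.coe_ne_infty z (σ.symm.injective hz)
      filter_upwards [mem_nhdsWithin_of_mem_nhds hmem, self_mem_nhdsWithin] with y hy hy'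
      obtain ⟨y, rfl⟩ := σ.symm.surjective y
      induction y using OnePoint.rec with
      | infty => exact absurd rfl hy'
      | coe z =>
        have : AnalyticAt ℂ w z := hwρ z fun h => hy ⟨z, h, rfl⟩
        rw [← coordMap, holAt_coordMap_iff hσ]
        simpa only [hkj] using this

end coord

/-- Each section of the quotient of the continuous by the holomorphic functions is, near a closed
set, the class of a continuous function on the whole sphere. -/
theorem exists_global_representative (U : Opens sphere) (b : sec (quotSheaf sphere) U)
    (K : Set sphere) (hK : IsClosed K) (hKU : K ⊆ U) :
    ∃ (e : sec (contSheaf sphere) ⊤) (V : Opens sphere) (hV : V ≤ U), K ⊆ V ∧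
      res _ le_top (app (contToQuot sphere) ⊤ e) = res (quotSheaf sphere) hV b := by
  let q (e : sec (contSheaf sphere) ⊤) : sec (quotSheaf sphere) U :=
    res _ le_top (app (contToQuot sphere) ⊤ e)
  have hq (e e' : sec (contSheaf sphere) ⊤) : q (e + e') = q e + q e' := by simp only [q, map_add]
  -- the last clause, that a correction vanishes wherever the class does already, ensures that a
  -- correction near one closed set does not spoil what was achieved near another one
  have key := hK.isCompact.induction_on (p := fun A => ∀ e₀ : sec (contSheaf sphere) ⊤,
    ∃ (e : sec (contSheaf sphere) ⊤) (V : Opens sphere) (hV : V ≤ U), closure A ⊆ V ∧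
      res _ hV (q e) = res (quotSheaf sphere) hV (b - q e₀) ∧
      ∀ (W : Opens sphere) (hW : W ≤ U), res (quotSheaf sphere) hW (b - q e₀) = 0 →
        res _ hW (q e) = 0) ?_ ?_ ?_ ?_
  · obtain ⟨e, V, hV, hKV, he, -⟩ := key 0
    refine ⟨e, V, hV, subset_closure.trans hKV, ?_⟩
    simp only [q, map_zero, sub_zero, res_res] at he
    exact he
  · exact fun e₀ => ⟨0, ⊥, bot_le, by simp, sec_ext _ fun x hx => hx.elim,
      fun W hW _ => by simp only [q, map_zero]⟩
  · intro A B hAB hB e₀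
    obtain ⟨e, V, hV, hBV, h⟩ := hB e₀
    exact ⟨e, V, hV, (closure_mono hAB).trans hBV, h⟩
  · intro A B hA hB e₀
    obtain ⟨e, V, hV, hAV, h₁, h₂⟩ := hA e₀
    obtain ⟨e', V', hV', hBV, h₁', h₂'⟩ := hB (e₀ + e)
    have hsub : b - q (e₀ + e) = (b - q e₀) - q e := by rw [hq, sub_sub]
    refine ⟨e + e', V ⊔ V', sup_le hV hV', ?_, ?_, fun W hW hb => ?_⟩
    · rw [closure_union]
      exact union_subset (hAV.trans (show V ≤ V ⊔ V' from le_sup_left))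
        (hBV.trans (show V' ≤ V ⊔ V' from le_sup_right))
    · refine sec_ext₂ _ (le_sup_left : V ≤ V ⊔ V') le_sup_right le_rfl ?_ ?_
      · have := h₂' V hV (by rw [hsub, map_sub, h₁, sub_self])
        rw [res_res _ _ _ (q (e + e')), res_res _ _ _ (b - q e₀), hq, map_add, this, add_zero, h₁]
      · rw [res_res _ _ _ (q (e + e')), res_res _ _ _ (b - q e₀), hq, map_add, h₁', hsub,
          map_sub _ (b - q e₀), add_sub_cancel]
    · have h0 := h₂ W hW hb
      rw [hq, map_add, h0, h₂' W hW (by rw [hsub, map_sub, hb, h0, sub_self]), add_zero]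
  · intro x hx
    obtain ⟨V₀, hV₀, u₀, hxV₀, hu₀⟩ := locally_surjective_of_epi (contToQuot sphere) U b x (hKU hx)
    obtain ⟨σ, hσ, a, rfl⟩ := exists_coordMap_eq x
    have hj := isOpenEmbedding_coordMap (σ := σ)
    obtain ⟨R, hR, hball⟩ := Metric.isOpen_iff.1 (V₀.isOpen.preimage hj.continuous) a hxV₀
    refine ⟨coordMap σ '' Metric.closedBall a (R / 2), mem_nhdsWithin_of_mem_nhds
      (mem_of_superset (hj.isOpenMap.image_mem_nhds (Metric.ball_mem_nhds a (half_pos hR)))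
        (image_mono Metric.ball_subset_closedBall)), fun e₀ => ?_⟩
    have hclosed : IsClosed (coordMap σ '' Metric.closedBall a (R / 2)) :=
      ((isCompact_closedBall a _).image hj.continuous).isClosed
    let u : sec (contSheaf sphere) V₀ := u₀ - res _ le_top e₀
    have hu : app (contToQuot sphere) V₀ u = res (quotSheaf sphere) hV₀ (b - q e₀) := by
      rw [map_sub, hu₀, app_res, map_sub]
      simp only [q, res_res]
    have hballV : coordMap σ '' Metric.ball a R ⊆ V₀ := image_subset_iff.2 hball
    obtain ⟨k, hk, hkr, hku⟩ := exists_global_modification hσ (half_pos hR) (half_lt_self hR)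
      ((continuousOn_contExt u).mono hballV)
    let e := contMk ⊤ k hk.continuousOn
    -- the open set where `k - u` is holomorphic
    let N : Opens sphere := V₀ ⊓ ⟨interior {y | HolAt (k - contExt u) y}, isOpen_interior⟩
    have hN : N ≤ V₀ := inf_le_left
    refine ⟨e, N, hN.trans hV₀, ?_, ?_, fun W hW hb => ?_⟩
    · rw [hclosed.closure_eq]
      refine fun y hy =>
        ⟨hballV (image_mono (Metric.closedBall_subset_ball (half_lt_self hR)) hy), ?_⟩
      exact mem_interior_iff_mem_nhds.2 (hkr y hy).eventually
    · have h1 : app (contToQuot sphere) N (res _ le_top e - res _ hN u) = 0 := by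
        rw [contToQuot_eq_zero_iff]
        intro y hy
        refine HolAt.congr (h := k - contExt u) (interior_subset hy.2) ?_
        filter_upwards [N.isOpen.mem_nhds hy] with t ht
        rw [contExt_of_mem _ ht, cval_sub, cval_res, cval_res, Pi.sub_apply,
          contExt_of_mem u (hN ht)]
        rfl
      rw [map_sub, app_res, app_res, hu, sub_eq_zero, res_res] at h1
      rw [← h1]
      exact res_res _ _ _ _
    · have h1 : app (contToQuot sphere) W (res _ le_top e) = 0 := by
        rw [contToQuot_eq_zero_iff]
        intro y hy
        refine HolAt.congr (h := k) (hku y fun hyD => ?_) ?_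
        · have h2 : app (contToQuot sphere) (W ⊓ V₀) (res _ inf_le_right u) = 0 := by
            have := congrArg (res _ (inf_le_left : W ⊓ V₀ ≤ W)) hb
            rw [res_res, map_zero] at this
            rw [app_res, hu, res_res, this]
          have hyWV : y ∈ W ⊓ V₀ := ⟨hy, hballV hyD⟩
          refine ((contToQuot_eq_zero_iff _).1 h2 y hyWV).congr ?_
          filter_upwards [(W ⊓ V₀).isOpen.mem_nhds hyWV] with t ht
          rw [contExt_of_mem _ ht, contExt_of_mem _ ht.2, cval_res]
        · filter_upwards [W.isOpen.mem_nhds hy] with t ht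
          rw [contExt_of_mem _ ht, cval_res]
          rfl
      rw [app_res] at h1
      exact (res_res _ _ _ _).trans h1

end RiemannSphere

/-! ### The differential of a coordinate generates the sheaf of one-forms -/

namespace RiemannSurface

open SheafOfModules

variable {X : TopCat.{0}} [ChartedSpace ℂ X]

theorem cotangent_ext {x : X} {α η : Cotangent x} (h : α (1 : ℂ) = η (1 : ℂ)) : α = η :=
  ContinuousLinearMap.ext_ring (R₁ := ℂ) (M₁ := ℂ) h

/-- The derivative of a function with respect to the trivialization of the tangent space which is
part of the definition of a manifold. -/
noncomputable def dval (h : X → ℂ) (y : X) : ℂ := differential h y (1 : ℂ)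

section formVal

variable {U : Opens X}

/-- The coefficient of a one-form with respect to the trivialization of the tangent space which is
part of the definition of a manifold. -/
noncomputable def formVal (α : sec (cotangentSheaf X) U) (x : X) (hx : x ∈ U) : ℂ :=
  (show holForms X (op U) from α).1 ⟨x, hx⟩ (1 : ℂ)

theorem form_ext {α η : sec (cotangentSheaf X) U} (h : ∀ x hx, formVal α x hx = formVal η x hx) :
    α = η :=
  Subtype.ext (a1 := (α : holForms X (op U))) <| funext fun x => cotangent_ext (h x.1 x.2)

theorem formVal_smul (r : holSec U) (α : sec (cotangentSheaf X) U) (x : X) (hx : x ∈ U) :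
    formVal (r • α) x hx = val r x hx * formVal α x hx := rfl

theorem formVal_add (α η : sec (cotangentSheaf X) U) (x : X) (hx : x ∈ U) :
    formVal (α + η) x hx = formVal α x hx + formVal η x hx := rfl

theorem formVal_res {V : Opens X} (h : V ≤ U) (α : sec (cotangentSheaf X) U) (x : X) (hx : x ∈ V) :
    formVal (res _ h α) x hx = formVal α x (h hx) := rfl

end formVal

variable [IsManifold 𝓘(ℂ) ∞ X] {e : OpenPartialHomeomorph X ℂ}

theorem holAt_chart (he : e ∈ atlas ℂ X) {x : X} (hx : x ∈ e.source) : HolAt e x :=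
  contMDiffAt_of_mem_maximalAtlas (IsManifold.subset_maximalAtlas he) hx

theorem dval_chart_ne_zero (he : e ∈ atlas ℂ X) {x : X} (hx : x ∈ e.source) :
    dval e x ≠ 0 := by
  have : IsManifold 𝓘(ℂ) 1 X := IsManifold.of_le (n := ∞) (by norm_cast)
  intro h
  have := (mdifferentiable_of_mem_atlas (I := 𝓘(ℂ)) he).mfderiv_injective hx
    (a₁ := (1 : ℂ)) (a₂ := (0 : ℂ)) (h.trans (map_zero (differential (e : X → ℂ) x)).symm)
  exact one_ne_zero (α := ℂ) this

/-- The domain of a chart. -/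
def chartDomain (e : OpenPartialHomeomorph X ℂ) : Opens X := ⟨e.source, e.open_source⟩

/-- The differential of a chart. -/
noncomputable def chartForm (he : e ∈ atlas ℂ X) : sec (cotangentSheaf X) (chartDomain e) :=
  (⟨fun x => differential (e : X → ℂ) x, fun x => by
    obtain ⟨g, hg, h⟩ := exists_eq_smul_mfderiv_chart (holAt_chart he x.2)
    exact ⟨g, hg, h.mono fun y hy _ => hy⟩⟩ : holForms X (op (chartDomain e)))

theorem formVal_chartForm (he : e ∈ atlas ℂ X) (x : X) (hx : x ∈ chartDomain e) :
    formVal (chartForm he) x hx = dval e x := rfl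

open Classical in
/-- The quotient of a one-form by the differential of a chart. -/
noncomputable def chartCoef (he : e ∈ atlas ℂ X) {U : Opens X} (hU : U ≤ chartDomain e)
    (α : sec (cotangentSheaf X) U) : holSec U :=
  holMk U (fun x => if hx : x ∈ U then formVal α x hx / dval e x else 0)
    fun x hx => by
      obtain ⟨g, hg, h⟩ := (show holForms X (op U) from α).2 ⟨x, hx⟩
      obtain ⟨k, hk, h'⟩ := exists_eq_smul_mfderiv_chart (holAt_chart he (hU hx))
      have hval : ∀ᶠ y in 𝓝 x, dval e y =
          k y * dval (chartAt ℂ x) y :=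
        h'.mono fun y hy => congrArg (fun L : Cotangent y => L (1 : ℂ)) hy
      have hkx : k x ≠ 0 := fun h0 => dval_chart_ne_zero he (hU hx) (by
        rw [hval.self_of_nhds, h0, zero_mul])
      refine HolAt.congr (h := fun y => g y / k y) (ContMDiffAt.div₀ hg hk hkx) ?_
      filter_upwards [h, hval, U.isOpen.mem_nhds hx] with y hy hy' hyU
      have hyU : y ∈ U := hyU
      rw [dif_pos hyU]
      have hα : formVal α y hyU = g y * dval (chartAt ℂ x) y :=
        congrArg (fun L : Cotangent y => L (1 : ℂ)) (hy hyU)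
      have hne := dval_chart_ne_zero he (hU hyU)
      rw [hy'] at hne
      rw [hα, hy', mul_div_mul_right _ _ (right_ne_zero_of_mul hne)]

theorem val_chartCoef (he : e ∈ atlas ℂ X) {U : Opens X} (hU : U ≤ chartDomain e)
    (α : sec (cotangentSheaf X) U) (x : X) (hx : x ∈ U) :
    val (chartCoef he hU α) x hx = formVal α x hx / dval e x := by
  rw [chartCoef, val_holMk, dif_pos hx]

/-- The frame of the sheaf of one-forms given by the differential of a chart. -/
noncomputable def chartFrame (he : e ∈ atlas ℂ X) : Frame (cotangentSheaf X) (chartDomain e) where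
  gen := chartForm he
  coef U hU :=
    { toFun α := chartCoef he hU α
      map_add' α η := hol_ext fun x hx => by
        rw [val_chartCoef, formVal_add, add_div]
        exact congrArg₂ (· + ·) (val_chartCoef he hU α x hx).symm (val_chartCoef he hU η x hx).symm
      map_smul' r α := hol_ext fun x hx => by
        rw [val_chartCoef, formVal_smul, mul_div_assoc, ← val_chartCoef he hU]
        rfl }
  coef_smul U hU α := form_ext fun x hx => by
    have hne := dval_chart_ne_zero he (hU hx)
    refine (formVal_smul (chartCoef he hU α) _ x hx).trans ?_
    rw [val_chartCoef, formVal_res, formVal_chartForm, div_mul_cancel₀ _ hne]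
  coef_gen U hU := hol_ext fun x hx => by
    have hne := dval_chart_ne_zero he (hU hx)
    refine (val_chartCoef he hU _ x hx).trans ?_
    rw [formVal_res, formVal_chartForm, div_self hne]
    rfl

theorem val_transition (he : e ∈ atlas ℂ X) {e' : OpenPartialHomeomorph X ℂ}
    (he' : e' ∈ atlas ℂ X) (x : X) (hx : x ∈ chartDomain e ⊓ chartDomain e') :
    val (transition (chartFrame he) (chartFrame he')) x hx =
      dval e' x / dval e x :=
  val_chartCoef he inf_le_left _ x hx

omit [IsManifold 𝓘(ℂ) ∞ X] in
/-- The sheaf of continuous functions is soft, by Urysohn's lemma. -/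
theorem isSoft_contSheaf [CompactSpace X] [T2Space X] : IsSoft (contSheaf X) := by
  intro U s K hK hKU
  obtain ⟨V₂, hV₂, hKV₂, hcl₂⟩ := normal_exists_closure_subset hK U.isOpen hKU
  obtain ⟨V₁, hV₁, hKV₁, hcl₁⟩ := normal_exists_closure_subset hK hV₂ hKV₂
  obtain ⟨χ, hχ0, hχ1, -⟩ := exists_continuous_zero_one_of_isClosed (s := V₂ᶜ) (t := closure V₁)
    hV₂.isClosed_compl isClosed_closure (Set.disjoint_left.2 fun x hx hx' => hx (hcl₁ hx'))
  have hc : Continuous fun x => (χ x : ℂ) * contExt s x := by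
    rw [continuous_iff_continuousAt]
    intro x
    by_cases hx : x ∈ closure V₂
    · exact (Complex.continuous_ofReal.comp χ.continuous).continuousAt.mul
        ((continuousOn_contExt s).continuousAt (U.isOpen.mem_nhds (hcl₂ hx)))
    · refine (continuousAt_const (y := (0 : ℂ))).congr ?_
      filter_upwards [isClosed_closure.isOpen_compl.mem_nhds hx] with y hy
      rw [hχ0 (fun h => hy (subset_closure h))]
      simp
  have hVU : (⟨V₁, hV₁⟩ : Opens X) ≤ U := fun x hx =>
    hcl₂ (subset_closure (hcl₁ (subset_closure hx)))
  refine ⟨contMk ⊤ _ hc.continuousOn, ⟨V₁, hV₁⟩, hVU, hKV₁, cont_ext fun x hx => ?_⟩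
  rw [cval_res, cval_res, cval_contMk, hχ1 (subset_closure hx), contExt_of_mem s (hVU hx)]
  simp

end RiemannSurface

/-! ### Acyclicity of the structure sheaf of the Riemann sphere -/

namespace RiemannSphere

open RiemannSurface SheafOfModules CategoryTheory.Endofunctor.Coalgebra

/-- The chart `z`, on the object `sphere`. -/
noncomputable def chart₀ : OpenPartialHomeomorph sphere ℂ := chartZero

/-- The chart `1 / z`, on the object `sphere`. -/
noncomputable def chart₁ : OpenPartialHomeomorph sphere ℂ := chartInfty

theorem chart₀_mem : chart₀ ∈ atlas ℂ sphere := Or.inl rfl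

theorem chart₁_mem : chart₁ ∈ atlas ℂ sphere := Or.inr rfl

/-- The complement of `∞`. -/
noncomputable abbrev U₀ : Opens sphere := chartDomain chart₀

/-- The complement of `0`. -/
noncomputable abbrev U₁ : Opens sphere := chartDomain chart₁

/-- The point of the sphere with coordinate `z`. -/
noncomputable def pt (z : ℂ) : sphere := (z : OnePoint ℂ)

/-- The inversion, as a self-map of the object `sphere`. -/
noncomputable def sinv (x : sphere) : sphere := inversion x

theorem sinv_sinv (x : sphere) : sinv (sinv x) = x := inversion_inversion x

theorem sinv_pt {z : ℂ} (hz : z ≠ 0) : sinv (pt z) = pt z⁻¹ := inversion_coe hz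

theorem pt_ne_sinv_pt_zero (z : ℂ) : pt z ≠ sinv (pt 0) := fun h =>
  OnePoint.coe_ne_infty z (h.trans inversion_zero)

/-- Each point of the sphere is finite or the point at infinity. -/
theorem sphere_cases (x : sphere) : (∃ z, x = pt z) ∨ x = sinv (pt 0) := by
  induction x using OnePoint.rec with
  | infty => exact Or.inr inversion_zero.symm
  | coe z => exact Or.inl ⟨z, rfl⟩

theorem mem_U₀ {x : sphere} : x ∈ U₀ ↔ ∃ z : ℂ, pt z = x := by
  change x ∈ chartZero.source ↔ _
  rw [chartZero_source]; rfl

theorem mem_U₁ {x : sphere} : x ∈ U₁ ↔ ∃ z : ℂ, sinv (pt z) = x := by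
  change x ∈ chartInfty.source ↔ _
  rw [chartInfty_source]
  exact ⟨fun ⟨z, hz⟩ => ⟨z, (congrArg sinv hz).trans (sinv_sinv x)⟩,
    fun ⟨z, hz⟩ => ⟨z, (sinv_sinv (pt z)).symm.trans (congrArg sinv hz)⟩⟩

theorem U₀_or_U₁ (x : sphere) : x ∈ U₀ ∨ x ∈ U₁ := by
  obtain ⟨z, rfl⟩ | rfl := sphere_cases x
  · exact Or.inl (mem_U₀.2 ⟨z, rfl⟩)
  · exact Or.inr (mem_U₁.2 ⟨0, rfl⟩)

theorem pt_mem_U₀ (z : ℂ) : pt z ∈ U₀ := mem_U₀.2 ⟨z, rfl⟩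

theorem infty_notMem_U₀ : sinv (pt 0) ∉ U₀ := fun h => by
  obtain ⟨z, hz⟩ := mem_U₀.1 h
  exact pt_ne_sinv_pt_zero z hz

theorem sinv_mem_U₁ {x : sphere} : sinv x ∈ U₁ ↔ x ∈ U₀ := by
  rw [mem_U₀, mem_U₁]
  exact exists_congr fun z =>
    ⟨fun h => by rw [← sinv_sinv (pt z), h, sinv_sinv], fun h => by rw [h]⟩

theorem pt_mem_U₁ {z : ℂ} : pt z ∈ U₁ ↔ z ≠ 0 := by
  constructor
  · rintro h rfl
    rw [← sinv_sinv (pt 0), sinv_mem_U₁] at h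
    exact infty_notMem_U₀ h
  · intro hz
    rw [← inv_inv z, ← sinv_pt (inv_ne_zero hz), sinv_mem_U₁]
    exact pt_mem_U₀ _

/-- The coordinate function `z`, extended by `0` to `∞`. -/
noncomputable def zFun (x : sphere) : ℂ := OnePoint.elim (X := ℂ) x 0 id

/-- The coordinate function `1 / z`, extended by `0` to `0`. -/
noncomputable def wFun (x : sphere) : ℂ := zFun (sinv x)

theorem zFun_pt (z : ℂ) : zFun (pt z) = z := rfl

theorem zFun_infty : zFun (sinv (pt 0)) = 0 :=
  congrArg (fun x => OnePoint.elim (X := ℂ) x 0 id) inversion_zero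

theorem wFun_sinv_pt (z : ℂ) : wFun (sinv (pt z)) = z := by
  rw [wFun, sinv_sinv, zFun_pt]

theorem wFun_pt (z : ℂ) : wFun (pt z) = z⁻¹ := by
  by_cases hz : z = 0
  · rw [hz, wFun, zFun_infty, inv_zero]
  · rw [wFun, sinv_pt hz, zFun_pt]

theorem zFun_mul_wFun {x : sphere} (hx : x ∈ U₀ ⊓ U₁) : zFun x * wFun x = 1 := by
  obtain ⟨z, rfl⟩ := mem_U₀.1 hx.1
  rw [zFun_pt, wFun_pt, mul_inv_cancel₀ (pt_mem_U₁.1 hx.2)]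

theorem holAt_pt_iff {h : sphere → ℂ} {z : ℂ} :
    HolAt h (pt z) ↔ AnalyticAt ℂ (fun w => h (pt w)) z :=
  holAt_coordMap_iff (σ := Homeomorph.refl _) (Or.inl rfl)

theorem holAt_sinv_pt_iff {h : sphere → ℂ} {z : ℂ} :
    HolAt h (sinv (pt z)) ↔ AnalyticAt ℂ (fun w => h (sinv (pt w))) z :=
  holAt_coordMap_iff (σ := inversionHomeomorph) (Or.inr rfl)

theorem holAt_zFun {x : sphere} (hx : x ∈ U₀) : HolAt zFun x := by
  obtain ⟨z, rfl⟩ := mem_U₀.1 hx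
  exact holAt_pt_iff.2 analyticAt_id

theorem holAt_wFun {x : sphere} (hx : x ∈ U₁) : HolAt wFun x := by
  obtain ⟨z, rfl⟩ := mem_U₁.1 hx
  exact holAt_sinv_pt_iff.2
    (analyticAt_id.congr (Eventually.of_forall fun w => (wFun_sinv_pt w).symm))

/-- The frame `dz`. -/
noncomputable abbrev frame₀ : Frame (cotangentSheaf sphere) U₀ := chartFrame chart₀_mem

/-- The frame `d(1 / z)`. -/
noncomputable abbrev frame₁ : Frame (cotangentSheaf sphere) U₁ := chartFrame chart₁_mem

/-- The function `-z²`, the transition function from `d(1 / z)` to `dz`. -/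
noncomputable def trans₀ : holSec U₀ := holMk U₀ (fun x => -(zFun x * zFun x)) fun _ hx =>
  ((holAt_zFun hx).mul (holAt_zFun hx)).neg

/-- The function `-1 / z²`, the transition function from `dz` to `d(1 / z)`. -/
noncomputable def trans₁ : holSec U₁ := holMk U₁ (fun x => -(wFun x * wFun x)) fun _ hx =>
  ((holAt_wFun hx).mul (holAt_wFun hx)).neg

theorem trans₀_mul_trans₁ :
    ringRes (holSheaf sphere) (inf_le_left : U₀ ⊓ U₁ ≤ U₀) trans₀ *
      ringRes (holSheaf sphere) (inf_le_right : U₀ ⊓ U₁ ≤ U₁) trans₁ = 1 :=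
  hol_ext fun x hx => by
    have h := zFun_mul_wFun hx
    change -(zFun x * zFun x) * -(wFun x * wFun x) = 1
    linear_combination (zFun x * wFun x + 1) * h

theorem trans₁_mul_trans₀ :
    ringRes (holSheaf sphere) (inf_le_right : U₀ ⊓ U₁ ≤ U₁) trans₁ *
      ringRes (holSheaf sphere) (inf_le_left : U₀ ⊓ U₁ ≤ U₀) trans₀ = 1 :=
  hol_ext fun x hx => by
    have h := zFun_mul_wFun hx
    change -(wFun x * wFun x) * -(zFun x * zFun x) = 1
    linear_combination (zFun x * wFun x + 1) * h

theorem chart₀_eq {x : sphere} (hx : x ∈ U₀) : chart₀ x = zFun x := by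
  obtain ⟨z, rfl⟩ := mem_U₀.1 hx
  exact chartZero_coe z

theorem chart₁_eq {x : sphere} (hx : x ∈ U₁) : chart₁ x = wFun x :=
  (chart₀_eq (x := sinv x) (sinv_mem_U₁.1 (by rwa [sinv_sinv])) :)

theorem transition_eq : transition frame₀ frame₁ =
    ringRes (holSheaf sphere) (inf_le_right : U₀ ⊓ U₁ ≤ U₁) trans₁ :=
  hol_ext fun x hx => by
    have hne := dval_chart_ne_zero chart₀_mem hx.1
    have h1 := zFun_mul_wFun hx
    have hz : chart₀ x ≠ 0 := by
      rw [chart₀_eq hx.1]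
      exact left_ne_zero_of_mul_eq_one h1
    have hc : chart₁ =ᶠ[𝓝 x] (fun z => z⁻¹) ∘ chart₀ := by
      filter_upwards [(U₀ ⊓ U₁).isOpen.mem_nhds hx] with y hy
      rw [Function.comp_apply, chart₀_eq hy.1, chart₁_eq hy.2,
        eq_inv_of_mul_eq_one_right (zFun_mul_wFun hy)]
    have hd : differential chart₁ x =
        -(wFun x * wFun x) • differential chart₀ x := by
      rw [differential_congr hc, differential_comp_chart (differentiableAt_inv hz)
        ((holAt_chart chart₀_mem hx.1).mdifferentiableAt (by simp)), deriv_inv,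
        chart₀_eq hx.1, eq_inv_of_mul_eq_one_right h1, sq, mul_inv]
    refine (val_transition chart₀_mem chart₁_mem x hx).trans ?_
    rw [div_eq_iff hne]
    exact congrArg (fun L : Cotangent x => L (1 : ℂ)) hd

end RiemannSphere

namespace RiemannSphere

open RiemannSurface SheafOfModules CategoryTheory.Endofunctor.Coalgebra

theorem closedLift_contToQuot : ClosedLift (contToQuot sphere) := fun U b K hK hKU => by
  obtain ⟨e, V, hV, hKV, he⟩ := exists_global_representative U b K hK hKU
  exact ⟨V, hV, res _ le_top e, hKV, (app_res _ _ _).trans he⟩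

theorem isSoft_quotSheaf : IsSoft (quotSheaf sphere) := fun U b K hK hKU => by
  obtain ⟨e, V, hV, hKV, he⟩ := exists_global_representative U b K hK hKU
  exact ⟨app (contToQuot sphere) ⊤ e, V, hV, hKV, he⟩

/-- Vanishing of the first cohomology of the tangent sheaf, which has degree `2`. -/
theorem exists_lift_of_hom_quotSheaf (φ : cotangentSheaf sphere ⟶ quotSheaf sphere) :
    ∃ ψ : cotangentSheaf sphere ⟶ contSheaf sphere, ψ ≫ contToQuot sphere = φ := by
  have hb := app_gen_eq frame₀ frame₁ φ
  rw [transition_eq] at hb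
  obtain ⟨e₀, e₁, h₀, h₁, he⟩ := exists_pair_lift (contToQuot sphere) exists_global_representative
    U₀_or_U₁ trans₀ trans₁ trans₀_mul_trans₁ trans₁_mul_trans₀ _ _ hb
  obtain ⟨ψ, hψ₀, hψ₁⟩ := exists_hom_of_frames frame₀ frame₁ U₀_or_U₁ e₀ e₁
    (by rw [transition_eq]; exact he)
  exact ⟨ψ, hom_ext_frames frame₀ frame₁ U₀_or_U₁ (by rw [app_comp, hψ₀, h₀])
    (by rw [app_comp, hψ₁, h₁])⟩

variable (f : HolEnd sphere)

/-- The pullback of holomorphic functions. -/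
noncomputable def pullHol {U : Opens sphere} (g : holSec U) : holSec (preim f U) :=
  (comorphism f).hom.app (op U) g

theorem pullHol_trans₀_mul_trans₁ :
    ringRes (holSheaf sphere) (inf_le_left : preim f U₀ ⊓ preim f U₁ ≤ _) (pullHol f trans₀) *
      ringRes (holSheaf sphere) (inf_le_right : preim f U₀ ⊓ preim f U₁ ≤ _) (pullHol f trans₁) =
        1 :=
  hol_ext fun x hx => congrArg (fun r => RiemannSurface.val r (f x) hx) trans₀_mul_trans₁

theorem pullHol_trans₁_mul_trans₀ :
    ringRes (holSheaf sphere) (inf_le_right : preim f U₀ ⊓ preim f U₁ ≤ _) (pullHol f trans₁) *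
      ringRes (holSheaf sphere) (inf_le_left : preim f U₀ ⊓ preim f U₁ ≤ _) (pullHol f trans₀) =
        1 :=
  hol_ext fun x hx => congrArg (fun r => RiemannSurface.val r (f x) hx) trans₁_mul_trans₀

theorem pullHol_ringRes {U V : Opens sphere} (h : V ≤ U) (g : holSec U) :
    pullHol f (ringRes (holSheaf sphere) h g) =
      ringRes (holSheaf sphere) (preim_mono f h) (pullHol f g) :=
  hol_ext fun _ _ => rfl

theorem smul_direct (M : SheafOfModules.{0} (holSheaf sphere)) {U : Opens sphere} (r : holSec U)
    (m : sec M (preim f U)) :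
    (r • (show sec ((direct f).obj M) U from m)) = pullHol f r • m := rfl

/-- The images of the two frames under a morphism to `f_* M`, as sections of `M` on the preimages of
`U₀` and `U₁`, are related by the pullback of the transition function. -/
theorem res_app_gen {M : SheafOfModules.{0} (holSheaf sphere)}
    (φ : cotangentSheaf sphere ⟶ (direct f).obj M) :
    res M (inf_le_right : preim f U₀ ⊓ preim f U₁ ≤ _) (app φ U₁ frame₁.gen) =
      ringRes (holSheaf sphere) (inf_le_right : preim f U₀ ⊓ preim f U₁ ≤ _) (pullHol f trans₁) •
        res M (inf_le_left : preim f U₀ ⊓ preim f U₁ ≤ _) (app φ U₀ frame₀.gen) := by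
  have hb := app_gen_eq frame₀ frame₁ φ
  rw [transition_eq] at hb
  refine hb.trans ((smul_direct f M (U := U₀ ⊓ U₁) _ _).trans ?_)
  rw [pullHol_ringRes]
  rfl

theorem exists_hom_direct {M : SheafOfModules.{0} (holSheaf sphere)} (m₀ : sec M (preim f U₀))
    (m₁ : sec M (preim f U₁))
    (h : res M (inf_le_right : preim f U₀ ⊓ preim f U₁ ≤ _) m₁ =
      ringRes (holSheaf sphere) (inf_le_right : preim f U₀ ⊓ preim f U₁ ≤ _) (pullHol f trans₁) •
        res M (inf_le_left : preim f U₀ ⊓ preim f U₁ ≤ _) m₀) :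
    ∃ φ : cotangentSheaf sphere ⟶ (direct f).obj M,
      app φ U₀ frame₀.gen = m₀ ∧ app φ U₁ frame₁.gen = m₁ := by
  refine exists_hom_of_frames (M := (direct f).obj M) frame₀ frame₁ U₀_or_U₁ m₀ m₁ ?_
  rw [transition_eq]
  refine Eq.trans ?_ (smul_direct f M (U := U₀ ⊓ U₁) _ _).symm
  rw [pullHol_ringRes]
  exact h

/-- Vanishing of the first cohomology of the pullback of the tangent sheaf, which has degree `2 d`.
-/
theorem exists_lift_of_hom_direct_quotSheaf
    (φ : cotangentSheaf sphere ⟶ (direct f).obj (quotSheaf sphere)) :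
    ∃ ψ : cotangentSheaf sphere ⟶ (direct f).obj (contSheaf sphere),
      ψ ≫ (direct f).map (contToQuot sphere) = φ := by
  have hb := res_app_gen f φ
  let b₀ : sec (quotSheaf sphere) (preim f U₀) := app φ U₀ frame₀.gen
  let b₁ : sec (quotSheaf sphere) (preim f U₁) := app φ U₁ frame₁.gen
  have hA : ∀ x, x ∈ preim f U₀ ∨ x ∈ preim f U₁ := fun x => U₀_or_U₁ (f x)
  obtain ⟨e₀, e₁, h₀, h₁, he⟩ := exists_pair_lift (contToQuot sphere) exists_global_representative
    hA (pullHol f trans₀) (pullHol f trans₁) (pullHol_trans₀_mul_trans₁ f)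
    (pullHol_trans₁_mul_trans₀ f) b₀ b₁ hb
  obtain ⟨ψ, hψ₀, hψ₁⟩ := exists_hom_direct f e₀ e₁ he
  refine ⟨ψ, hom_ext_frames frame₀ frame₁ U₀_or_U₁ ?_ ?_⟩
  · rw [app_comp, hψ₀]; exact h₀
  · rw [app_comp, hψ₁]; exact h₁

/-- Soft sheaves contain the injective ones and satisfy the conditions for dimension shifting. -/
theorem cofreeAcyclic_of_isSoft {M : SheafOfModules.{0} (holSheaf sphere)} (hM : IsSoft M) :
    CofreeAcyclic (cotangentFSheaf f) M :=
  cofreeAcyclic_of_class (cotangentFSheaf f) IsSoft (fun J _ => isSoft_of_injective J)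
    (fun _ hS h₁ h₂ => h₁.of_shortExact hS h₂)
    (fun _ hS h₁ φ => IsSoft.exists_hom_lift frame₀ frame₁ U₀_or_U₁ hS h₁ φ)
    (fun _ hS h₁ => epi_cofree_map f (h₁.closedLift hS)) hM

/-- In the resolution of `𝒪` by continuous functions, the continuous functions and their quotient by
the holomorphic ones are soft. -/
theorem cofreeAcyclic_structureSheaf :
    CofreeAcyclic (cotangentFSheaf f) (SheafOfModules.unit (holSheaf sphere)) := by
  have h : CofreeAcyclic (cotangentFSheaf f) (contSeq sphere).X₁ := by
    refine cofreeAcyclic_of_shortExact (cotangentFSheaf f) contSeq_shortExact ?_ ?_ ?_ ?_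
    · exact epi_cofree_map f closedLift_contToQuot
    · exact cofreeAcyclic_of_isSoft f isSoft_contSheaf
    · exact cofreeAcyclic_of_isSoft f isSoft_quotSheaf
    · exact exists_lift_of_hom_quotSheaf
  exact h

theorem direct_contSeq_shortExact : ((contSeq sphere).map (direct f)).ShortExact where
  exact := contSeq_shortExact.exact.map_of_mono_of_preservesKernel (direct f)
    (inferInstanceAs (Mono (holToCont sphere))) inferInstance
  mono_f := inferInstanceAs (Mono ((direct f).map (holToCont sphere)))
  epi_g := (closedLift_direct f closedLift_contToQuot).epi

theorem cofreeAcyclic_direct_structureSheaf :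
    CofreeAcyclic (cotangentFSheaf f)
      ((direct f).obj (SheafOfModules.unit (holSheaf sphere))) := by
  have h : CofreeAcyclic (cotangentFSheaf f) ((contSeq sphere).map (direct f)).X₁ := by
    refine cofreeAcyclic_of_shortExact (cotangentFSheaf f) (direct_contSeq_shortExact f) ?_ ?_ ?_ ?_
    · exact epi_cofree_map f (closedLift_direct f closedLift_contToQuot)
    · exact cofreeAcyclic_of_isSoft f (isSoft_direct f isSoft_contSheaf)
    · exact cofreeAcyclic_of_isSoft f (isSoft_direct f isSoft_quotSheaf)
    · exact exists_lift_of_hom_direct_quotSheaf f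
  exact h

end RiemannSphere

/-! ### Entire functions of polynomial growth -/

section Polynomial

open Polynomial

/-- The extended theorem of Liouville, by the Cauchy estimates for the derivatives at `0`. -/
theorem exists_polynomial_of_growth {h : ℂ → ℂ} (hh : Differentiable ℂ h) {n : ℕ} {C R : ℝ}
    (hC : ∀ z : ℂ, R ≤ ‖z‖ → ‖h z‖ ≤ C * ‖z‖ ^ n) :
    ∃ c : ℂ[X], c.natDegree ≤ n ∧ ∀ z, h z = c.eval z := by
  have hzero : ∀ k, n < k → iteratedDeriv k h 0 = 0 := by
    intro k hk
    have hlim : Tendsto (fun r : ℝ => k.factorial * C * (r ^ (k - n))⁻¹) atTop (𝓝 0) := by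
      have := (tendsto_inv_atTop_zero.comp (tendsto_pow_atTop (α := ℝ) (n := k - n)
        (by omega))).const_mul (k.factorial * C)
      simpa using this
    refine norm_le_zero_iff.1 (ge_of_tendsto hlim ?_)
    filter_upwards [eventually_ge_atTop R, eventually_gt_atTop 0] with r hr hr0
    have := Complex.norm_iteratedDeriv_le_of_forall_mem_sphere_norm_le (c := 0) (R := r)
      (C := C * r ^ n) k hr0 hh.diffContOnCl (fun z hz => by
        have hz' : ‖z‖ = r := mem_sphere_zero_iff_norm.1 hz
        simpa [hz'] using hC z (hz'.symm ▸ hr))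
    refine this.trans_eq ?_
    have : r ^ k = r ^ (k - n) * r ^ n := by rw [← pow_add]; congr 1; omega
    rw [this]
    field_simp
  refine ⟨∑ k ∈ Finset.range (n + 1),
    Polynomial.C ((k.factorial : ℂ)⁻¹ * iteratedDeriv k h 0) * X ^ k, ?_, fun z => ?_⟩
  · refine natDegree_sum_le_of_forall_le _ _ fun k hk => ?_
    exact (natDegree_C_mul_X_pow_le _ _).trans (Nat.lt_succ_iff.1 (Finset.mem_range.1 hk))
  · rw [← Complex.taylorSeries_eq_of_entire' 0 z hh, eval_finsetSum,
      tsum_eq_sum (s := Finset.range (n + 1)) fun k hk => ?_]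
    · simp
    · rw [hzero k (by simpa using hk)]
      simp

theorem Polynomial.eval_reflect {N : ℕ} {c : ℂ[X]} (hc : c.natDegree ≤ N) {w : ℂ} (hw : w ≠ 0) :
    (reflect N c).eval w = w ^ N * c.eval w⁻¹ := by
  let _ := invertibleOfNonzero (inv_ne_zero hw)
  have h := eval₂_reflect_mul_pow (RingHom.id ℂ) w⁻¹ N c hc
  rw [invOf_eq_inv, inv_inv, ← eval, ← eval] at h
  rw [← h, inv_pow, mul_comm _ (w ^ N)⁻¹, mul_inv_cancel_left₀ (pow_ne_zero _ hw)]

theorem Polynomial.eval_zero_reflect (N : ℕ) (c : ℂ[X]) : (reflect N c).eval 0 = c.coeff N := by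
  rw [← coeff_zero_eq_eval_zero, coeff_reflect, revAt_le (Nat.zero_le N), Nat.sub_zero]

end Polynomial

/-! ### Pairs of functions which represent twisted vector fields -/

namespace RiemannSphere

open RiemannSurface Polynomial

/-- In the local parameter `j`, the map `g` is the quotient of the polynomials `P` and `Q`, without
common zeros. -/
def IsQuot (g : sphere → sphere) (j : ℂ → sphere) (P Q : ℂ[X]) : Prop :=
  ∀ z, (Q.eval z ≠ 0 → g (j z) = pt (P.eval z / Q.eval z)) ∧
    (Q.eval z = 0 → P.eval z ≠ 0 ∧ g (j z) = sinv (pt 0))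

section IsQuot

variable {g : sphere → sphere} {j : ℂ → sphere} {P Q : ℂ[X]} (h : IsQuot g j P Q) {z : ℂ}

include h

theorem IsQuot.mem_U₀ : g (j z) ∈ U₀ ↔ Q.eval z ≠ 0 := by
  by_cases hQ : Q.eval z = 0
  · rw [((h z).2 hQ).2]
    exact iff_of_false infty_notMem_U₀ (not_not.2 hQ)
  · rw [(h z).1 hQ]
    exact iff_of_true (pt_mem_U₀ _) hQ

theorem IsQuot.mem_U₁ : g (j z) ∈ U₁ ↔ P.eval z ≠ 0 := by
  by_cases hQ : Q.eval z = 0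
  · rw [((h z).2 hQ).2]
    exact iff_of_true (RiemannSphere.mem_U₁.2 ⟨0, rfl⟩) ((h z).2 hQ).1
  · rw [(h z).1 hQ, pt_mem_U₁, ne_eq, div_eq_zero_iff, or_iff_left hQ]

theorem IsQuot.wFun_eq : wFun (g (j z)) = Q.eval z / P.eval z := by
  by_cases hQ : Q.eval z = 0
  · rw [((h z).2 hQ).2, wFun_sinv_pt, hQ, zero_div]
  · rw [(h z).1 hQ, wFun_pt, inv_div]

end IsQuot

/-- The rational map, on the object `sphere`. -/
noncomputable def rat (p q : ℂ[X]) (x : sphere) : sphere := ratMap p q x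

theorem rat_pt (p q : ℂ[X]) (z : ℂ) :
    rat p q (pt z) = if q.eval z = 0 then sinv (pt 0) else pt (p.eval z / q.eval z) := by
  have h : sinv (pt 0) = (OnePoint.infty : OnePoint ℂ) := inversion_zero
  rw [h]
  rfl

theorem rat_infty (p q : ℂ[X]) : rat p q (sinv (pt 0)) =
    if q.coeff (max p.natDegree q.natDegree) = 0 then sinv (pt 0)
      else pt (p.coeff (max p.natDegree q.natDegree) / q.coeff (max p.natDegree q.natDegree)) := by
  have h : sinv (pt 0) = (OnePoint.infty : OnePoint ℂ) := inversion_zero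
  rw [h]
  rfl

variable {p q : ℂ[X]} (hpq : IsCoprime p q) {d : ℕ} (hd : 1 ≤ d)
  (hdeg : max p.natDegree q.natDegree = d)

include hpq in
theorem eval_ne_zero_of_isCoprime {z : ℂ} (hq : q.eval z = 0) : p.eval z ≠ 0 := by
  obtain ⟨a, b, hab⟩ := hpq
  intro hp
  have := congrArg (eval z) hab
  simp [hp, hq] at this

include hpq in
theorem isQuot_pt : IsQuot (rat p q) pt p q := fun z =>
  ⟨fun hq => by rw [rat_pt, if_neg hq],
    fun hq => ⟨eval_ne_zero_of_isCoprime hpq hq, by rw [rat_pt, if_pos hq]⟩⟩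

include hpq hd hdeg in
/-- In the coordinate `w = 1 / z` a rational map of degree `d` is the quotient of the reversed
polynomials. -/
theorem isQuot_sinv : IsQuot (rat p q) (fun w => sinv (pt w)) (reflect d p) (reflect d q) := by
  have hp : p.natDegree ≤ d := hdeg ▸ le_max_left _ _
  have hq : q.natDegree ≤ d := hdeg ▸ le_max_right _ _
  intro w
  by_cases hw : w = 0
  · subst hw
    rw [eval_zero_reflect, eval_zero_reflect, rat_infty, hdeg]
    refine ⟨fun h => if_neg h, fun h => ⟨fun h' => ?_, if_pos h⟩⟩
    obtain h0 | h0 := max_choice p.natDegree q.natDegree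
    · rw [← hdeg, h0, coeff_natDegree, leadingCoeff_eq_zero] at h'
      rw [hdeg, h', natDegree_zero] at h0
      omega
    · rw [← hdeg, h0, coeff_natDegree, leadingCoeff_eq_zero] at h
      rw [hdeg, h, natDegree_zero] at h0
      omega
  · have hwd : w ^ d ≠ 0 := pow_ne_zero _ hw
    beta_reduce
    rw [eval_reflect hp hw, eval_reflect hq hw, sinv_pt hw, rat_pt, mul_ne_zero_iff_left hwd,
      mul_eq_zero_iff_left hwd, mul_ne_zero_iff_left hwd]
    refine ⟨fun h => ?_, fun h => ⟨eval_ne_zero_of_isCoprime hpq h, if_pos h⟩⟩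
    rw [if_neg h, mul_div_mul_left _ _ hwd]

/-- The function `c / q²` on the sphere, where the polynomials `c` and `q` are considered as being
of degree `2 d` and `d`. -/
noncomputable def secFun (d : ℕ) (c q : ℂ[X]) (x : sphere) : ℂ :=
  OnePoint.elim (X := ℂ) x (c.coeff (2 * d) / q.coeff d ^ 2) fun z => c.eval z / q.eval z ^ 2

theorem secFun_pt (d : ℕ) (c q : ℂ[X]) (z : ℂ) :
    secFun d c q (pt z) = c.eval z / q.eval z ^ 2 := rfl

theorem secFun_infty (d : ℕ) (c q : ℂ[X]) :
    secFun d c q (sinv (pt 0)) = c.coeff (2 * d) / q.coeff d ^ 2 :=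
  congrArg (secFun d c q) inversion_zero

theorem secFun_sinv {d : ℕ} {c q : ℂ[X]} (hc : c.natDegree ≤ 2 * d) (hq : q.natDegree ≤ d) (w : ℂ) :
    secFun d c q (sinv (pt w)) = (reflect (2 * d) c).eval w / (reflect d q).eval w ^ 2 := by
  by_cases hw : w = 0
  · subst hw
    rw [secFun_infty, eval_zero_reflect, eval_zero_reflect]
  · have hwd : w ^ d ≠ 0 := pow_ne_zero _ hw
    rw [sinv_pt hw, secFun_pt, eval_reflect hc hw, eval_reflect hq hw]
    rw [mul_pow, pow_mul', mul_div_mul_left _ _ (pow_ne_zero 2 hwd)]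

theorem holAt_secFun {d : ℕ} {c q : ℂ[X]} (hc : c.natDegree ≤ 2 * d) (hq : q.natDegree ≤ d)
    {x : sphere} (h₀ : ∀ z, x = pt z → q.eval z ≠ 0)
    (h₁ : ∀ z, x = sinv (pt z) → (reflect d q).eval z ≠ 0) : HolAt (secFun d c q) x := by
  have key (c q : ℂ[X]) (z : ℂ) (hz : q.eval z ≠ 0) :
      AnalyticAt ℂ (fun w => c.eval w / q.eval w ^ 2) z :=
    (c.differentiable.analyticAt z).div ((q.differentiable.analyticAt z).pow 2) (pow_ne_zero 2 hz)
  obtain ⟨z, rfl⟩ | rfl := sphere_cases x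
  · exact holAt_pt_iff.2 (key c q z (h₀ z rfl))
  · rw [holAt_sinv_pt_iff]
    simp only [secFun_sinv hc hq]
    exact key _ _ 0 (h₁ 0 rfl)

/-- A vector space of pairs `(m₀, m₁)` of functions, holomorphic on the preimages of `U₀` and `U₁`
under `g` and related by the transition function of `g^* T`. -/
structure IsPairSpace (g : sphere → sphere) {V : Type*} [AddCommGroup V] [Module ℂ V]
    (ev₀ ev₁ : V →ₗ[ℂ] sphere → ℂ) : Prop where
  hol₀ : ∀ v x, g x ∈ U₀ → HolAt (ev₀ v) x
  hol₁ : ∀ v x, g x ∈ U₁ → HolAt (ev₁ v) x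
  compat : ∀ v x, g x ∈ U₀ → g x ∈ U₁ → ev₁ v x = -(wFun (g x) * wFun (g x)) * ev₀ v x
  ext : ∀ v v', (∀ x, g x ∈ U₀ → ev₀ v x = ev₀ v' x) → (∀ x, g x ∈ U₁ → ev₁ v x = ev₁ v' x) → v = v'
  exist : ∀ m₀ m₁ : sphere → ℂ, (∀ x, g x ∈ U₀ → HolAt m₀ x) → (∀ x, g x ∈ U₁ → HolAt m₁ x) →
    (∀ x, g x ∈ U₀ → g x ∈ U₁ → m₁ x = -(wFun (g x) * wFun (g x)) * m₀ x) →
    ∃ v, (∀ x, g x ∈ U₀ → ev₀ v x = m₀ x) ∧ ∀ x, g x ∈ U₁ → ev₁ v x = m₁ x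

section

variable {g : sphere → sphere} {V : Type*} [AddCommGroup V] [Module ℂ V]
  {ev₀ ev₁ : V →ₗ[ℂ] sphere → ℂ} (hV : IsPairSpace g ev₀ ev₁)

include hV

open Classical in
/-- In a local parameter in which `g = P / Q`, a pair gives rise to a holomorphic function, namely
`Q² m₀ = -P² m₁`. -/
theorem IsPairSpace.exists_analytic {j : ℂ → sphere}
    (hjh : ∀ (h : sphere → ℂ) z, HolAt h (j z) → AnalyticAt ℂ (fun w => h (j w)) z) {P Q : ℂ[X]}
    (hq : IsQuot g j P Q) (v : V) :
    ∃ h : ℂ → ℂ, (∀ z, AnalyticAt ℂ h z) ∧ (∀ z, Q.eval z ≠ 0 → h z = Q.eval z ^ 2 * ev₀ v (j z)) ∧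
      ∀ z, P.eval z ≠ 0 → h z = -(P.eval z ^ 2 * ev₁ v (j z)) := by
  let h : ℂ → ℂ := fun z => if Q.eval z ≠ 0 then Q.eval z ^ 2 * ev₀ v (j z)
    else -(P.eval z ^ 2 * ev₁ v (j z))
  have h₀ : ∀ z, Q.eval z ≠ 0 → h z = Q.eval z ^ 2 * ev₀ v (j z) := fun z hz => if_pos hz
  have h₁ : ∀ z, P.eval z ≠ 0 → h z = -(P.eval z ^ 2 * ev₁ v (j z)) := fun z hz => by
    by_cases hQ : Q.eval z ≠ 0
    · rw [h₀ z hQ, hV.compat v _ (hq.mem_U₀.2 hQ) (hq.mem_U₁.2 hz), hq.wFun_eq]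
      field_simp
    · exact if_neg hQ
  refine ⟨h, fun z => ?_, h₀, h₁⟩
  by_cases hQ : Q.eval z = 0
  · have hP : P.eval z ≠ 0 := ((hq z).2 hQ).1
    refine (((P.differentiable.analyticAt z).pow 2).mul
      (hjh _ z (hV.hol₁ v _ (hq.mem_U₁.2 hP)))).neg.congr ?_
    filter_upwards [P.continuous.continuousAt.eventually_ne hP] with w hw
    exact (h₁ w hw).symm
  · refine (((Q.differentiable.analyticAt z).pow 2).mul
      (hjh _ z (hV.hol₀ v _ (hq.mem_U₀.2 hQ)))).congr ?_
    filter_upwards [Q.continuous.continuousAt.eventually_ne hQ] with w hw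
    exact (h₀ w hw).symm

include hpq hd hdeg

/-- A pair is given by a polynomial `c` of degree at most `2 d`: `m₀ = c / q²`, `m₁ = -c / p²`. -/
theorem IsPairSpace.exists_polynomial (hg : g = rat p q) (v : V) :
    ∃ c : ℂ[X], c.natDegree ≤ 2 * d ∧ (∀ x, g x ∈ U₀ → ev₀ v x = secFun d c q x) ∧
      ∀ x, g x ∈ U₁ → ev₁ v x = -secFun d c p x := by
  have hp : p.natDegree ≤ d := hdeg ▸ le_max_left _ _
  have hq : q.natDegree ≤ d := hdeg ▸ le_max_right _ _
  have q₀ : IsQuot g pt p q := hg ▸ isQuot_pt hpq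
  have q₁ := isQuot_sinv hpq hd hdeg
  rw [← hg] at q₁
  obtain ⟨h, ha, h₀, h₁⟩ := hV.exists_analytic (fun _ _ => holAt_pt_iff.1) q₀ v
  obtain ⟨k, ka, k₀, k₁⟩ := hV.exists_analytic (fun _ _ => holAt_sinv_pt_iff.1) q₁ v
  have hk (w : ℂ) (hw : w ≠ 0) : k w = w ^ (2 * d) * h w⁻¹ := by
    have hwd : w ^ d ≠ 0 := pow_ne_zero _ hw
    by_cases hQ : q.eval w⁻¹ = 0
    · have hP := ((q₀ _).2 hQ).1
      rw [h₁ _ hP, k₁ _ (by rw [eval_reflect hp hw]; exact mul_ne_zero hwd hP), eval_reflect hp hw,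
        sinv_pt hw]
      ring
    · rw [h₀ _ hQ, k₀ _ (by rw [eval_reflect hq hw]; exact mul_ne_zero hwd hQ), eval_reflect hq hw,
        sinv_pt hw]
      ring
  obtain ⟨δ, hδ, hδk⟩ := Metric.eventually_nhds_iff.1
    ((ka 0).continuousAt.norm.eventually (gt_mem_nhds (lt_add_one ‖k 0‖)))
  obtain ⟨c, hc, hhc⟩ := exists_polynomial_of_growth (h := h) (n := 2 * d) (C := ‖k 0‖ + 1)
    (R := δ⁻¹ + 1) (fun z => (ha z).differentiableAt) (fun z hz => by
      have hz0 : z ≠ 0 := by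
        rintro rfl
        rw [norm_zero] at hz
        have := inv_pos.2 hδ
        linarith
      have h1 := hk z⁻¹ (inv_ne_zero hz0)
      rw [inv_inv] at h1
      have h2 : ‖k z⁻¹‖ < ‖k 0‖ + 1 := hδk (by
        rw [dist_zero_right, norm_inv]
        exact inv_lt_of_inv_lt₀ hδ (by linarith))
      have h3 : h z = k z⁻¹ * z ^ (2 * d) := by
        rw [h1, inv_pow]
        field_simp
      rw [h3, norm_mul, norm_pow]
      gcongr)
  have hkc (w : ℂ) : k w = (reflect (2 * d) c).eval w := by
    have hne (w : ℂ) (hw : w ≠ 0) : k w = (reflect (2 * d) c).eval w := by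
      rw [hk w hw, eval_reflect hc hw, hhc]
    by_cases hw : w = 0
    · subst hw
      have t₁ := (ka 0).continuousAt.tendsto.mono_left (nhdsWithin_le_nhds (s := {0}ᶜ))
      have t₂ := ((reflect (2 * d) c).continuous.tendsto 0).mono_left
        (nhdsWithin_le_nhds (s := {0}ᶜ))
      refine tendsto_nhds_unique_of_eventuallyEq t₁ t₂ ?_
      filter_upwards [self_mem_nhdsWithin] with w hw
      exact hne w hw
    · exact hne w hw
  refine ⟨c, hc, fun x hx => ?_, fun x hx => ?_⟩
  · obtain ⟨z, rfl⟩ | rfl := sphere_cases x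
    · have hz := q₀.mem_U₀.1 hx
      rw [secFun_pt, eq_div_iff (pow_ne_zero 2 hz), ← hhc, h₀ z hz, mul_comm]
    · have hz := q₁.mem_U₀.1 hx
      rw [secFun_sinv hc hq, eq_div_iff (pow_ne_zero 2 hz), ← hkc, k₀ 0 hz, mul_comm]
  · obtain ⟨z, rfl⟩ | rfl := sphere_cases x
    · have hz := q₀.mem_U₁.1 hx
      rw [secFun_pt, ← neg_div, eq_div_iff (pow_ne_zero 2 hz), ← hhc, h₁ z hz, mul_comm, neg_neg]
    · have hz := q₁.mem_U₁.1 hx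
      rw [secFun_sinv hc hp, ← neg_div, eq_div_iff (pow_ne_zero 2 hz), ← hkc, k₁ 0 hz, mul_comm,
        neg_neg]

theorem IsPairSpace.exists_of_polynomial (hg : g = rat p q) {c : ℂ[X]} (hc : c.natDegree ≤ 2 * d) :
    ∃ v, (∀ x, g x ∈ U₀ → ev₀ v x = secFun d c q x) ∧
      ∀ x, g x ∈ U₁ → ev₁ v x = -secFun d c p x := by
  have hp : p.natDegree ≤ d := hdeg ▸ le_max_left _ _
  have hq : q.natDegree ≤ d := hdeg ▸ le_max_right _ _
  have q₀ : IsQuot g pt p q := hg ▸ isQuot_pt hpq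
  have q₁ := isQuot_sinv hpq hd hdeg
  rw [← hg] at q₁
  refine hV.exist _ (fun x => -secFun d c p x) (fun x hx => ?_) (fun x hx => ?_) fun x hx hx' => ?_
  · exact holAt_secFun hc hq (fun z hz => q₀.mem_U₀.1 (hz ▸ hx)) fun z hz => q₁.mem_U₀.1 (hz ▸ hx)
  · exact (holAt_secFun hc hp (fun z hz => q₀.mem_U₁.1 (hz ▸ hx)) fun z hz =>
      q₁.mem_U₁.1 (hz ▸ hx)).neg
  · obtain ⟨z, rfl⟩ | rfl := sphere_cases x
    · have hz := q₀.mem_U₀.1 hx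
      have hz' := q₀.mem_U₁.1 hx'
      rw [secFun_pt, secFun_pt, q₀.wFun_eq]
      field_simp
    · have hz := q₁.mem_U₀.1 hx
      have hz' := q₁.mem_U₁.1 hx'
      rw [secFun_sinv hc hp, secFun_sinv hc hq, q₁.wFun_eq]
      field_simp

/-- The space of sections of `g^* T` is the space of polynomials of degree at most `2 d`. -/
theorem IsPairSpace.exists_linearEquiv (hg : g = rat p q) :
    ∃ e : degreeLT ℂ (2 * d + 1) ≃ₗ[ℂ] V,
      ∀ (c : degreeLT ℂ (2 * d + 1)) x, g x ∈ U₀ → ev₀ (e c) x = secFun d c q x := by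
  have hdegc (c : degreeLT ℂ (2 * d + 1)) : (c : ℂ[X]).natDegree ≤ 2 * d :=
    natDegree_le_of_degree_le (Order.lt_succ_iff.1 (by exact_mod_cast mem_degreeLT.1 c.2))
  choose v h₀ h₁ using fun c : degreeLT ℂ (2 * d + 1) =>
    hV.exists_of_polynomial hpq hd hdeg hg (hdegc c)
  have q₀ : IsQuot g pt p q := hg ▸ isQuot_pt hpq
  let φ : degreeLT ℂ (2 * d + 1) →ₗ[ℂ] V :=
    { toFun := v
      map_add' a b := hV.ext _ _
        (fun x hx => by
          rw [h₀ _ x hx, map_add, Pi.add_apply, h₀ _ x hx, h₀ _ x hx]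
          obtain ⟨z, rfl⟩ | rfl := sphere_cases x
          · simp only [secFun_pt, Submodule.coe_add, eval_add, add_div]
          · simp only [secFun_infty, Submodule.coe_add, coeff_add, add_div])
        (fun x hx => by
          rw [h₁ _ x hx, map_add, Pi.add_apply, h₁ _ x hx, h₁ _ x hx]
          obtain ⟨z, rfl⟩ | rfl := sphere_cases x
          · simp only [secFun_pt, Submodule.coe_add, eval_add, add_div, neg_add]
          · simp only [secFun_infty, Submodule.coe_add, coeff_add, add_div, neg_add])
      map_smul' r a := hV.ext _ _
        (fun x hx => by
          rw [h₀ _ x hx, RingHom.id_apply, map_smul, Pi.smul_apply, h₀ _ x hx]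
          obtain ⟨z, rfl⟩ | rfl := sphere_cases x
          · simp only [secFun_pt, Submodule.coe_smul, eval_smul, smul_eq_mul, mul_div_assoc]
          · simp only [secFun_infty, Submodule.coe_smul, coeff_smul, smul_eq_mul, mul_div_assoc])
        (fun x hx => by
          rw [h₁ _ x hx, RingHom.id_apply, map_smul, Pi.smul_apply, h₁ _ x hx]
          obtain ⟨z, rfl⟩ | rfl := sphere_cases x
          · simp only [secFun_pt, Submodule.coe_smul, eval_smul, smul_eq_mul, mul_div_assoc,
              mul_neg]
          · simp only [secFun_infty, Submodule.coe_smul, coeff_smul, smul_eq_mul, mul_div_assoc,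
              mul_neg]) }
  have hq0 : q ≠ 0 := by
    rintro rfl
    have := natDegree_eq_zero_of_isUnit (isCoprime_zero_right.1 hpq)
    rw [this, natDegree_zero, max_self] at hdeg
    omega
  refine ⟨LinearEquiv.ofBijective φ ⟨fun a b hab => ?_, fun u => ?_⟩, h₀⟩
  · refine Subtype.ext (sub_eq_zero.1 ?_)
    refine (mul_eq_zero.1 (funext (q := 0) fun z => ?_)).resolve_right hq0
    rw [eval_mul, eval_zero, mul_eq_zero]
    by_cases hz : q.eval z = 0
    · exact Or.inr hz
    · left
      have hx := q₀.mem_U₀.2 hz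
      have h := (h₀ a _ hx).symm.trans ((congrArg (fun u => ev₀ u (pt z)) hab).trans (h₀ b _ hx))
      rw [secFun_pt, secFun_pt, div_left_inj' (pow_ne_zero 2 hz)] at h
      rw [eval_sub, h, sub_self]
  · obtain ⟨c, hc, hc₀, hc₁⟩ := hV.exists_polynomial hpq hd hdeg hg u
    have hmem : c ∈ degreeLT ℂ (2 * d + 1) := mem_degreeLT.2
      (degree_le_natDegree.trans_lt (by exact_mod_cast Nat.lt_succ_of_le hc))
    exact ⟨⟨c, hmem⟩, hV.ext _ _ (fun x hx => (h₀ ⟨c, hmem⟩ x hx).trans (hc₀ x hx).symm)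
      (fun x hx => (h₁ ⟨c, hmem⟩ x hx).trans (hc₁ x hx).symm)⟩

end

end RiemannSphere

/-! ### Homomorphisms from one-forms to cofree coalgebras as pairs of functions -/

namespace RiemannSphere

open RiemannSurface SheafOfModules CategoryTheory.Endofunctor.Coalgebra

variable (f : HolEnd sphere)

theorem app_smul_comp {F N : FSheaf f} {P : SheafOfModules.{0} (holSheaf sphere)} (c : ℂ)
    (k : F ⟶ N) (π : N.V ⟶ P) {W : Opens sphere} (s : sec F.V W) :
    app ((c • k).f ≫ π) W s = const (op W) c • app (k.f ≫ π) W s := by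
  have h : app ((c • k).f ≫ π) W s = app (k.f ≫ π) W (const (op W) c • s) := rfl
  rw [h, map_smul]

theorem holExt_add {U : Opens sphere} (g h : holSec U) : holExt (g + h) = holExt g + holExt h := by
  funext x
  by_cases hx : x ∈ U
  · rw [Pi.add_apply, holExt_of_mem _ hx, holExt_of_mem _ hx, holExt_of_mem _ hx, val_add]
  · simp [holExt, hx]

theorem holExt_const_mul {U : Opens sphere} (c : ℂ) (g : holSec U) :
    holExt (const (op U) c * g) = c • holExt g := by
  funext x
  by_cases hx : x ∈ U
  · rw [Pi.smul_apply, holExt_of_mem _ hx, holExt_of_mem _ hx, val_mul, val_const, smul_eq_mul]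
  · simp [holExt, hx]

theorem app_add_comp {F N : FSheaf f} {P : SheafOfModules.{0} (holSheaf sphere)}
    (k l : F ⟶ N) (π : N.V ⟶ P) {W : Opens sphere} (s : sec F.V W) :
    app ((k + l).f ≫ π) W s = app (k.f ≫ π) W s + app (l.f ≫ π) W s :=
  map_add (app π W) (app k.f W s) (app l.f W s)

section

variable {W : Opens sphere} (s : sec (cotangentSheaf sphere) W)

/-- The holomorphic function on `W` which is the value at the one-form `s` of a morphism from `Ω` to
the cofree coalgebra on `𝒪`. -/
noncomputable def unitVal
    (k : cotangentFSheaf f ⟶ cofreeObj (direct f) (SheafOfModules.unit (holSheaf sphere))) :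
    holSec W :=
  app (k.f ≫ cofreeCounit (direct f) _) W s

/-- The extension by zero of `unitVal`. -/
noncomputable def evUnit :
    (cotangentFSheaf f ⟶ cofreeObj (direct f) (SheafOfModules.unit (holSheaf sphere))) →ₗ[ℂ]
      sphere → ℂ where
  toFun k := holExt (unitVal f s k)
  map_add' k l := (congrArg holExt (app_add_comp f k l _ s)).trans (holExt_add _ _)
  map_smul' c k := (congrArg holExt (app_smul_comp f c k _ s)).trans (holExt_const_mul c _)

theorem evUnit_of_mem
    (k : cotangentFSheaf f ⟶ cofreeObj (direct f) (SheafOfModules.unit (holSheaf sphere)))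
    {x : sphere} (hx : x ∈ W) : evUnit f s k x = RiemannSurface.val (unitVal f s k) x hx :=
  holExt_of_mem _ hx

theorem holAt_evUnit
    (k : cotangentFSheaf f ⟶ cofreeObj (direct f) (SheafOfModules.unit (holSheaf sphere)))
    {x : sphere} (hx : x ∈ W) : HolAt (evUnit f s k) x :=
  holAt_holExt _ hx

/-- The holomorphic function on the preimage of `W` which is the value at the one-form `s` of a
morphism from `Ω` to the cofree coalgebra on `f_* 𝒪`. -/
noncomputable def directVal
    (k : cotangentFSheaf f ⟶ cofreeObj (direct f)
      ((direct f).obj (SheafOfModules.unit (holSheaf sphere)))) : holSec (preim f W) :=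
  app (k.f ≫ cofreeCounit (direct f) _) W s

/-- The extension by zero of `directVal`. -/
noncomputable def evDirect :
    (cotangentFSheaf f ⟶ cofreeObj (direct f)
      ((direct f).obj (SheafOfModules.unit (holSheaf sphere)))) →ₗ[ℂ] sphere → ℂ where
  toFun k := holExt (directVal f s k)
  map_add' k l := (congrArg holExt (app_add_comp f k l _ s)).trans (holExt_add _ _)
  map_smul' c k := (congrArg holExt (app_smul_comp f c k _ s)).trans (holExt_const_mul c _)

theorem evDirect_of_mem
    (k : cotangentFSheaf f ⟶ cofreeObj (direct f)
      ((direct f).obj (SheafOfModules.unit (holSheaf sphere))))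
    {x : sphere} (hx : x ∈ preim f W) :
    evDirect f s k x = RiemannSurface.val (directVal f s k) x hx :=
  holExt_of_mem _ hx

theorem holAt_evDirect
    (k : cotangentFSheaf f ⟶ cofreeObj (direct f)
      ((direct f).obj (SheafOfModules.unit (holSheaf sphere))))
    {x : sphere} (hx : x ∈ preim f W) : HolAt (evDirect f s k) x :=
  holAt_holExt _ hx

theorem unitVal_cofreeLift
    (φ : (cotangentFSheaf f).V ⟶ SheafOfModules.unit (holSheaf sphere)) :
    unitVal f s (cofreeLift _ φ) = app φ W s :=
  congrArg (fun φ => app φ W s) (cofreeLift_counit _ φ)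

theorem directVal_cofreeLift
    (φ : (cotangentFSheaf f).V ⟶ (direct f).obj (SheafOfModules.unit (holSheaf sphere))) :
    directVal f s (cofreeLift _ φ) = app φ W s :=
  congrArg (fun φ => app φ W s) (cofreeLift_counit _ φ)

end

/-- Homomorphisms to the cofree coalgebra on `𝒪` are morphisms `Ω ⟶ 𝒪` of sheaves, that is sections
of `T`, given by their values at `dz` and `d(1 / z)`. -/
theorem isPairSpace_evUnit : IsPairSpace id (evUnit f frame₀.gen) (evUnit f frame₁.gen) where
  hol₀ k x hx := holAt_evUnit f _ k hx
  hol₁ k x hx := holAt_evUnit f _ k hx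
  compat k x h₀ h₁ := by
    have h₀ : x ∈ U₀ := h₀
    have h₁ : x ∈ U₁ := h₁
    have hb := app_gen_eq frame₀ frame₁ (k.f ≫ cofreeCounit (direct f) _)
    rw [transition_eq] at hb
    rw [evUnit_of_mem f _ k h₀, evUnit_of_mem f _ k h₁]
    exact congrArg (fun r : holSec (U₀ ⊓ U₁) => RiemannSurface.val r x ⟨h₀, h₁⟩) hb
  ext k l h₀ h₁ := cofree_hom_ext <| hom_ext_frames frame₀ frame₁ U₀_or_U₁
    (hol_ext fun x hx =>
      (evUnit_of_mem f _ k hx).symm.trans ((h₀ x hx).trans (evUnit_of_mem f _ l hx)))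
    (hol_ext fun x hx =>
      (evUnit_of_mem f _ k hx).symm.trans ((h₁ x hx).trans (evUnit_of_mem f _ l hx)))
  exist m₀ m₁ h₀ h₁ h := by
    obtain ⟨φ, hφ₀, hφ₁⟩ := exists_hom_of_frames (M := SheafOfModules.unit (holSheaf sphere))
      frame₀ frame₁ U₀_or_U₁ (holMk U₀ m₀ h₀) (holMk U₁ m₁ h₁) (by
        rw [transition_eq]
        exact hol_ext fun x hx => h x hx.1 hx.2)
    refine ⟨cofreeLift (cotangentFSheaf f) φ, fun x hx => ?_, fun x hx => ?_⟩
    · exact (evUnit_of_mem f _ _ hx).trans (congrArg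
        (fun r : holSec U₀ => RiemannSurface.val r x hx) ((unitVal_cofreeLift f _ φ).trans hφ₀))
    · exact (evUnit_of_mem f _ _ hx).trans (congrArg
        (fun r : holSec U₁ => RiemannSurface.val r x hx) ((unitVal_cofreeLift f _ φ).trans hφ₁))

/-- Homomorphisms to the cofree coalgebra on `f_* 𝒪` are morphisms `Ω ⟶ f_* 𝒪` of sheaves, that is
sections of `f^* T`. -/
theorem isPairSpace_evDirect : IsPairSpace f (evDirect f frame₀.gen) (evDirect f frame₁.gen) where
  hol₀ k x hx := holAt_evDirect f _ k hx
  hol₁ k x hx := holAt_evDirect f _ k hx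
  compat k x h₀ h₁ := by
    have hb := res_app_gen f (k.f ≫ cofreeCounit (direct f) _)
    rw [evDirect_of_mem f frame₀.gen k h₀, evDirect_of_mem f frame₁.gen k h₁]
    exact congrArg (fun r : holSec (preim f U₀ ⊓ preim f U₁) =>
      RiemannSurface.val r x ⟨h₀, h₁⟩) hb
  ext k l h₀ h₁ := cofree_hom_ext <| hom_ext_frames frame₀ frame₁ U₀_or_U₁
    (hol_ext (U := preim f U₀) fun x hx =>
      (evDirect_of_mem f _ k hx).symm.trans ((h₀ x hx).trans (evDirect_of_mem f _ l hx)))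
    (hol_ext (U := preim f U₁) fun x hx =>
      (evDirect_of_mem f _ k hx).symm.trans ((h₁ x hx).trans (evDirect_of_mem f _ l hx)))
  exist m₀ m₁ h₀ h₁ h := by
    obtain ⟨φ, hφ₀, hφ₁⟩ := exists_hom_direct f (M := SheafOfModules.unit (holSheaf sphere))
      (holMk (preim f U₀) m₀ h₀) (holMk (preim f U₁) m₁ h₁)
      (hol_ext fun x hx => h x hx.1 hx.2)
    refine ⟨cofreeLift (cotangentFSheaf f) φ, fun x hx => ?_, fun x hx => ?_⟩
    · exact (evDirect_of_mem f _ _ hx).trans (congrArg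
        (fun r : holSec (preim f U₀) => RiemannSurface.val r x hx)
        ((directVal_cofreeLift f _ φ).trans hφ₀))
    · exact (evDirect_of_mem f _ _ hx).trans (congrArg
        (fun r : holSec (preim f U₁) => RiemannSurface.val r x hx)
        ((directVal_cofreeLift f _ φ).trans hφ₁))

end RiemannSphere

/-! ### The differential of the standard resolution in coordinates -/

namespace RiemannSphere

open RiemannSurface SheafOfModules CategoryTheory.Endofunctor.Coalgebra

variable (f : HolEnd sphere)

/-- The derivative of `f` in the coordinate `z`. -/
theorem differential_chart₀_comp {z : ℂ} (hz : f (pt z) ∈ U₀) :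
    differential ((chart₀ : sphere → ℂ) ∘ f) (pt z) =
      deriv (fun w => zFun (f (pt w))) z • differential chart₀ (pt z) := by
  have hp : pt z ∈ U₀ := pt_mem_U₀ z
  have hcz : chart₀ (pt z) = z := (chart₀_eq hp).trans (zFun_pt z)
  have hpre : ∀ᶠ y in 𝓝 (pt z), f y ∈ U₀ :=
    f.contMDiff.continuous.continuousAt.preimage_mem_nhds (U₀.isOpen.mem_nhds hz)
  have he : (chart₀ : sphere → ℂ) ∘ f =ᶠ[𝓝 (pt z)] (fun w => zFun (f (pt w))) ∘ chart₀ := by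
    filter_upwards [hpre, U₀.isOpen.mem_nhds hp] with y hy hy'
    obtain ⟨w, rfl⟩ := mem_U₀.1 hy'
    have hw : chart₀ (pt w) = w := (chart₀_eq hy').trans (zFun_pt w)
    rw [Function.comp_apply, Function.comp_apply, hw, chart₀_eq hy]
  have hd : DifferentiableAt ℂ (fun w => zFun (f (pt w))) z :=
    (holAt_pt_iff (h := fun x => zFun (f x))).1
      ((holAt_zFun hz).comp (pt z) f.contMDiff.contMDiffAt) |>.differentiableAt
  rw [differential_congr he, differential_comp_chart (by rw [hcz]; exact hd)
    ((holAt_chart chart₀_mem hp).mdifferentiableAt (by simp)), hcz]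

/-- The pullback of `dz` along `f` is `f' dz`. -/
theorem coef_cotangent_str {z : ℂ} (hz : f (pt z) ∈ U₀) :
    RiemannSurface.val (frame₀.coef (U₀ ⊓ preim f U₀) inf_le_left
      (res (cotangentSheaf sphere) inf_le_right
        (show sec (cotangentSheaf sphere) (preim f U₀) from
          app (cotangentFSheaf f).str U₀ frame₀.gen))) (pt z) ⟨pt_mem_U₀ z, hz⟩ =
      deriv (fun w => zFun (f (pt w))) z := by
  refine (val_chartCoef chart₀_mem inf_le_left _ (pt z) ⟨pt_mem_U₀ z, hz⟩).trans ?_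
  rw [div_eq_iff (dval_chart_ne_zero chart₀_mem (pt_mem_U₀ z))]
  have h := differential_comp (h := (chart₀ : sphere → ℂ)) (f := f) (y := pt z)
    ((holAt_chart chart₀_mem hz).mdifferentiableAt (by simp))
    (f.contMDiff.mdifferentiableAt (by simp))
  exact (congrArg (fun L : Cotangent (pt z) => L (1 : ℂ)) h).symm.trans
    (congrArg (fun L : Cotangent (pt z) => L (1 : ℂ)) (differential_chart₀_comp f hz))

/-- On vector fields `v`, the differential of the standard resolution is `df(v) - v ∘ f`. -/
theorem evDirect_standardDiff
    (v : cotangentFSheaf f ⟶ cofreeObj (direct f) (structureFSheaf f).V) {z : ℂ}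
    (hz : f (pt z) ∈ U₀) :
    evDirect f frame₀.gen (standardDiff (cotangentFSheaf f) (structureFSheaf f) ℂ v) (pt z) =
      deriv (fun w => zFun (f (pt w))) z * evUnit f frame₀.gen v (pt z) -
        evUnit f frame₀.gen v (f (pt z)) := by
  obtain ⟨φ, rfl⟩ : ∃ φ : (cotangentFSheaf f).V ⟶ (structureFSheaf f).V,
      v = cofreeLift (cotangentFSheaf f) φ :=
    ⟨v.f ≫ cofreeCounit _ _, cofree_hom_ext (cofreeLift_counit _ _).symm⟩
  have h₁ : directVal f frame₀.gen (standardDiff (cotangentFSheaf f) (structureFSheaf f) ℂ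
      (cofreeLift (cotangentFSheaf f) φ)) =
      app ((cotangentFSheaf f).str ≫ (direct f).map φ - φ ≫ (structureFSheaf f).str) U₀
        frame₀.gen :=
    (congrArg (directVal f frame₀.gen) (cofreeLift_comp_standardMap φ)).trans
      (directVal_cofreeLift f _ _)
  have h₂ : unitVal f frame₀.gen (cofreeLift (cotangentFSheaf f) φ) = app φ U₀ frame₀.gen :=
    unitVal_cofreeLift f _ φ
  let s : sec (cotangentSheaf sphere) (preim f U₀) := app (cotangentFSheaf f).str U₀ frame₀.gen
  have h₃ : res (SheafOfModules.unit (holSheaf sphere)) (inf_le_right : U₀ ⊓ preim f U₀ ≤ _)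
      (app φ (preim f U₀) s) = _ :=
    (app_res φ _ s).symm.trans (frame₀.app_eq φ inf_le_left _)
  have h₄ := congrArg (fun r : holSec (U₀ ⊓ preim f U₀) =>
    RiemannSurface.val r (pt z) ⟨pt_mem_U₀ z, hz⟩) h₃
  let a : holSec U₀ := app φ U₀ frame₀.gen
  have e₁ : evUnit f frame₀.gen (cofreeLift (cotangentFSheaf f) φ) (pt z) =
      RiemannSurface.val a (pt z) (pt_mem_U₀ z) :=
    (evUnit_of_mem f _ _ (pt_mem_U₀ z)).trans
      (congrArg (fun r : holSec U₀ => RiemannSurface.val r (pt z) (pt_mem_U₀ z)) h₂)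
  have e₂ : evUnit f frame₀.gen (cofreeLift (cotangentFSheaf f) φ) (f (pt z)) =
      RiemannSurface.val a (f (pt z)) hz :=
    (evUnit_of_mem f _ _ hz).trans
      (congrArg (fun r : holSec U₀ => RiemannSurface.val r (f (pt z)) hz) h₂)
  refine Eq.trans ?_ (congrArg₂ (· - ·) (congrArg (_ * ·) e₁.symm) e₂.symm)
  refine (evDirect_of_mem f frame₀.gen _ hz).trans ((congrArg (fun r : holSec (preim f U₀) =>
    RiemannSurface.val r (pt z) hz) h₁).trans ?_)
  refine congrArg (· - RiemannSurface.val a (f (pt z)) hz) ?_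
  exact h₄.trans (congrArg (· * RiemannSurface.val a (pt z) (pt_mem_U₀ z))
    (coef_cotangent_str f hz))

end RiemannSphere

/-! ### Invariant quadratic vector fields of a rational map -/

namespace Polynomial

/-- The numerator `p' q - p q'` of the derivative of `p / q`. -/
noncomputable def derivNum (p q : ℂ[X]) : ℂ[X] := derivative p * q - p * derivative q

variable {P Q : ℂ[X]}

theorem exists_eq_pow_mul_of_isRoot (hP : P ≠ 0) {x : ℂ} (hx : P.IsRoot x) :
    ∃ (k : ℕ) (R : ℂ[X]), P.rootMultiplicity x = k + 1 ∧ R.eval x ≠ 0 ∧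
      P = (X - C x) ^ (k + 1) * R := by
  obtain ⟨R, hR, hdvd⟩ := exists_eq_pow_rootMultiplicity_mul_and_not_dvd P hP x
  obtain ⟨k, hk⟩ := Nat.exists_eq_succ_of_ne_zero ((rootMultiplicity_pos hP).2 hx).ne'
  refine ⟨k, R, hk, fun h => hdvd (dvd_iff_isRoot.2 h), ?_⟩
  rw [← Nat.succ_eq_add_one, ← hk]
  exact hR

theorem derivNum_eq_of_pow {x : ℂ} {k : ℕ} (R Q : ℂ[X]) :
    derivNum ((X - C x) ^ (k + 1) * R) Q =
      (X - C x) ^ k * (C ((k : ℂ) + 1) * R * Q + (X - C x) * derivNum R Q) := by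
  rw [derivNum, derivNum, derivative_mul, derivative_X_sub_C_pow, Nat.add_sub_cancel]
  push_cast
  rw [pow_succ, C_add, C_1]
  ring

theorem natDegree_le_of_simple_roots {l : ℂ[X]} (hl : l ≠ 0)
    (h : ∀ x, P ≠ 0 → P.IsRoot x → P.rootMultiplicity x = 1 ∧ l.IsRoot x) :
    P.natDegree ≤ l.natDegree := by
  by_cases hP : P = 0
  · rw [hP, natDegree_zero]
    exact Nat.zero_le _
  rw [(IsAlgClosed.splits P).natDegree_eq_card_roots]
  refine (Multiset.card_le_card (Multiset.le_iff_count.2 fun x => ?_)).trans (card_roots' l)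
  rw [count_roots, count_roots]
  by_cases hx : P.IsRoot x
  · rw [(h x hP hx).1]
    exact (rootMultiplicity_pos hl).2 (h x hP hx).2
  · rw [rootMultiplicity_eq_zero hx]
    exact Nat.zero_le _

theorem eval_ne_zero_of_isCoprime_of_isRoot (h : IsCoprime P Q) {x : ℂ} (hx : P.IsRoot x) :
    Q.eval x ≠ 0 := by
  obtain ⟨a, b, hab⟩ := h
  intro hq
  have := congrArg (eval x) hab
  rw [eval_add, eval_mul, eval_mul, hx, hq] at this
  simp at this

/-- The residue of `P' / P - Q' / Q` at a zero of `P` is its multiplicity. -/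
theorem rootMultiplicity_mul_eval_derivative {a : ℂ[X]} {D : ℂ} (hPQ : IsCoprime P Q)
    (h : C D * P * Q = derivNum P Q * a) (hP : P ≠ 0) {x : ℂ} (hx : P.IsRoot x) :
    a.IsRoot x ∧ P.rootMultiplicity x * (derivative a).eval x = D := by
  obtain ⟨k, R, hk, hR, rfl⟩ := exists_eq_pow_mul_of_isRoot hP hx
  have hQ := eval_ne_zero_of_isCoprime_of_isRoot hPQ hx
  rw [hk]
  have hk1 : (k : ℂ) + 1 ≠ 0 := by exact_mod_cast k.succ_ne_zero
  rw [derivNum_eq_of_pow] at h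
  have h' : C D * (X - C x) * R * Q =
      (C ((k : ℂ) + 1) * R * Q + (X - C x) * derivNum R Q) * a := by
    refine mul_left_cancel₀ (pow_ne_zero k (X_sub_C_ne_zero x)) ?_
    linear_combination h
  have h₀ := congrArg (eval x) h'
  simp only [eval_mul, eval_add, eval_sub, eval_X, eval_C, sub_self, mul_zero, zero_mul,
    add_zero] at h₀
  have ha : a.eval x = 0 := by
    have := h₀.symm
    simpa [hk1, hR, hQ] using this
  have h₁ := congrArg (fun P => eval x (derivative P)) h'
  simp only [derivative_mul, derivative_add, derivative_sub, derivative_X, derivative_C, eval_mul,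
    eval_add, eval_sub, eval_X, eval_C, sub_self, mul_zero, zero_mul, add_zero, eval_one,
    sub_zero, mul_one, zero_add, ha] at h₁
  refine ⟨ha, ?_⟩
  push_cast
  have : ((k : ℂ) + 1) * (derivative a).eval x * (R.eval x * Q.eval x) =
      D * (R.eval x * Q.eval x) := by linear_combination -h₁
  exact mul_right_cancel₀ (mul_ne_zero hR hQ) this

/-- The case of a vector field with two distinct zeros. By the residues of `P' / P - Q' / Q`, a zero
of `P` is simple and a zero of the first linear factor. -/
theorem natDegree_le_one_of_distinct {u₁ v₁ u₂ v₂ : ℂ} (hD : u₁ * v₂ - u₂ * v₁ ≠ 0)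
    (hPQ : IsCoprime P Q)
    (h : C (u₁ * v₂ - u₂ * v₁) * P * Q =
      derivNum P Q * ((C u₁ * X + C v₁) * (C u₂ * X + C v₂))) :
    P.natDegree ≤ 1 := by
  have hl : C u₁ * X + C v₁ ≠ 0 := fun h0 => hD (by
    have h1 := congrArg (coeff · 1) h0
    have h2 := congrArg (coeff · 0) h0
    simp at h1 h2
    rw [h1, h2]
    ring)
  refine (natDegree_le_of_simple_roots hl fun x hP hx => ?_).trans natDegree_linear_le
  obtain ⟨ha, hm⟩ := rootMultiplicity_mul_eval_derivative hPQ h hP hx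
  simp only [IsRoot, eval_mul, eval_add, eval_X, eval_C, mul_eq_zero] at ha ⊢
  simp only [derivative_mul, derivative_add, derivative_X, derivative_C, eval_mul, eval_add, eval_X,
    eval_C, zero_mul, zero_add, mul_one, add_zero] at hm
  set m := P.rootMultiplicity x
  -- the derivative of the quadratic polynomial is `D` at the zero of the first linear factor and
  -- `-D` at the zero of the second one
  obtain ha | ha := ha
  · refine ⟨?_, ha⟩
    have : ((m : ℂ) - 1) * (u₁ * v₂ - u₂ * v₁) = 0 := by
      linear_combination hm - 2 * m * u₂ * ha
    have := (mul_eq_zero.1 this).resolve_right hD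
    exact_mod_cast sub_eq_zero.1 this
  · exfalso
    have : ((m : ℂ) + 1) * (u₁ * v₂ - u₂ * v₁) = 0 := by
      linear_combination -hm + 2 * m * u₁ * ha
    have := (mul_eq_zero.1 this).resolve_right hD
    exact m.succ_ne_zero (by exact_mod_cast this)

/-- A zero of `P` is simple and a zero of `l`, as its order `m` satisfies
`2 m = m - 1 + 2 ord l`. -/
theorem rootMultiplicity_eq_one_of_sq {l : ℂ[X]} {D : ℂ} (hD : D ≠ 0) (hl : l.natDegree ≤ 1)
    (hPQ : IsCoprime P Q) (h : C D * P ^ 2 = derivNum P Q * l ^ 2) (hP : P ≠ 0) {x : ℂ}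
    (hx : P.IsRoot x) : P.rootMultiplicity x = 1 ∧ l.IsRoot x := by
  obtain ⟨k, R, hk, hR, rfl⟩ := exists_eq_pow_mul_of_isRoot hP hx
  have hQ := eval_ne_zero_of_isCoprime_of_isRoot hPQ hx
  have hk1 : (k : ℂ) + 1 ≠ 0 := by exact_mod_cast k.succ_ne_zero
  rw [derivNum_eq_of_pow] at h
  have h' : C D * (X - C x) ^ (k + 2) * R ^ 2 =
      (C ((k : ℂ) + 1) * R * Q + (X - C x) * derivNum R Q) * l ^ 2 := by
    refine mul_left_cancel₀ (pow_ne_zero k (X_sub_C_ne_zero x)) ?_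
    linear_combination h
  have h₀ := congrArg (eval x) h'
  simp only [eval_mul, eval_add, eval_sub, eval_X, eval_C, eval_pow, sub_self, mul_zero, zero_mul,
    add_zero, zero_pow (Nat.succ_ne_zero _)] at h₀
  have hlx : l.eval x = 0 := by
    have := h₀.symm
    simpa [hk1, hR, hQ] using this
  refine ⟨?_, hlx⟩
  obtain ⟨c, rfl⟩ := dvd_iff_isRoot.2 hlx
  rw [hk]
  by_contra hk0
  obtain ⟨j, rfl⟩ := Nat.exists_eq_add_one_of_ne_zero (fun h0 => hk0 (by rw [h0]) : k ≠ 0)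
  have h'' : C D * (X - C x) ^ (j + 1) * R ^ 2 =
      (C (((j + 1 : ℕ) : ℂ) + 1) * R * Q + (X - C x) * derivNum R Q) * c ^ 2 := by
    refine mul_left_cancel₀ (pow_ne_zero 2 (X_sub_C_ne_zero x)) ?_
    linear_combination h'
  have hc : c.eval x ≠ 0 := by
    intro hc
    obtain ⟨b, rfl⟩ := dvd_iff_isRoot.2 hc
    by_cases hb : b = 0
    · rw [hb] at h''
      have hR0 : R ≠ 0 := fun h0 => hR (by rw [h0, eval_zero])
      simp [hD, hR0, X_sub_C_ne_zero] at h''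
    · rw [natDegree_mul (X_sub_C_ne_zero x) (mul_ne_zero (X_sub_C_ne_zero x) hb),
        natDegree_mul (X_sub_C_ne_zero x) hb, natDegree_X_sub_C] at hl
      omega
  have h₁ := congrArg (eval x) h''
  simp only [eval_mul, eval_add, eval_sub, eval_X, eval_C, eval_pow, sub_self, mul_zero, zero_mul,
    add_zero, zero_pow (Nat.succ_ne_zero _)] at h₁
  simp [hR, hQ, hc] at h₁
  exact hk1 (by exact_mod_cast h₁)

theorem natDegree_le_one_of_derivative_const (hQ : derivative (derivative Q) = 0) :
    Q.natDegree ≤ 1 := by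
  have h := derivative_eq_zero.1 hQ
  rw [natDegree_derivative] at h
  omega

/-- The case of a vector field with a double zero. If `P` is constant, then so is `Q'`; otherwise
`P` is proportional to `l`, and `P' Q - P Q'` is constant, which forces `P Q'' = 0`. -/
theorem natDegree_le_one_of_sq {l : ℂ[X]} {D : ℂ} (hD : D ≠ 0) (hl : l.natDegree ≤ 1) (hl0 : l ≠ 0)
    (hPQ : IsCoprime P Q) (h : C D * P ^ 2 = derivNum P Q * l ^ 2) :
    P.natDegree ≤ 1 ∧ Q.natDegree ≤ 1 := by
  have hroot x (hP : P ≠ 0) (hx : P.IsRoot x) := rootMultiplicity_eq_one_of_sq hD hl hPQ h hP hx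
  have hPl := natDegree_le_of_simple_roots hl0 hroot
  refine ⟨hPl.trans hl, ?_⟩
  by_cases hP : P.natDegree = 0
  · obtain ⟨b, rfl⟩ : ∃ b, P = C b := ⟨_, eq_C_of_natDegree_eq_zero hP⟩
    by_cases hb : b = 0
    · rw [hb, C_0, isCoprime_zero_left] at hPQ
      rw [natDegree_eq_zero_of_isUnit hPQ]
      exact zero_le_one
    · refine natDegree_le_one_of_derivative_const ?_
      rw [derivNum, derivative_C, zero_mul, zero_sub] at h
      have h1 : derivative Q * l ^ 2 = C (-(D * b)) := by
        refine mul_left_cancel₀ (C_ne_zero.2 hb) ?_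
        rw [C_neg, C_mul]
        linear_combination h
      have hu : IsUnit (derivative Q * l ^ 2) := by
        rw [h1]
        exact isUnit_C.2 (neg_ne_zero.2 (mul_ne_zero hD hb)).isUnit
      rw [eq_C_of_natDegree_eq_zero (natDegree_eq_zero_of_isUnit (isUnit_of_mul_isUnit_left hu)),
        derivative_C]
  · have hP0 : P ≠ 0 := by
      rintro rfl
      exact hP natDegree_zero
    obtain ⟨x, hx⟩ := IsAlgClosed.exists_root P (fun h => hP (natDegree_eq_of_degree_eq_some h))
    obtain ⟨b, hb⟩ := dvd_iff_isRoot.2 hx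
    obtain ⟨c, hc⟩ := dvd_iff_isRoot.2 (hroot x hP0 hx).2
    have aux {R b : ℂ[X]} (hR0 : R ≠ 0) (hR : R = (X - C x) * b) (h1 : R.natDegree ≤ 1) :
        ∃ β, b = C β ∧ β ≠ 0 := by
      have hb0 : b ≠ 0 := by
        rintro rfl
        exact hR0 (by rw [hR, mul_zero])
      have : b.natDegree = 0 := by
        rw [hR, natDegree_mul (X_sub_C_ne_zero x) hb0, natDegree_X_sub_C] at h1
        omega
      refine ⟨_, eq_C_of_natDegree_eq_zero this, fun h0 => hb0 ?_⟩
      rw [eq_C_of_natDegree_eq_zero this, h0, C_0]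
    obtain ⟨β, rfl, hβ⟩ := aux hP0 hb (hPl.trans hl)
    obtain ⟨γ, rfl, hγ⟩ := aux hl0 hc hl
    rw [hb, hc, derivNum] at h
    simp only [derivative_mul, derivative_sub, derivative_X, derivative_C, sub_zero, one_mul,
      mul_zero, add_zero] at h
    have h1 : (Q - (X - C x) * derivative Q) * C (γ ^ 2) = C (D * β) := by
      refine mul_left_cancel₀ (mul_ne_zero (C_ne_zero.2 hβ) (pow_ne_zero 2 (X_sub_C_ne_zero x))) ?_
      rw [C_pow, C_mul]
      linear_combination -h
    have h2 := congrArg derivative h1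
    simp only [derivative_mul, derivative_sub, derivative_X, derivative_C, sub_zero, one_mul,
      mul_zero, add_zero] at h2
    refine natDegree_le_one_of_derivative_const ?_
    refine (mul_eq_zero.1 ?_).resolve_left
      (mul_ne_zero (X_sub_C_ne_zero x) (C_ne_zero.2 (pow_ne_zero 2 hγ)))
    linear_combination -h2

theorem isCoprime_linear_combination {p q : ℂ[X]} (hpq : IsCoprime p q) {u₁ v₁ u₂ v₂ : ℂ}
    (hD : u₁ * v₂ - u₂ * v₁ ≠ 0) :
    IsCoprime (C u₁ * p + C v₁ * q) (C u₂ * p + C v₂ * q) := by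
  obtain ⟨a, b, hab⟩ := hpq
  have hC : C (u₁ * v₂ - u₂ * v₁)⁻¹ * (C u₁ * C v₂ - C u₂ * C v₁) = 1 := by
    rw [← C_mul, ← C_mul, ← C_sub, ← C_mul, inv_mul_cancel₀ hD, C_1]
  refine ⟨C (u₁ * v₂ - u₂ * v₁)⁻¹ * (a * C v₂ - b * C u₂),
    C (u₁ * v₂ - u₂ * v₁)⁻¹ * (b * C u₁ - a * C v₁), ?_⟩
  linear_combination (a * p + b * q) * hC + hab

theorem natDegree_le_one_of_linear_combination {p q : ℂ[X]} {u₁ v₁ u₂ v₂ : ℂ}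
    (hD : u₁ * v₂ - u₂ * v₁ ≠ 0) (h₁ : (C u₁ * p + C v₁ * q).natDegree ≤ 1)
    (h₂ : (C u₂ * p + C v₂ * q).natDegree ≤ 1) : p.natDegree ≤ 1 ∧ q.natDegree ≤ 1 := by
  have hC : C (u₁ * v₂ - u₂ * v₁)⁻¹ * (C u₁ * C v₂ - C u₂ * C v₁) = 1 := by
    rw [← C_mul, ← C_mul, ← C_sub, ← C_mul, inv_mul_cancel₀ hD, C_1]
  have hp : p = C ((u₁ * v₂ - u₂ * v₁)⁻¹ * v₂) * (C u₁ * p + C v₁ * q) +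
      C (-((u₁ * v₂ - u₂ * v₁)⁻¹ * v₁)) * (C u₂ * p + C v₂ * q) := by
    rw [C_neg, C_mul, C_mul]
    linear_combination -p * hC
  have hq : q = C (-((u₁ * v₂ - u₂ * v₁)⁻¹ * u₂)) * (C u₁ * p + C v₁ * q) +
      C ((u₁ * v₂ - u₂ * v₁)⁻¹ * u₁) * (C u₂ * p + C v₂ * q) := by
    rw [C_neg, C_mul, C_mul]
    linear_combination -q * hC
  constructor
  · rw [hp]
    exact natDegree_add_le_of_degree_le ((natDegree_C_mul_le _ _).trans h₁)
      ((natDegree_C_mul_le _ _).trans h₂)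
  · rw [hq]
    exact natDegree_add_le_of_degree_le ((natDegree_C_mul_le _ _).trans h₁)
      ((natDegree_C_mul_le _ _).trans h₂)

/-- A binary quadratic form over `ℂ` is a product of two linear forms. -/
theorem exists_factor_quadratic (α β γ : ℂ) : ∃ u₁ v₁ u₂ v₂ : ℂ,
    α = u₁ * u₂ ∧ β = u₁ * v₂ + u₂ * v₁ ∧ γ = v₁ * v₂ := by
  by_cases hα : α = 0
  · exact ⟨0, 1, β, γ, by rw [hα, zero_mul], by ring, by ring⟩
  · obtain ⟨s, hs⟩ := IsAlgClosed.exists_pow_nat_eq (β ^ 2 - 4 * α * γ) two_pos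
    refine ⟨α, (β - s) / 2, 1, (β + s) / (2 * α), by ring, ?_, ?_⟩
    · field_simp
      ring
    · field_simp
      linear_combination hs

/-- A rational map which preserves a nonzero quadratic vector field has degree at most one. -/
theorem natDegree_le_one_of_invariant {p q : ℂ[X]} (hpq : IsCoprime p q) {α β γ : ℂ}
    (hne : ¬(α = 0 ∧ β = 0 ∧ γ = 0))
    (h : C α * p ^ 2 + C β * (p * q) + C γ * q ^ 2 =
      derivNum p q * (C α * X ^ 2 + C β * X + C γ)) :
    p.natDegree ≤ 1 ∧ q.natDegree ≤ 1 := by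
  obtain ⟨u₁, v₁, u₂, v₂, rfl, rfl, rfl⟩ := exists_factor_quadratic α β γ
  by_cases hD : u₁ * v₂ - u₂ * v₁ = 0
  · -- the two linear forms are proportional
    obtain ⟨u, v, t, ht, hu, e₁, e₂, e₃⟩ : ∃ u v t : ℂ, t ≠ 0 ∧ ¬(u = 0 ∧ v = 0) ∧
        u₁ * u₂ = t * u ^ 2 ∧ u₁ * v₂ + u₂ * v₁ = t * (2 * u * v) ∧ v₁ * v₂ = t * v ^ 2 := by
      by_cases hu₁ : u₁ = 0
      · have hv₁ : v₁ ≠ 0 := by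
          rintro rfl
          exact hne ⟨by rw [hu₁]; ring, by rw [hu₁]; ring, by ring⟩
        have hu₂ : u₂ = 0 := by
          rw [hu₁] at hD
          simpa [hv₁] using hD
        have hv₂ : v₂ ≠ 0 := by
          rintro rfl
          exact hne ⟨by rw [hu₁]; ring, by rw [hu₂]; ring, by ring⟩
        refine ⟨0, v₁, v₂ / v₁, div_ne_zero hv₂ hv₁, fun h => hv₁ h.2, ?_, ?_, ?_⟩
        · rw [hu₁]; ring
        · rw [hu₁, hu₂]; ring
        · field_simp
      · have e : v₂ = u₂ / u₁ * v₁ := by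
          field_simp
          linear_combination hD
        have hu₂ : u₂ ≠ 0 := by
          rintro rfl
          rw [zero_div, zero_mul] at e
          exact hne ⟨by ring, by rw [e]; ring, by rw [e]; ring⟩
        refine ⟨u₁, v₁, u₂ / u₁, div_ne_zero hu₂ hu₁, fun h => hu₁ h.1, ?_, ?_, ?_⟩
        · field_simp
        · rw [e]; field_simp; ring
        · rw [e]; ring
    obtain ⟨u', v', hD'⟩ : ∃ u' v' : ℂ, u * v' - u' * v ≠ 0 := by
      by_cases hu0 : u = 0
      · exact ⟨1, 0, by simpa [hu0] using hu⟩
      · exact ⟨0, 1, by simpa using hu0⟩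
    have hl : C u * X + C v ≠ 0 := fun h0 => hu (by
      have h1 := congrArg (coeff · 1) h0
      have h2 := congrArg (coeff · 0) h0
      simp at h1 h2
      exact ⟨h1, h2⟩)
    have key := natDegree_le_one_of_sq hD' natDegree_linear_le hl
      (isCoprime_linear_combination hpq hD') (by
        refine mul_left_cancel₀ (C_ne_zero.2 ht) ?_
        rw [e₁, e₂, e₃] at h
        simp only [derivNum, derivative_add, derivative_mul, derivative_C, zero_mul, zero_add,
          C_mul, C_sub, C_pow, C_ofNat] at h ⊢
        linear_combination (C u * C v' - C u' * C v) * h)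
    exact natDegree_le_one_of_linear_combination hD' key.1 key.2
  · have hP := isCoprime_linear_combination hpq hD
    have hD' : u₂ * v₁ - u₁ * v₂ ≠ 0 := fun h0 => hD (by linear_combination -h0)
    refine natDegree_le_one_of_linear_combination hD
      (natDegree_le_one_of_distinct hD hP ?_) (natDegree_le_one_of_distinct hD' hP.symm ?_)
    · simp only [derivNum, derivative_add, derivative_mul, derivative_C, zero_mul, zero_add,
        C_add, C_mul, C_sub] at h ⊢
      linear_combination (C u₁ * C v₂ - C u₂ * C v₁) * h
    · simp only [derivNum, derivative_add, derivative_mul, derivative_C, zero_mul, zero_add,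
        C_add, C_mul, C_sub] at h ⊢
      linear_combination (C u₂ * C v₁ - C u₁ * C v₂) * h

section Linear

variable {p q : ℂ[X]} (hp : p.natDegree ≤ 1) (hq : q.natDegree ≤ 1)

include hp hq

theorem eq_linear_of_natDegree_le_one : p = C (p.coeff 1) * X + C (p.coeff 0) ∧
    q = C (q.coeff 1) * X + C (q.coeff 0) :=
  ⟨eq_X_add_C_of_natDegree_le_one hp, eq_X_add_C_of_natDegree_le_one hq⟩

theorem derivNum_of_natDegree_le_one :
    derivNum p q = C (p.coeff 1 * q.coeff 0 - p.coeff 0 * q.coeff 1) := by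
  conv_lhs => rw [(eq_linear_of_natDegree_le_one hp hq).1, (eq_linear_of_natDegree_le_one hp hq).2]
  simp only [derivNum, derivative_add, derivative_mul, derivative_C, derivative_X, C_sub, C_mul]
  ring

theorem det_ne_zero_of_isCoprime (hpq : IsCoprime p q) (hdeg : max p.natDegree q.natDegree = 1) :
    p.coeff 1 * q.coeff 0 - p.coeff 0 * q.coeff 1 ≠ 0 := by
  intro h
  obtain ⟨a, b, hab⟩ := hpq
  obtain ⟨ep, eq⟩ := eq_linear_of_natDegree_le_one hp hq
  -- both polynomials vanish at a common point, the zero of one of them of degree one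
  have key : ∃ x, p.eval x = 0 ∧ q.eval x = 0 := by
    obtain h1 | h1 := max_choice p.natDegree q.natDegree
    · have h2 : p.coeff 1 ≠ 0 := by
        have h3 : p.natDegree = 1 := h1.symm.trans hdeg
        rw [← h3, coeff_natDegree, leadingCoeff_ne_zero]
        rintro rfl
        simp at h3
      refine ⟨-p.coeff 0 / p.coeff 1, ?_, ?_⟩
      · rw [ep]
        simp
        field_simp
        ring
      · rw [eq]
        simp
        field_simp
        linear_combination h
    · have h2 : q.coeff 1 ≠ 0 := by
        have h3 : q.natDegree = 1 := h1.symm.trans hdeg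
        rw [← h3, coeff_natDegree, leadingCoeff_ne_zero]
        rintro rfl
        simp at h3
      refine ⟨-q.coeff 0 / q.coeff 1, ?_, ?_⟩
      · rw [ep]
        simp
        field_simp
        linear_combination -h
      · rw [eq]
        simp
        field_simp
        ring
  obtain ⟨x, hx, hx'⟩ := key
  have := congrArg (eval x) hab
  simp [hx, hx'] at this

/-- The vector field with the fixed points of a Möbius transformation as zeros is preserved. -/
theorem invariant_fixedPoints :
    C (q.coeff 1) * p ^ 2 + C (q.coeff 0 - p.coeff 1) * (p * q) + C (-p.coeff 0) * q ^ 2 =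
      derivNum p q * (C (q.coeff 1) * X ^ 2 + C (q.coeff 0 - p.coeff 1) * X + C (-p.coeff 0)) := by
  rw [derivNum_of_natDegree_le_one hp hq]
  obtain ⟨ep, eq⟩ := eq_linear_of_natDegree_le_one hp hq
  generalize p.coeff 1 = p₁ at *
  generalize p.coeff 0 = p₀ at *
  generalize q.coeff 1 = q₁ at *
  generalize q.coeff 0 = q₀ at *
  rw [ep, eq]
  simp only [C_sub, C_neg, C_mul]
  ring

/-- A quadratic vector field which is preserved by a Möbius transformation is proportional to the
one with the fixed points as zeros: the corresponding matrices commute. -/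
theorem proportional_of_invariant (hdet : p.coeff 1 * q.coeff 0 - p.coeff 0 * q.coeff 1 ≠ 0)
    {α β γ : ℂ} (h : C α * p ^ 2 + C β * (p * q) + C γ * q ^ 2 =
      derivNum p q * (C α * X ^ 2 + C β * X + C γ)) :
    α * (q.coeff 0 - p.coeff 1) = β * q.coeff 1 ∧ α * -p.coeff 0 = γ * q.coeff 1 ∧
      β * -p.coeff 0 = γ * (q.coeff 0 - p.coeff 1) := by
  rw [derivNum_of_natDegree_le_one hp hq] at h
  obtain ⟨ep, eq⟩ := eq_linear_of_natDegree_le_one hp hq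
  generalize p.coeff 1 = p₁ at *
  generalize p.coeff 0 = p₀ at *
  generalize q.coeff 1 = q₁ at *
  generalize q.coeff 0 = q₀ at *
  have hx (z : ℂ) := congrArg (eval z) h
  rw [ep, eq] at hx
  simp only [eval_add, eval_mul, eval_pow, eval_C, eval_X] at hx
  have h₀ := hx 0
  have h₁ := hx 1
  have h₂ := hx (-1)
  have e₃ : α * p₀ ^ 2 + β * (p₀ * q₀) + γ * q₀ ^ 2 = (p₁ * q₀ - p₀ * q₁) * γ := by
    linear_combination h₀
  have e₂ : 2 * α * p₁ * p₀ + β * (p₁ * q₀ + p₀ * q₁) + 2 * γ * q₁ * q₀ =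
      (p₁ * q₀ - p₀ * q₁) * β := by
    linear_combination (h₁ - h₂) / 2
  have e₁ : α * p₁ ^ 2 + β * (p₁ * q₁) + γ * q₁ ^ 2 = (p₁ * q₀ - p₀ * q₁) * α := by
    linear_combination (h₁ + h₂) / 2 - h₀
  refine ⟨mul_left_cancel₀ hdet ?_, mul_left_cancel₀ hdet ?_, mul_left_cancel₀ hdet ?_⟩
  · linear_combination -(q₀ * e₁ - q₁ * e₂ / 2)
  · linear_combination -(q₀ * e₂ / 2 - q₁ * e₃)
  · linear_combination -(-p₀ * e₂ / 2 + p₁ * e₃)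

end Linear

end Polynomial

/-! ### Dimensions of the spaces of homomorphisms -/

namespace RiemannSphere

open RiemannSurface SheafOfModules CategoryTheory.Endofunctor.Coalgebra Polynomial

theorem id_eq_rat : (id : sphere → sphere) = rat X 1 := by
  have hmax : max (X : ℂ[X]).natDegree (1 : ℂ[X]).natDegree = 1 := by
    rw [natDegree_X, natDegree_one]; rfl
  funext x
  obtain ⟨z, rfl⟩ | rfl := sphere_cases x
  · rw [rat_pt, eval_one, if_neg one_ne_zero, eval_X, div_one]
    rfl
  · rw [rat_infty, hmax, if_pos (by rw [coeff_one, if_neg one_ne_zero])]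
    rfl

/-- The polynomial with the coefficients of an element of `degreeLT ℂ 3`. -/
theorem eq_quadratic (c : degreeLT ℂ (2 * 1 + 1)) :
    (c : ℂ[X]) = C ((c : ℂ[X]).coeff 2) * X ^ 2 + C ((c : ℂ[X]).coeff 1) * X +
      C ((c : ℂ[X]).coeff 0) :=
  eq_quadratic_of_degree_le_two (Order.lt_succ_iff.1 (by exact_mod_cast mem_degreeLT.1 c.2))

theorem hasDerivAt_of_eq_rat {f : sphere → sphere} {p q : ℂ[X]} (hf : f = rat p q) {z : ℂ}
    (hz : q.eval z ≠ 0) : HasDerivAt (fun w => zFun (f (pt w)))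
      ((derivNum p q).eval z / q.eval z ^ 2) z := by
  have h := (p.hasDerivAt z).div (q.hasDerivAt z) hz
  rw [derivNum, eval_sub, eval_mul, eval_mul]
  refine h.congr_of_eventuallyEq ?_
  filter_upwards [q.continuous.continuousAt.eventually_ne hz] with w hw
  rw [hf, rat_pt, if_neg hw, zFun_pt]
  rfl

/-- The polynomial which represents the defect of invariance of the vector field `c`, namely the
difference of the vector fields `df(c)` and `c ∘ f` along `f`. -/
noncomputable def defect (p q c : ℂ[X]) : ℂ[X] :=
  derivNum p q * c -
    (C (c.coeff 2) * p ^ 2 + C (c.coeff 1) * (p * q) + C (c.coeff 0) * q ^ 2)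

theorem eval_defect {p q : ℂ[X]} (c : degreeLT ℂ (2 * 1 + 1)) {z : ℂ} (hz : q.eval z ≠ 0) :
    (defect p q c).eval z / q.eval z ^ 2 =
      (derivNum p q).eval z / q.eval z ^ 2 * (c : ℂ[X]).eval z -
        (c : ℂ[X]).eval (p.eval z / q.eval z) := by
  rw [defect, eq_quadratic c]
  generalize (c : ℂ[X]).coeff 2 = α
  generalize (c : ℂ[X]).coeff 1 = β
  generalize (c : ℂ[X]).coeff 0 = γ
  simp [coeff_X]
  field_simp

theorem defect_eq_zero_iff {p q : ℂ[X]} (c : degreeLT ℂ (2 * 1 + 1)) : defect p q c = 0 ↔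
    C ((c : ℂ[X]).coeff 2) * p ^ 2 + C ((c : ℂ[X]).coeff 1) * (p * q) +
      C ((c : ℂ[X]).coeff 0) * q ^ 2 = derivNum p q * (C ((c : ℂ[X]).coeff 2) * X ^ 2 +
        C ((c : ℂ[X]).coeff 1) * X + C ((c : ℂ[X]).coeff 0)) := by
  rw [defect, sub_eq_zero, eq_comm, ← eq_quadratic]

/-- A rational map of degree greater than one has no invariant vector field. -/
theorem defect_eq_zero_of_one_lt {p q : ℂ[X]} (hpq : IsCoprime p q)
    (hdeg : 1 < max p.natDegree q.natDegree) {c : degreeLT ℂ (2 * 1 + 1)}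
    (h : defect p q c = 0) : c = 0 := by
  by_contra hc
  have := natDegree_le_one_of_invariant hpq (fun h0 => hc (Subtype.ext (by
    rw [eq_quadratic c, h0.1, h0.2.1, h0.2.2]
    simp))) ((defect_eq_zero_iff c).1 h)
  omega

section

variable {p q : ℂ[X]} (hpq : IsCoprime p q) (hdeg : max p.natDegree q.natDegree = 1)

variable (p q) in
/-- The vector field with the fixed points of a Möbius transformation as zeros. -/
noncomputable def fixedPointField : degreeLT ℂ (2 * 1 + 1) :=
  ⟨C (q.coeff 1) * X ^ 2 + C (q.coeff 0 - p.coeff 1) * X + C (-p.coeff 0), mem_degreeLT.2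
    (degree_quadratic_le.trans_lt (by norm_num))⟩

theorem coeff_fixedPointField : (fixedPointField p q : ℂ[X]).coeff 2 = q.coeff 1 ∧
    (fixedPointField p q : ℂ[X]).coeff 1 = q.coeff 0 - p.coeff 1 ∧
      (fixedPointField p q : ℂ[X]).coeff 0 = -p.coeff 0 := by
  refine ⟨?_, ?_, ?_⟩ <;> simp [fixedPointField, coeff_X, coeff_C]

include hdeg

theorem defect_fixedPointField : defect p q (fixedPointField p q) = 0 := by
  obtain ⟨h₂, h₁, h₀⟩ := coeff_fixedPointField (p := p) (q := q)
  rw [defect_eq_zero_iff, h₂, h₁, h₀]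
  exact invariant_fixedPoints (hdeg ▸ le_max_left _ _) (hdeg ▸ le_max_right _ _)

include hpq

theorem fixedPointField_ne_zero (hne : rat p q ≠ id) : fixedPointField p q ≠ 0 := by
  intro h
  obtain ⟨h₂, h₁, h₀⟩ := coeff_fixedPointField (p := p) (q := q)
  rw [h] at h₂ h₁ h₀
  rw [ZeroMemClass.coe_zero, coeff_zero] at h₂ h₁ h₀
  have hp : p.natDegree ≤ 1 := hdeg ▸ le_max_left _ _
  have hq : q.natDegree ≤ 1 := hdeg ▸ le_max_right _ _
  have hdet := det_ne_zero_of_isCoprime hp hq hpq hdeg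
  obtain ⟨ep, eq⟩ := eq_linear_of_natDegree_le_one hp hq
  have e₀ : p.coeff 0 = 0 := by linear_combination h₀
  have e₁ : p.coeff 1 = q.coeff 0 := by linear_combination h₁
  rw [← h₂, e₁, e₀, zero_mul, sub_zero, mul_self_ne_zero] at hdet
  refine hne (funext fun x => ?_)
  obtain ⟨z, rfl⟩ | rfl := sphere_cases x
  · have hqz : q.eval z = q.coeff 0 := by
      conv_lhs => rw [eq, ← h₂]
      simp
    have hpz : p.eval z = q.coeff 0 * z := by
      conv_lhs => rw [ep, e₁, e₀]
      simp
    rw [rat_pt, if_neg (hqz.trans_ne hdet), hqz, hpz, mul_div_cancel_left₀ _ hdet]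
    rfl
  · rw [rat_infty, hdeg, if_pos h₂.symm]
    rfl

theorem exists_smul_fixedPointField (hne : rat p q ≠ id) {c : degreeLT ℂ (2 * 1 + 1)}
    (h : defect p q c = 0) : ∃ t : ℂ, t • fixedPointField p q = c := by
  have hp : p.natDegree ≤ 1 := hdeg ▸ le_max_left _ _
  have hq : q.natDegree ≤ 1 := hdeg ▸ le_max_right _ _
  have hw := fixedPointField_ne_zero hpq hdeg hne
  obtain ⟨e₁, e₂, e₃⟩ := proportional_of_invariant hp hq (det_ne_zero_of_isCoprime hp hq hpq hdeg)
    ((defect_eq_zero_iff c).1 h)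
  have hc := eq_quadratic c
  have key (t : ℂ) (h₂ : t * q.coeff 1 = (c : ℂ[X]).coeff 2)
      (h₁ : t * (q.coeff 0 - p.coeff 1) = (c : ℂ[X]).coeff 1)
      (h₀ : t * -p.coeff 0 = (c : ℂ[X]).coeff 0) : t • fixedPointField p q = c := by
    refine Subtype.ext (Eq.trans ?_ hc.symm)
    rw [← h₂, ← h₁, ← h₀, Submodule.coe_smul, fixedPointField, smul_eq_C_mul]
    simp only [C_mul]
    ring
  by_cases h₂ : q.coeff 1 = 0
  · by_cases h₁ : q.coeff 0 - p.coeff 1 = 0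
    · by_cases h₀ : -p.coeff 0 = 0
      · refine absurd (Subtype.ext ?_) hw
        rw [neg_eq_zero] at h₀
        simp [fixedPointField, h₂, h₁, h₀]
      · refine ⟨(c : ℂ[X]).coeff 0 / -p.coeff 0, key _ ?_ ?_ (div_mul_cancel₀ _ h₀)⟩
        · rw [div_mul_eq_mul_div, div_eq_iff h₀, e₂]
        · rw [div_mul_eq_mul_div, div_eq_iff h₀, e₃]
    · refine ⟨(c : ℂ[X]).coeff 1 / (q.coeff 0 - p.coeff 1), key _ ?_ (div_mul_cancel₀ _ h₁) ?_⟩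
      · rw [div_mul_eq_mul_div, div_eq_iff h₁, e₁]
      · rw [div_mul_eq_mul_div, div_eq_iff h₁, e₃]
  · refine ⟨(c : ℂ[X]).coeff 2 / q.coeff 1, key _ (div_mul_cancel₀ _ h₂) ?_ ?_⟩
    · rw [div_mul_eq_mul_div, div_eq_iff h₂, e₁]
    · rw [div_mul_eq_mul_div, div_eq_iff h₂, e₂]

end

variable {f : HolEnd sphere} {p q : ℂ[X]} (hpq : IsCoprime p q) {d : ℕ} (hd : 1 ≤ d)
  (hdeg : max p.natDegree q.natDegree = d) (hf : (f : sphere → sphere) = rat p q)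

variable (f) in
theorem exists_linearEquiv_unit : ∃ e : degreeLT ℂ (2 * 1 + 1) ≃ₗ[ℂ]
    (cotangentFSheaf f ⟶ cofreeObj (direct f) (structureFSheaf f).V),
      ∀ c z, evUnit f frame₀.gen (e c) (pt z) = (c : ℂ[X]).eval z := by
  have hmax : max (X : ℂ[X]).natDegree (1 : ℂ[X]).natDegree = 1 := by
    rw [natDegree_X, natDegree_one]; rfl
  obtain ⟨e, he⟩ := (isPairSpace_evUnit f).exists_linearEquiv (p := X) (q := 1) isCoprime_one_right
    le_rfl hmax id_eq_rat
  refine ⟨e, fun c z => (he c (pt z) (pt_mem_U₀ z)).trans ?_⟩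
  rw [secFun_pt, eval_one, one_pow, div_one]

include hpq hd hdeg hf

theorem exists_linearEquiv_direct : ∃ e : degreeLT ℂ (2 * d + 1) ≃ₗ[ℂ]
    (cotangentFSheaf f ⟶ cofreeObj (direct f) ((direct f).obj (structureFSheaf f).V)),
      ∀ c z, q.eval z ≠ 0 → evDirect f frame₀.gen (e c) (pt z) =
        (c : ℂ[X]).eval z / q.eval z ^ 2 := by
  obtain ⟨e, he⟩ := (isPairSpace_evDirect f).exists_linearEquiv hpq hd hdeg hf
  have hq : IsQuot f pt p q := hf ▸ isQuot_pt hpq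
  exact ⟨e, fun c z hz => he c (pt z) (hq.mem_U₀.2 hz)⟩

/-- The kernel of the differential of the standard resolution consists of the invariant vector
fields. -/
theorem standardDiff_eq_zero_iff
    {e : degreeLT ℂ (2 * 1 + 1) ≃ₗ[ℂ]
      (cotangentFSheaf f ⟶ cofreeObj (direct f) (structureFSheaf f).V)}
    (he : ∀ c z, evUnit f frame₀.gen (e c) (pt z) = (c : ℂ[X]).eval z)
    (c : degreeLT ℂ (2 * 1 + 1)) :
    standardDiff (cotangentFSheaf f) (structureFSheaf f) ℂ (e c) = 0 ↔ defect p q c = 0 := by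
  obtain ⟨e', he'⟩ := exists_linearEquiv_direct hpq hd hdeg hf
  obtain ⟨b, hb⟩ := e'.surjective (standardDiff (cotangentFSheaf f) (structureFSheaf f) ℂ (e c))
  have hq0 : q ≠ 0 := by
    rintro rfl
    have := natDegree_eq_zero_of_isUnit (isCoprime_zero_right.1 hpq)
    rw [this, natDegree_zero, max_self] at hdeg
    omega
  have hq : IsQuot f pt p q := hf ▸ isQuot_pt hpq
  have hbc : (b : ℂ[X]) = defect p q c := by
    refine sub_eq_zero.1 ((mul_eq_zero.1 (funext (q := 0) fun z => ?_)).resolve_right hq0)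
    rw [eval_mul, eval_zero, mul_eq_zero]
    by_cases hz : q.eval z = 0
    · exact Or.inr hz
    · left
      have hfz : f (pt z) = pt (p.eval z / q.eval z) := (hq z).1 hz
      have h₁ := (he' b z hz).symm.trans
        ((congrArg (fun v => evDirect f frame₀.gen v (pt z)) hb).trans
          (evDirect_standardDiff f (e c) (hq.mem_U₀.2 hz)))
      rw [hfz, he, he, (hasDerivAt_of_eq_rat hf hz).deriv, ← eval_defect c hz,
        div_left_inj' (pow_ne_zero 2 hz)] at h₁
      rw [eval_sub, h₁, sub_self]
  rw [← hb, ← hbc]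
  exact (map_eq_zero_iff e' e'.injective).trans (ZeroMemClass.coe_eq_zero).symm

theorem finrank_hom_eq_zero (hd1 : 1 < d) :
    Module.finrank ℂ (cotangentFSheaf f ⟶ structureFSheaf f) = 0 := by
  obtain ⟨e, he⟩ := exists_linearEquiv_unit f
  rw [← LinearMap.finrank_range_of_inj
    (homToCofree_injective (F := cotangentFSheaf f) (G := structureFSheaf f) ℂ),
    range_homToCofree]
  rw [LinearMap.ker_eq_bot'.2 fun v hv => ?_, finrank_bot]
  obtain ⟨c, rfl⟩ := e.surjective v
  rw [standardDiff_eq_zero_iff hpq hd hdeg hf he] at hv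
  rw [defect_eq_zero_of_one_lt hpq (hdeg ▸ hd1) hv, map_zero]

omit hd in
theorem finrank_hom_eq_one (hd1 : d = 1) (hne : (f : sphere → sphere) ≠ id) :
    Module.finrank ℂ (cotangentFSheaf f ⟶ structureFSheaf f) = 1 := by
  obtain ⟨e, he⟩ := exists_linearEquiv_unit f
  rw [hd1] at hdeg
  rw [hf] at hne
  have hker : LinearMap.ker (standardDiff (cotangentFSheaf f) (structureFSheaf f) ℂ) =
      Submodule.span ℂ {e (fixedPointField p q)} := by
    refine le_antisymm (fun v hv => ?_) ((Submodule.span_singleton_le_iff_mem _ _).2 ?_)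
    · obtain ⟨c, rfl⟩ := e.surjective v
      obtain ⟨t, rfl⟩ := exists_smul_fixedPointField hpq hdeg hne
        ((standardDiff_eq_zero_iff hpq le_rfl hdeg hf he c).1 hv)
      rw [map_smul]
      exact Submodule.smul_mem _ _ (Submodule.mem_span_singleton_self _)
    · exact (standardDiff_eq_zero_iff hpq le_rfl hdeg hf he _).2 (defect_fixedPointField hdeg)
  rw [← LinearMap.finrank_range_of_inj
    (homToCofree_injective (F := cotangentFSheaf f) (G := structureFSheaf f) ℂ),
    range_homToCofree, hker]
  exact finrank_span_singleton ((map_ne_zero_iff e e.injective).2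
    (fixedPointField_ne_zero hpq hdeg hne))

end RiemannSphere

/-! ### Holomorphic vector fields in coordinates -/

namespace RiemannSurface

variable {X : TopCat.{0}} [ChartedSpace ℂ X] [IsManifold 𝓘(ℂ) ∞ X]

/-- A vector field is holomorphic if and only if its coefficients in the charts are. -/
theorem isHolVectorField_iff {v : ∀ x : X, TangentSpace 𝓘(ℂ) x} : IsHolVectorField v ↔
    ∀ x, HolAt (fun y => differential (chartAt ℂ x) y (v y)) x := by
  have : IsManifold 𝓘(ℂ) 1 X := IsManifold.of_le (n := ∞) (by norm_cast)
  refine forall_congr' fun x => (Bundle.contMDiffAt_section x).trans ?_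
  refine Filter.EventuallyEq.contMDiffAt_iff ?_
  filter_upwards [(chartAt ℂ x).open_source.mem_nhds (mem_chart_source ℂ x)] with y hy
  have h := TangentBundle.continuousLinearMapAt_trivializationAt (I := 𝓘(ℂ)) (𝕜 := ℂ) hy
  have h' := congrArg (fun L => L (v y)) h
  refine Eq.trans ?_ h'
  exact (Bundle.Trivialization.continuousLinearMapAt_apply_of_mem (R := ℂ)
    (trivializationAt ℂ (TangentSpace 𝓘(ℂ) : X → Type) x) hy (v y)).symm

theorem IsHolVectorField.holAt {v : ∀ x : X, TangentSpace 𝓘(ℂ) x} (hv : IsHolVectorField v)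
    {h : X → ℂ} {x : X} (hh : HolAt h x) : HolAt (fun y => differential h y (v y)) x := by
  obtain ⟨g, hg, he⟩ := exists_eq_smul_mfderiv_chart hh
  refine HolAt.congr (ContMDiffAt.mul hg (isHolVectorField_iff.1 hv x)) ?_
  filter_upwards [he] with y hy
  rw [hy]
  rfl

end RiemannSurface

namespace RiemannSphere

open RiemannSurface Polynomial SheafOfModules CategoryTheory.Endofunctor.Coalgebra

theorem dval_chart₁ {x : sphere} (h₀ : x ∈ U₀) (h₁ : x ∈ U₁) :
    dval chart₁ x = -(wFun x * wFun x) * dval chart₀ x := by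
  have h := (val_transition chart₀_mem chart₁_mem x ⟨h₀, h₁⟩).symm.trans
    (congrArg (fun r : holSec (U₀ ⊓ U₁) => RiemannSurface.val r x ⟨h₀, h₁⟩) transition_eq)
  exact (div_eq_iff (dval_chart_ne_zero chart₀_mem h₀)).1 h

/-- A tangent vector, as a complex number in the trivialization of the tangent space which is
part of the definition of a manifold. -/
def tval {x : sphere} (v : TangentSpace 𝓘(ℂ) x) : ℂ := v

theorem differential_apply (h : sphere → ℂ) {x : sphere} (v : TangentSpace 𝓘(ℂ) x) :
    differential h x v = dval h x * tval v := by
  have h1 : v = (tval v • (1 : ℂ) : ℂ) := (mul_one (M := ℂ) v).symm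
  have h2 := (differential h x).map_smul (tval v) (1 : ℂ)
  refine (congrArg (differential h x) h1).trans (h2.trans (mul_comm _ _))

theorem chartAt_eq (x : sphere) : chartAt ℂ x = chart₀ ∨ chartAt ℂ x = chart₁ :=
  chart_mem_atlas ℂ x

/-- A pair of functions related by the transition function defines a vector field. -/
theorem exists_vectorField {m₀ m₁ : sphere → ℂ} (h₀ : ∀ x ∈ U₀, HolAt m₀ x)
    (h₁ : ∀ x ∈ U₁, HolAt m₁ x)
    (h : ∀ x, x ∈ U₀ → x ∈ U₁ → m₁ x = -(wFun x * wFun x) * m₀ x) :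
    ∃ v : ∀ x : sphere, TangentSpace 𝓘(ℂ) x, IsHolVectorField v ∧
      (∀ x ∈ U₀, differential chart₀ x (v x) = m₀ x) ∧
        ∀ x ∈ U₁, differential chart₁ x (v x) = m₁ x := by
  classical
  let v : ∀ x : sphere, TangentSpace 𝓘(ℂ) x := fun x =>
    (if x ∈ U₀ then m₀ x / dval chart₀ x else m₁ x / dval chart₁ x : ℂ)
  have e₀ : ∀ x ∈ U₀, differential chart₀ x (v x) = m₀ x := fun x hx => by
    have hv : tval (v x) = m₀ x / dval chart₀ x := if_pos hx
    rw [differential_apply, hv, mul_div_cancel₀ _ (dval_chart_ne_zero chart₀_mem hx)]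
  have e₁ : ∀ x ∈ U₁, differential chart₁ x (v x) = m₁ x := fun x hx => by
    by_cases hx₀ : x ∈ U₀
    · have := e₀ x hx₀
      rw [differential_apply] at this ⊢
      rw [dval_chart₁ hx₀ hx, mul_assoc, this, h x hx₀ hx]
    · have hv : tval (v x) = m₁ x / dval chart₁ x := if_neg hx₀
      rw [differential_apply, hv, mul_div_cancel₀ _ (dval_chart_ne_zero chart₁_mem hx)]
  refine ⟨v, isHolVectorField_iff.2 fun x => ?_, e₀, e₁⟩
  have hx := mem_chart_source ℂ x
  obtain hc | hc := chartAt_eq x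
  · rw [hc] at hx ⊢
    refine (h₀ x hx).congr ?_
    filter_upwards [U₀.isOpen.mem_nhds hx] with y hy
    exact e₀ y hy
  · rw [hc] at hx ⊢
    refine (h₁ x hx).congr ?_
    filter_upwards [U₁.isOpen.mem_nhds hx] with y hy
    exact e₁ y hy

/-- A holomorphic vector field is given by a polynomial of degree at most two. -/
theorem IsHolVectorField.exists_polynomial {v : ∀ x : sphere, TangentSpace 𝓘(ℂ) x}
    (hv : IsHolVectorField v) : ∃ c : degreeLT ℂ (2 * 1 + 1),
      (∀ z, differential chart₀ (pt z) (v (pt z)) = (c : ℂ[X]).eval z) ∧ (c = 0 → v = 0) := by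
  -- the choice of the map is irrelevant, as only the underlying sheaves matter here
  let f : HolEnd sphere := ⟨id, contMDiff_id⟩
  obtain ⟨e, he⟩ := exists_linearEquiv_unit f
  obtain ⟨k, hk₀, hk₁⟩ := (isPairSpace_evUnit f).exist
    (fun x => differential chart₀ x (v x)) (fun x => differential chart₁ x (v x))
    (fun x hx => hv.holAt (holAt_chart chart₀_mem hx))
    (fun x hx => hv.holAt (holAt_chart chart₁_mem hx)) fun x h₀ h₁ => by
      have h := dval_chart₁ (x := x) h₀ h₁
      rw [differential_apply, differential_apply, id_eq, h, mul_assoc]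
  obtain ⟨c, rfl⟩ := e.surjective k
  refine ⟨c, fun z => (hk₀ (pt z) (pt_mem_U₀ z)).symm.trans (he c z), ?_⟩
  rintro rfl
  rw [map_zero] at hk₀ hk₁
  funext x
  obtain hx | hx := U₀_or_U₁ x
  · have h := (congrFun (map_zero (evUnit f frame₀.gen)) x).symm.trans (hk₀ x hx)
    rw [differential_apply] at h
    exact (mul_eq_zero.1 h.symm).resolve_left (dval_chart_ne_zero chart₀_mem hx)
  · have h := (congrFun (map_zero (evUnit f frame₁.gen)) x).symm.trans (hk₁ x hx)
    rw [differential_apply] at h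
    exact (mul_eq_zero.1 h.symm).resolve_left (dval_chart_ne_zero chart₁_mem hx)

variable {f : HolEnd sphere} {p q : ℂ[X]} (hf : (f : sphere → sphere) = rat p q)

include hf

/-- Invariance of a vector field at a point where neither the point nor its image is infinite. -/
theorem invariant_pt_iff {v : ∀ x : sphere, TangentSpace 𝓘(ℂ) x} {c : degreeLT ℂ (2 * 1 + 1)}
    (hc : ∀ z, differential chart₀ (pt z) (v (pt z)) = (c : ℂ[X]).eval z) {z : ℂ}
    (hz : q.eval z ≠ 0) :
    v (f (pt z)) = mfderiv 𝓘(ℂ) 𝓘(ℂ) f (pt z) (v (pt z)) ↔ (defect p q c).eval z = 0 := by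
  have hfz : f (pt z) = pt (p.eval z / q.eval z) := by rw [hf, rat_pt, if_neg hz]
  have hmem : f (pt z) ∈ U₀ := hfz ▸ pt_mem_U₀ _
  have h₁ : differential chart₀ (f (pt z)) (v (f (pt z))) =
      (c : ℂ[X]).eval (p.eval z / q.eval z) := by
    rw [← hc, ← hfz]
  have h₂ : differential chart₀ (f (pt z)) (mfderiv 𝓘(ℂ) 𝓘(ℂ) f (pt z) (v (pt z))) =
      (derivNum p q).eval z / q.eval z ^ 2 * (c : ℂ[X]).eval z := by
    have h := differential_comp (h := (chart₀ : sphere → ℂ)) (f := f) (y := pt z)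
      ((holAt_chart chart₀_mem hmem).mdifferentiableAt (by simp))
      (f.contMDiff.mdifferentiableAt (by simp))
    have h' := congrArg (fun L : Cotangent (pt z) => L (v (pt z)))
      (h.symm.trans (differential_chart₀_comp f hmem))
    rw [(hasDerivAt_of_eq_rat hf hz).deriv] at h'
    exact h'.trans (congrArg (_ * ·) (hc z))
  have hne := dval_chart_ne_zero chart₀_mem hmem
  have hinj : v (f (pt z)) = mfderiv 𝓘(ℂ) 𝓘(ℂ) f (pt z) (v (pt z)) ↔
      differential chart₀ (f (pt z)) (v (f (pt z))) =
        differential chart₀ (f (pt z)) (mfderiv 𝓘(ℂ) 𝓘(ℂ) f (pt z) (v (pt z))) := by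
    rw [differential_apply, differential_apply]
    exact (mul_right_inj' hne).symm
  rw [hinj, h₁, h₂, eq_comm, ← sub_eq_zero, ← eval_defect c hz, div_eq_zero_iff,
    or_iff_left (pow_ne_zero 2 hz)]

omit hf in
/-- Both sides of the equation of invariance are continuous, so that it is enough to check it
outside a finite set. -/
theorem invariant_of_pt (hq : q ≠ 0) {v : ∀ x : sphere, TangentSpace 𝓘(ℂ) x}
    (hv : IsHolVectorField v)
    (h : ∀ z, q.eval z ≠ 0 → v (f (pt z)) = mfderiv 𝓘(ℂ) 𝓘(ℂ) f (pt z) (v (pt z))) (x : sphere) :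
    v (f x) = mfderiv 𝓘(ℂ) 𝓘(ℂ) f x (v x) := by
  obtain ⟨e, he, hx⟩ : ∃ e ∈ atlas ℂ sphere, f x ∈ e.source :=
    ⟨chartAt ℂ (f x), chart_mem_atlas ℂ _, mem_chart_source ℂ _⟩
  have hpre : ∀ᶠ y in 𝓝 x, f y ∈ e.source :=
    f.contMDiff.continuous.continuousAt.preimage_mem_nhds (e.open_source.mem_nhds hx)
  have h₁ : ContinuousAt (fun y => differential e (f y) (v (f y))) x :=
    ((hv.holAt (holAt_chart he hx)).comp x f.contMDiff.contMDiffAt).continuousAt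
  have h₂ : ContinuousAt (fun y => differential (e ∘ f) y (v y)) x :=
    (hv.holAt ((holAt_chart he hx).comp x f.contMDiff.contMDiffAt)).continuousAt
  have hcomp (y : sphere) (hy : f y ∈ e.source) : differential (e ∘ f) y (v y) =
      differential e (f y) (mfderiv 𝓘(ℂ) 𝓘(ℂ) f y (v y)) :=
    congrArg (fun L : Cotangent y => L (v y)) (differential_comp
      ((holAt_chart he hy).mdifferentiableAt (by simp)) (f.contMDiff.mdifferentiableAt (by simp)))
  have hfin : (insert (sinv (pt 0)) (pt '' {z | q.IsRoot z})).Finite :=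
    ((finite_setOfPred_isRoot hq).image pt).insert _
  have : (𝓝[≠] x).NeBot := OnePoint.nhdsNE_neBot (X := ℂ) x
  have hev : ∀ᶠ y in 𝓝[≠] x, differential e (f y) (v (f y)) = differential (e ∘ f) y (v y) := by
    filter_upwards [nhdsNE_of_nhdsNE_sdiff_finite univ_mem hfin,
      hpre.filter_mono nhdsWithin_le_nhds] with y hy hy'
    obtain ⟨z, rfl⟩ | rfl := sphere_cases y
    · rw [hcomp _ hy', h z fun hz => hy.2 (Or.inr ⟨z, hz, rfl⟩)]
    · exact absurd (Or.inl rfl) hy.2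
  have hlim := tendsto_nhds_unique_of_eventuallyEq (h₁.tendsto.mono_left nhdsWithin_le_nhds)
    (h₂.tendsto.mono_left nhdsWithin_le_nhds) hev
  rw [hcomp x hx, differential_apply, differential_apply] at hlim
  exact mul_left_cancel₀ (M₀ := ℂ) (dval_chart_ne_zero he hx) hlim

end RiemannSphere

/-! ### Invariant vector fields and the dimensions of the Ext groups -/

namespace RiemannSphere

open RiemannSurface Polynomial SheafOfModules CategoryTheory.Endofunctor.Coalgebra

theorem exists_vectorField_of_polynomial (c : degreeLT ℂ (2 * 1 + 1)) :
    ∃ v : ∀ x : sphere, TangentSpace 𝓘(ℂ) x, IsHolVectorField v ∧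
      ∀ z, differential chart₀ (pt z) (v (pt z)) = (c : ℂ[X]).eval z := by
  let f : HolEnd sphere := ⟨id, contMDiff_id⟩
  obtain ⟨e, he⟩ := exists_linearEquiv_unit f
  have h := isPairSpace_evUnit f
  obtain ⟨v, hv, hv₀, -⟩ := exists_vectorField (h.hol₀ (e c)) (h.hol₁ (e c)) (h.compat (e c))
  exact ⟨v, hv, fun z => (hv₀ (pt z) (pt_mem_U₀ z)).trans (he c z)⟩

theorem vectorField_ne_zero {c : degreeLT ℂ (2 * 1 + 1)} (hc : c ≠ 0)
    {v : ∀ x : sphere, TangentSpace 𝓘(ℂ) x}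
    (h : ∀ z, differential chart₀ (pt z) (v (pt z)) = (c : ℂ[X]).eval z) : v ≠ 0 := by
  rintro rfl
  refine hc (Subtype.ext (funext fun z => ?_))
  rw [← h, ZeroMemClass.coe_zero, eval_zero]
  exact map_zero (differential chart₀ (pt z))

theorem ne_zero_of_isCoprime {p q : ℂ[X]} (hpq : IsCoprime p q) {d : ℕ} (hd : 1 ≤ d)
    (hdeg : max p.natDegree q.natDegree = d) : q ≠ 0 := by
  rintro rfl
  have := natDegree_eq_zero_of_isUnit (isCoprime_zero_right.1 hpq)
  rw [this, natDegree_zero, max_self] at hdeg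
  omega

theorem exists_invariant_vectorField_iff {f : HolEnd sphere} {p q : ℂ[X]} (hpq : IsCoprime p q)
    {d : ℕ} (hd : 1 ≤ d) (hdeg : max p.natDegree q.natDegree = d)
    (hf : (f : sphere → sphere) = rat p q) :
    (∃ v : ∀ x : sphere, TangentSpace 𝓘(ℂ) x, IsHolVectorField v ∧ v ≠ 0 ∧
      ∀ x, v (f x) = mfderiv 𝓘(ℂ) 𝓘(ℂ) f x (v x)) ↔ d = 1 := by
  have hq0 := ne_zero_of_isCoprime hpq hd hdeg
  constructor
  · rintro ⟨v, hv, hv0, h⟩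
    by_contra hd1
    obtain ⟨c, hc, hc0⟩ := IsHolVectorField.exists_polynomial hv
    refine hv0 (hc0 (defect_eq_zero_of_one_lt hpq (by omega) ?_))
    refine (mul_eq_zero.1 (funext (q := 0) fun z => ?_)).resolve_right hq0
    rw [eval_mul, eval_zero, mul_eq_zero, or_iff_not_imp_right]
    exact fun hz => (invariant_pt_iff hf hc hz).1 (h _)
  · rintro rfl
    by_cases hid : rat p q = id
    · have hone : (1 : ℂ[X]) ∈ degreeLT ℂ (2 * 1 + 1) :=
        mem_degreeLT.2 (degree_one_le.trans_lt (by norm_num))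
      obtain ⟨v, hv, hv'⟩ := exists_vectorField_of_polynomial ⟨1, hone⟩
      refine ⟨v, hv, vectorField_ne_zero (fun h => one_ne_zero (congrArg Subtype.val h)) hv', ?_⟩
      have key (g : sphere → sphere) (hg : g = id) (x : sphere) :
          v (g x) = mfderiv 𝓘(ℂ) 𝓘(ℂ) g x (v x) := by
        subst hg
        rw [mfderiv_id]
        rfl
      exact key f (hf.trans hid)
    · obtain ⟨v, hv, hv'⟩ := exists_vectorField_of_polynomial (fixedPointField p q)
      refine ⟨v, hv, vectorField_ne_zero (fixedPointField_ne_zero hpq hdeg hid) hv',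
        invariant_of_pt hq0 hv fun z hz => (invariant_pt_iff hf hv' hz).2 ?_⟩
      rw [defect_fixedPointField hdeg, eval_zero]

section

variable {f : HolEnd sphere} {p q : ℂ[X]} (hpq : IsCoprime p q) {d : ℕ} (hd : 1 ≤ d)
  (hdeg : max p.natDegree q.natDegree = d) (hf : (f : sphere → sphere) = rat p q)

theorem subsingleton_extCotangent (f : HolEnd sphere) {n : ℕ} (hn : 2 ≤ n) :
    Subsingleton (extCotangent f n) := by
  obtain ⟨k, rfl⟩ : ∃ k, n = k + 1 + 1 := ⟨n - 2, by omega⟩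
  have h₀ : CofreeAcyclic (cotangentFSheaf f) (structureFSheaf f).V :=
    cofreeAcyclic_structureSheaf f
  have h₁ : CofreeAcyclic (cotangentFSheaf f) ((direct f).obj (structureFSheaf f).V) :=
    cofreeAcyclic_direct_structureSheaf f
  exact subsingleton_of_forall_eq 0 (ext_add_two_eq_zero h₀ h₁ k)

theorem finrank_unit (f : HolEnd sphere) :
    Module.Finite ℂ (cotangentFSheaf f ⟶ cofreeObj (direct f) (structureFSheaf f).V) ∧
    Module.finrank ℂ (cotangentFSheaf f ⟶ cofreeObj (direct f) (structureFSheaf f).V) = 3 := by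
  obtain ⟨e, -⟩ := exists_linearEquiv_unit f
  have e' := (degreeLTEquiv ℂ (2 * 1 + 1)).symm.trans e
  exact ⟨Module.Finite.equiv e', e'.finrank_eq.symm.trans (Module.finrank_fin_fun ℂ)⟩

include hpq hd hdeg hf

theorem finrank_direct :
    Module.Finite ℂ (cotangentFSheaf f ⟶
      cofreeObj (direct f) ((direct f).obj (structureFSheaf f).V)) ∧
    Module.finrank ℂ (cotangentFSheaf f ⟶
      cofreeObj (direct f) ((direct f).obj (structureFSheaf f).V)) = 2 * d + 1 := by
  obtain ⟨e, -⟩ := exists_linearEquiv_direct hpq hd hdeg hf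
  have e' := (degreeLTEquiv ℂ (2 * d + 1)).symm.trans e
  exact ⟨Module.Finite.equiv e', e'.finrank_eq.symm.trans (Module.finrank_fin_fun ℂ)⟩

theorem finite_extCotangent (n : ℕ) : Module.Finite ℂ (extCotangent f n) := by
  have := (finrank_unit f).1
  have := (finrank_direct hpq hd hdeg hf).1
  have h₀ : CofreeAcyclic (cotangentFSheaf f) (structureFSheaf f).V :=
    cofreeAcyclic_structureSheaf f
  obtain rfl | rfl | hn : n = 0 ∨ n = 1 ∨ 2 ≤ n := by omega
  · exact finite_ext_zero ℂ
  · exact finite_ext_one h₀ ℂ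
  · have := subsingleton_extCotangent f hn
    exact inferInstance

/-- The Euler characteristic, with `3 = dim H⁰(T)` and `2 d + 1 = dim H⁰(f^* T)`. -/
theorem finrank_extCotangent_one_add :
    Module.finrank ℂ (extCotangent f 1) + 3 =
      2 * d + 1 + Module.finrank ℂ (cotangentFSheaf f ⟶ structureFSheaf f) := by
  obtain ⟨_, h₁⟩ := finrank_unit f
  obtain ⟨_, h₂⟩ := finrank_direct hpq hd hdeg hf
  have h := finrank_ext_one_add (F := cotangentFSheaf f) (G := structureFSheaf f)
    (cofreeAcyclic_structureSheaf f) ℂ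
  rw [h₁, h₂] at h
  exact h

end

theorem finrank_extCotangent_zero (f : HolEnd sphere) :
    Module.finrank ℂ (extCotangent f 0) =
      Module.finrank ℂ (cotangentFSheaf f ⟶ structureFSheaf f) :=
  (Abelian.Ext.linearEquiv₀ (R := ℂ)).finrank_eq

end RiemannSphere

theorem mainTheorem9 (d : ℕ) (hd : 1 ≤ d) (f : RiemannSurface.HolEnd RiemannSphere.sphere)
    (hf : RiemannSphere.IsRationalOfDegree f d) :
    (∀ q : ℕ, Module.Finite ℂ (RiemannSurface.extCotangent f q)) ∧
    ((f : RiemannSphere.sphere → RiemannSphere.sphere) ≠ id → ∀ q : ℕ,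
      Module.finrank ℂ (RiemannSurface.extCotangent f q) =
        if d = 1 then (if q = 0 ∨ q = 1 then 1 else 0)
        else (if q = 1 then 2 * d - 2 else 0)) ∧
    (∀ q : ℕ, 2 ≤ q → Subsingleton (RiemannSurface.extCotangent f q)) ∧
    ((Module.finrank ℂ (RiemannSurface.extCotangent f 1) : ℤ) -
      (Module.finrank ℂ (RiemannSurface.extCotangent f 0) : ℤ) = 2 * (d : ℤ) - 2) ∧
    ((∃ v : ∀ x : RiemannSphere.sphere, TangentSpace 𝓘(ℂ) x,
      RiemannSurface.IsHolVectorField v ∧ v ≠ 0 ∧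
        ∀ x, v (f x) = mfderiv 𝓘(ℂ) 𝓘(ℂ) f x (v x)) ↔ d = 1) := by
  obtain ⟨p, q, hpq, hdeg, hf'⟩ := hf
  have hfr : (f : RiemannSphere.sphere → RiemannSphere.sphere) = RiemannSphere.rat p q := hf'
  have hone := RiemannSphere.finrank_extCotangent_one_add hpq hd hdeg hfr
  have hzero := RiemannSphere.finrank_extCotangent_zero f
  refine ⟨RiemannSphere.finite_extCotangent hpq hd hdeg hfr, fun hne n => ?_,
    fun _ hn => RiemannSphere.subsingleton_extCotangent f hn, by omega,
    RiemannSphere.exists_invariant_vectorField_iff hpq hd hdeg hfr⟩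
  have htwo : 2 ≤ n → Module.finrank ℂ (RiemannSurface.extCotangent f n) = 0 := fun hn =>
    have := RiemannSphere.subsingleton_extCotangent f hn
    Module.finrank_zero_of_subsingleton
  have hcases : n = 0 ∨ n = 1 ∨ 2 ≤ n := by omega
  by_cases hd1 : d = 1
  · have h := RiemannSphere.finrank_hom_eq_one hpq hdeg hfr hd1 hne
    rw [if_pos hd1]
    obtain rfl | rfl | hn := hcases
    · rw [if_pos (Or.inl rfl), hzero, h]
    · rw [if_pos (Or.inr rfl)]
      omega
    · rw [if_neg (by omega), htwo hn]
  · have h := RiemannSphere.finrank_hom_eq_zero hpq hd hdeg hfr (by omega)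
    rw [if_neg hd1]
    obtain rfl | rfl | hn := hcases
    · rw [if_neg (by omega), hzero, h]
    · rw [if_pos rfl]
      omega
    · rw [if_neg (by omega), htwo hn]
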